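/- **Setting.** For each $n$ let $W_i=(Y_i,X_i,Z_i)\in\mathbb R\times\mathbb R\times\mathbb R^{d_n}$, $i\in[n]=\{1,\dots,n\}$, be i.i.d. The law of $X_i$ is fixed; $d_n$ and the conditional law of $(Y_i,Z_i)$ given $X_i=x$ may vary with $n$ (conditional moments given $X_i=x$ are taken under a fixed version of this regular conditional law). Let $\mathcal X$ be the support of $X_i$ and $\mathcal X_h=\mathcal X\cap[-h,h]$. For a function $\eta$ on $\mathbb R^{d_n}$ put $M_i(\eta)=Y_i-\eta(Z_i)$. The indices are split, independently of the data, into a fixed number $S$ of folds $I_1,\dots,I_S$ of equal size (up to one unit); $s(i)$ is the fold containing $i$, and $\widehat\eta_s$ is an estimated function computed, by a rule that is measurable in the data and its argument, from $(W_j)_{j\notin I_s}$ only. Fix integers $p\ge 0$ and $R\ge1$. With $\widetilde X_{p,i}=(1,X_i,\dots,X_i^p)^\top$, $K_h(x)=K(x/h)/h$, $K_h^+(x)=K_h(x)\mathbf 1\{x\ge0\}$, $K_h^-(x)=K_h(x)\mathbf 1\{x<0\}$, define, for $0\le v\le p$, $w_{i,v,p}(h)=w^+_{i,v,p}(h)-w^-_{i,v,p}(h)$,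 where $w^\star_{i,v,p}(h)$ is the coordinate (numbered from $0$) with index $v$ of $\big(\sum_{k}K_h^\star(X_k)\widetilde X_{p,k}\widetilde X_{p,k}^\top\big)^{-1}K_h^\star(X_i)\widetilde X_{p,i}$. Let $\mathcal R_i$ be the set of the $R$ nearest neighbours of unit $i$, in terms of the running variable, among the other units on the same side of the cutoff $0$ (ties broken by index; all such units if there are fewer than $R$). Set $$\widehat{se}^2_{v,p}(h;\widehat\eta)=\sum_{i=1}^n w_{i,v,p}^2(h)\,\widehat\sigma_i^2(\widehat\eta),\qquad \widehat\sigma_i^2(\widehat\eta)=\frac{R}{R+1}\Big(M_i(\widehat\eta_{s(i)})-\frac1R\sum_{j\in\mathcal R_i}M_j(\widehat\eta_{s(j)})\Big)^2,$$ $$se^2_{v,p}(h;\bar\eta)=\sum_{i=1}^n w_{i,v,p}^2(h)\,\mathbb V[M_i(\bar\eta)|X_i].$$ **Assumptions.** Let $\mathcal E_n$ be the set of measurable $\eta$ for which $\mathbb E[\eta(Z_i)|X_i=x]$ exists and is twice continuously differentiable in $x$ in a neighbourhood of $0$. For each $n$ let $\mathcal T_n\subset\mathcal E_n$ and $\bar\eta=\bar\eta_n\in\mathcal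 T_n$. 1. $\mathbb P(\widehat\eta_s\in\mathcal T_n)\to1$ for all $s\in[S]$, and $\sup_{\eta\in\mathcal T_n}\sup_{x\in\mathcal X_h}\mathbb E[(\eta(Z_i)-\bar\eta(Z_i))^2|X_i=x]=O(r_n^2)$ for some $r_n=o(1)$. The same holds with $\mathcal X_h$ replaced by $\mathcal X\cap\widetilde{\mathcal X}_h$, where the $\widetilde{\mathcal X}_h\supset\mathcal X_h$ are open sets (depending on $n$) that contain all points of $\mathcal X$ at distance less than $\delta_n$ from $\mathcal X_h$, for some $\delta_n$ with $n\delta_n\to\infty$. 2. For all sufficiently large $n$ and all $\eta\in\mathcal T_n$, $\mathbb E[\eta(Z_i)-\bar\eta(Z_i)|X_i=x]$ is twice continuously differentiable on $\mathcal X_h\setminus\{0\}$, and for $j\in\{1,2\}$, $\sup_{\eta\in\mathcal T_n}\sup_{x\in\mathcal X_h\setminus\{0\}}|\partial_x^j\mathbb E[\eta(Z_i)-\bar\eta(Z_i)|X_i=x]|=O(v_{j,n})$ for some $v_{j,n}=o(1)$. 3. $X_i$ has a density that is continuous and bounded away from zero on an open neighbourhood of $0$; $K$ is a bounded symmetric probability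 density, continuous on its (closed) support and zero outside $[-1,1]$; $h=h_n>0$, $h\to0$, $nh\to\infty$. 4. There are constants $C>0$, $L\ge 0$, $q>2$ and $B$, not depending on $n$, such that for all $n$: on each of $\mathcal X\cap(0,\infty)$ and $\mathcal X\cap(-\infty,0)$, $\mathbb E[M_i(\bar\eta)|X_i=x]$ is twice continuously differentiable with $L$-Lipschitz second derivative bounded in absolute value by $C$, and both $\mathbb E[M_i(\bar\eta)|X_i=x]$ and $\mathbb V[M_i(\bar\eta)|X_i=x]$ are $L$-Lipschitz; $\mathbb E[|M_i(\bar\eta)-\mathbb E[M_i(\bar\eta)|X_i]|^q\,|X_i=x]$ exists and is at most $C$ for $x\in\mathcal X$; $\mathbb V[M_i(\bar\eta)|X_i=x]\ge1/C$ for $x\in\mathcal X\setminus\{0\}$; and $\sup_{\eta\in\mathcal T_n}\sup_{x\in\mathcal X\cap\widetilde{\mathcal X}_h}\mathbb E[(M_i(\eta)-\mathbb E[M_i(\eta)|X_i])^4|X_i=x]$ exists and is at most $B$. 5. For all $0\le v\le p$, $\sum_{i\in[n]}w_{i,v,p}^2(h)\,\iota_i(\widehat\eta)=o_P((nh^{1+2v})^{-1})$,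 where $$\iota_i(\widehat\eta)=\sum_{(j,l)\in\mathcal R_i^2,\ (j,l)\notin I_{s(i)}^2}\Big((\widehat\eta_{s(i)}(Z_i)-\bar\eta(Z_i))-(\widehat\eta_{s(j)}(Z_j)-\bar\eta(Z_j))\Big)\big(M_i(\bar\eta)-M_l(\bar\eta)\big).$$ **Conclusion.** For all $0\le v\le p$, $$nh^{1+2v}\big(\widehat{se}^2_{v,p}(h;\widehat\eta)-se^2_{v,p}(h;\bar\eta)\big)=o_P(1).$$ -/

import Mathlib

open MeasureTheory ProbabilityTheory Filter Topology
open scoped NNReal ENNReal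

noncomputable section

namespace FlexRD

universe u

/-- Covariate space of dimension `d`. -/
abbrev Cov (d : ℕ) : Type := Fin d → ℝ

/-- One observation, in the order (running variable `X`, (outcome `Y`, covariates `Z`)). -/
abbrev Obs (d : ℕ) : Type := ℝ × ℝ × Cov d

/-- The adjusted outcome `M(η) = Y - η(Z)`. -/
def adj {d : ℕ} (η : Cov d → ℝ) (yz : ℝ × Cov d) : ℝ := yz.1 - η yz.2

/-- A triangular array of RD samples with cross-fitting, for a fixed law `μ` of the running
variable and `S` folds. The covariate dimension and the conditional law `κ n x` of `(Y, Z)` given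
`X = x` may change with the sample size `n`. -/
structure Design (μ : Measure ℝ) (S : ℕ) where
  dim : ℕ → ℕ
  /-- conditional distribution of `(Y, Z)` given `X = x` at sample size `n` -/
  κ : ∀ n, Kernel ℝ (ℝ × Cov (dim n))
  markov : ∀ n, IsMarkovKernel (κ n)
  Ω : ℕ → Type u
  mΩ : ∀ n, MeasurableSpace (Ω n)
  P : ∀ n, Measure (Ω n)
  prob : ∀ n, IsProbabilityMeasure (P n)
  /-- the sample of size `n` -/
  W : ∀ n, Fin n → Ω n → Obs (dim n)
  measurable_W : ∀ n i, Measurable (W n i)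
  map_W : ∀ n i, (P n).map (W n i) = μ ⊗ₘ κ n
  indep_W : ∀ n, iIndepFun (W n) (P n)
  /-- `fold n ω i` is the fold `s(i)` containing unit `i`; the split may be random -/
  fold : ∀ n, Ω n → Fin n → Fin S
  measurable_fold : ∀ n, Measurable (fold n)
  /-- the split does not depend on the data -/
  indep_fold : ∀ n, IndepFun (fold n) (fun ω i => W n i ω) (P n)
  /-- folds have equal size, up to one unit when `S` does not divide `n` -/
  fold_balanced : ∀ n ω s t,
    (Finset.univ.filter fun i => fold n ω i = s).card
      ≤ (Finset.univ.filter fun i => fold n ω i = t).card + 1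
  /-- `est n I w` is the estimated adjustment function computed from the observations
  `w = (W_i)_{i ∈ I}` -/
  est : ∀ n, ∀ I : Finset (Fin n), (I → Obs (dim n)) → Cov (dim n) → ℝ
  measurable_est : ∀ n I, Measurable (Function.uncurry (est n I))

attribute [instance] Design.markov Design.mΩ Design.prob

/-! ### Local polynomial weights and nearest neighbours, as functions of the realised `X_i` -/

/-- `(1, x, …, x ^ p)`. -/
def polyVec (p : ℕ) (x : ℝ) : Fin (p + 1) → ℝ := fun a => x ^ (a : ℕ)

/-- `K_h(x) = K(x / h) / h`. -/
def scaled (K : ℝ → ℝ) (h x : ℝ) : ℝ := K (x / h) / h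

/-- `K_h^+(x) = K_h(x) 1{x ≥ 0}`. -/
def scaledPos (K : ℝ → ℝ) (h x : ℝ) : ℝ := if 0 ≤ x then scaled K h x else 0

/-- `K_h^-(x) = K_h(x) 1{x < 0}`. -/
def scaledNeg (K : ℝ → ℝ) (h x : ℝ) : ℝ := if x < 0 then scaled K h x else 0

/-- `∑ i, k(X_i) X̃_{p,i} X̃_{p,i}ᵀ`. -/
def gram {n : ℕ} (k : ℝ → ℝ) (p : ℕ) (x : Fin n → ℝ) :
    Matrix (Fin (p + 1)) (Fin (p + 1)) ℝ :=
  ∑ i, k (x i) • Matrix.vecMulVec (polyVec p (x i)) (polyVec p (x i))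

/-- `e_vᵀ (∑ i, k(X_i) X̃_{p,i} X̃_{p,i}ᵀ)⁻¹ k(X_i) X̃_{p,i}`. -/
def sideWeight {n : ℕ} (k : ℝ → ℝ) (p : ℕ) (v : Fin (p + 1)) (x : Fin n → ℝ) (i : Fin n) : ℝ :=
  Matrix.mulVec (gram k p x)⁻¹ (k (x i) • polyVec p (x i)) v

/-- The weight `w_{i,v,p}(h)` of the jump estimator in the `v`-th derivative. -/
def weight {n : ℕ} (K : ℝ → ℝ) (h : ℝ) (p : ℕ) (v : Fin (p + 1)) (x : Fin n → ℝ)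
    (i : Fin n) : ℝ :=
  sideWeight (scaledPos K h) p v x i - sideWeight (scaledNeg K h) p v x i

/-- Unit `k` is a competitor of unit `i`: a different unit on the same side of the cutoff. -/
def Rival {n : ℕ} (x : Fin n → ℝ) (i k : Fin n) : Prop := k ≠ i ∧ (0 ≤ x k ↔ 0 ≤ x i)

/-- Unit `k` is closer to unit `i` than unit `j`; ties are broken by the index. -/
def Closer {n : ℕ} (x : Fin n → ℝ) (i k j : Fin n) : Prop :=
  |x k - x i| < |x j - x i| ∨ (|x k - x i| = |x j - x i| ∧ k < j)

open Classical in
/-- The `R` nearest neighbours of unit `i` among the other units on its side of the cutoff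
(all of them, if there are fewer than `R`). -/
def neighbors {n : ℕ} (R : ℕ) (x : Fin n → ℝ) (i : Fin n) : Finset (Fin n) :=
  Finset.univ.filter fun j =>
    Rival x i j ∧ (Finset.univ.filter fun k => Rival x i k ∧ Closer x i k j).card < R

/-- Nearest-neighbour variance estimate at unit `i` for the outcome vector `m`, with the
normalisation `R / (R + 1)`. -/
def nnVar {n : ℕ} (R : ℕ) (x m : Fin n → ℝ) (i : Fin n) : ℝ :=
  (R : ℝ) / (R + 1) * (m i - 1 / (R : ℝ) * ∑ j ∈ neighbors R x i, m j) ^ 2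

namespace Design

variable {μ : Measure ℝ} {S : ℕ} (A : Design.{u} μ S)

/-- The running variable of the sample of size `n`. -/
def X (n : ℕ) (ω : A.Ω n) (i : Fin n) : ℝ := (A.W n i ω).1

/-- The index set `I_s` of fold `s`. -/
def foldSet (n : ℕ) (ω : A.Ω n) (s : Fin S) : Finset (Fin n) :=
  Finset.univ.filter fun i => A.fold n ω i = s

/-- The estimate `η̂_s`, computed from the observations outside fold `s`. -/
def etaHat (n : ℕ) (ω : A.Ω n) (s : Fin S) : Cov (A.dim n) → ℝ :=
  A.est n (A.foldSet n ω s)ᶜ fun i => A.W n i ω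

/-- The generated outcome `M_i(η̂_{s(i)})`. -/
def genOutcome (n : ℕ) (ω : A.Ω n) (i : Fin n) : ℝ :=
  adj (A.etaHat n ω (A.fold n ω i)) (A.W n i ω).2

/-- The outcome `M_i(η)` for a given adjustment function. -/
def outcome (n : ℕ) (η : Cov (A.dim n) → ℝ) (ω : A.Ω n) (i : Fin n) : ℝ :=
  adj η (A.W n i ω).2

/-- The estimation error `η̂_{s(i)}(Z_i) - η̄(Z_i)`. -/
def adjError (n : ℕ) (ηbar : Cov (A.dim n) → ℝ) (ω : A.Ω n) (i : Fin n) : ℝ :=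
  A.etaHat n ω (A.fold n ω i) (A.W n i ω).2.2 - ηbar (A.W n i ω).2.2

/-- `E[M(η) | X = x]`. -/
def condMean (n : ℕ) (η : Cov (A.dim n) → ℝ) (x : ℝ) : ℝ := ∫ yz, adj η yz ∂(A.κ n x)

/-- `V[M(η) | X = x]`. -/
def condVar (n : ℕ) (η : Cov (A.dim n) → ℝ) (x : ℝ) : ℝ := variance (adj η) (A.κ n x)

/-- The feasible squared standard error. -/
def seHatSq (K : ℝ → ℝ) (h : ℕ → ℝ) (p R : ℕ) (v : Fin (p + 1)) (n : ℕ) (ω : A.Ω n) : ℝ :=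
  ∑ i, weight K (h n) p v (A.X n ω) i ^ 2 * nnVar R (A.X n ω) (A.genOutcome n ω) i

/-- The conditional variance `∑ i, w_i² V[M_i(η̄) | X_i]`. -/
def seSq (K : ℝ → ℝ) (h : ℕ → ℝ) (p : ℕ) (v : Fin (p + 1)) (n : ℕ)
    (ηbar : Cov (A.dim n) → ℝ) (ω : A.Ω n) : ℝ :=
  ∑ i, weight K (h n) p v (A.X n ω) i ^ 2 * A.condVar n ηbar (A.X n ω i)

/-- `T_n = o_P(1)`, along the sequence of probability spaces. -/
def LittleOP (T : ∀ n, A.Ω n → ℝ) : Prop :=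
  ∀ ε : ℝ, 0 < ε → Tendsto (fun n => A.P n {ω | ε ≤ |T n ω|}) atTop (𝓝 0)

/-- The class of admissible adjustment functions: `E[η(Z) | X = x]` exists and is twice
continuously differentiable around the cutoff. -/
def admissible (n : ℕ) : Set (Cov (A.dim n) → ℝ) :=
  {η | Measurable η ∧
    (∀ᶠ x in 𝓝 (0 : ℝ), Integrable (fun yz : ℝ × Cov (A.dim n) => η yz.2) (A.κ n x)) ∧
    ContDiffAt ℝ 2 (fun x => ∫ yz, η yz.2 ∂(A.κ n x)) 0}

/-- First-stage condition, with the uniform `L²` contraction required over `region n`. -/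
structure FirstStage (T : ∀ n, Set (Cov (A.dim n) → ℝ)) (ηbar : ∀ n, Cov (A.dim n) → ℝ)
    (region : ℕ → Set ℝ) : Prop where
  subset : ∀ n, T n ⊆ A.admissible n
  mem : ∀ n, ηbar n ∈ T n
  whp : ∀ s : Fin S, Tendsto (fun n => A.P n {ω | A.etaHat n ω s ∉ T n}) atTop (𝓝 0)
  contraction : ∃ r : ℕ → ℝ, Tendsto r atTop (𝓝 0) ∧ ∃ C : ℝ, ∀ᶠ n in atTop,
    ∀ η ∈ T n, ∀ x ∈ region n,
      Integrable (fun yz : ℝ × Cov (A.dim n) => (η yz.2 - ηbar n yz.2) ^ 2) (A.κ n x) ∧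
      ∫ yz, (η yz.2 - ηbar n yz.2) ^ 2 ∂(A.κ n x) ≤ C * r n ^ 2

/-- Uniform smallness over `region n` of the first two derivatives of
`x ↦ E[η(Z) - η̄(Z) | X = x]`. -/
def SmallDerivatives (T : ∀ n, Set (Cov (A.dim n) → ℝ)) (ηbar : ∀ n, Cov (A.dim n) → ℝ)
    (region : ℕ → Set ℝ) : Prop :=
  (∀ᶠ n in atTop, ∀ η ∈ T n,
    ContDiffOn ℝ 2 (fun x => ∫ yz, (η yz.2 - ηbar n yz.2) ∂(A.κ n x)) (region n)) ∧
  ∀ j ∈ ({1, 2} : Set ℕ), ∃ r : ℕ → ℝ, Tendsto r atTop (𝓝 0) ∧ ∃ C : ℝ, ∀ᶠ n in atTop,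
    ∀ η ∈ T n, ∀ x ∈ region n,
      |iteratedDerivWithin j (fun x => ∫ yz, (η yz.2 - ηbar n yz.2) ∂(A.κ n x))
        (region n) x| ≤ C * r n

/-- Regularity of the conditional moments of `M(η̄)` given `X = x`, uniformly in `n`.
Smoothness on the support without the cutoff is required on each side of the cutoff. -/
structure RegularMoments (ηbar : ∀ n, Cov (A.dim n) → ℝ) (C : ℝ) (L : ℝ≥0) (q : ℝ) : Prop where
  integrable : ∀ n, ∀ x ∈ μ.support, Integrable (adj (ηbar n)) (A.κ n x)
  smooth : ∀ n, ∀ B ∈ ({Set.Ioi 0, Set.Iio 0} : Set (Set ℝ)),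
    ContDiffOn ℝ 2 (A.condMean n (ηbar n)) (μ.support ∩ B) ∧
    LipschitzOnWith L (iteratedDerivWithin 2 (A.condMean n (ηbar n)) (μ.support ∩ B))
      (μ.support ∩ B) ∧
    ∀ x ∈ μ.support ∩ B,
      |iteratedDerivWithin 2 (A.condMean n (ηbar n)) (μ.support ∩ B) x| ≤ C
  moment : ∀ n, ∀ x ∈ μ.support,
    Integrable (fun yz => |adj (ηbar n) yz - A.condMean n (ηbar n) x| ^ q) (A.κ n x) ∧
    ∫ yz, |adj (ηbar n) yz - A.condMean n (ηbar n) x| ^ q ∂(A.κ n x) ≤ C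
  var_lipschitz : ∀ n, ∀ B ∈ ({Set.Ioi 0, Set.Iio 0} : Set (Set ℝ)),
    LipschitzOnWith L (A.condVar n (ηbar n)) (μ.support ∩ B)
  var_lower : ∀ n, ∀ x ∈ μ.support \ {0}, 1 / C ≤ A.condVar n (ηbar n) x

open Classical in
/-- The cross-fold term `ι_i(η̂)`: the sum over pairs `(j, l)` of nearest neighbours of `i`
that are not both in the fold of `i`. -/
def crossTerm (R : ℕ) (n : ℕ) (ηbar : Cov (A.dim n) → ℝ) (ω : A.Ω n) (i : Fin n) : ℝ :=
  ∑ jl ∈ (neighbors R (A.X n ω) i ×ˢ neighbors R (A.X n ω) i).filter fun jl =>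
      ¬ (A.fold n ω jl.1 = A.fold n ω i ∧ A.fold n ω jl.2 = A.fold n ω i),
    (A.adjError n ηbar ω i - A.adjError n ηbar ω jl.1)
      * (A.outcome n ηbar ω i - A.outcome n ηbar ω jl.2)

/-- Negligibility of the cross-fold terms, for every derivative order `v ≤ p`. -/
def CrossFoldNegligible (K : ℝ → ℝ) (h : ℕ → ℝ) (p R : ℕ)
    (ηbar : ∀ n, Cov (A.dim n) → ℝ) : Prop :=
  ∀ v : Fin (p + 1), A.LittleOP fun n ω =>
    (n : ℝ) * h n ^ (1 + 2 * (v : ℕ)) *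
      ∑ i, weight K (h n) p v (A.X n ω) i ^ 2 * A.crossTerm R n (ηbar n) ω i

end Design

/-- The law `μ` of the running variable has a density that is continuous and bounded away from
zero on an open neighbourhood of the cutoff. -/
def RegularRunning (μ : Measure ℝ) : Prop :=
  ∃ f : ℝ → ℝ, Measurable f ∧ (∀ x, 0 ≤ f x) ∧
    μ = volume.withDensity (fun x => ENNReal.ofReal (f x)) ∧
    ∃ U : Set ℝ, IsOpen U ∧ (0 : ℝ) ∈ U ∧ ContinuousOn f U ∧ ∃ c : ℝ, 0 < c ∧ ∀ x ∈ U, c ≤ f x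

/-- A bounded symmetric density, continuous on its support and zero outside `[-1, 1]`. -/
structure IsKernelFn (K : ℝ → ℝ) : Prop where
  nonneg : ∀ t, 0 ≤ K t
  integrable : Integrable K
  integral_eq_one : ∫ t, K t = 1
  bounded : ∃ b : ℝ, ∀ t, K t ≤ b
  symm : ∀ t, K (-t) = K t
  continuousOn : ContinuousOn K (tsupport K)
  zero_outside : ∀ t, t ∉ Set.Icc (-1 : ℝ) 1 → K t = 0

/-- The bandwidth satisfies `h > 0`, `h → 0` and `n h → ∞`. -/
def IsBandwidth (h : ℕ → ℝ) : Prop :=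
  (∀ n, 0 < h n) ∧ Tendsto h atTop (𝓝 0) ∧ Tendsto (fun n : ℕ => (n : ℝ) * h n) atTop atTop

/-- `𝒳_h = 𝒳 ∩ [-h, h]`, where `𝒳` is the support of the running variable. -/
def window (μ : Measure ℝ) (h : ℝ) : Set ℝ := μ.support ∩ Set.Icc (-h) h

/-- Open sets `U n ⊇ 𝒳_h` that leave a margin around `𝒳_h` (within the support) which is large
relative to `1 / n`, the spacing of the observations. -/
def IsEnlargedWindow (μ : Measure ℝ) (h : ℕ → ℝ) (U : ℕ → Set ℝ) : Prop :=
  (∀ n, IsOpen (U n) ∧ window μ (h n) ⊆ U n) ∧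
  ∃ δ : ℕ → ℝ, Tendsto (fun n : ℕ => (n : ℝ) * δ n) atTop atTop ∧
    ∀ n, μ.support ∩ Metric.thickening (δ n) (window μ (h n)) ⊆ U n

end FlexRD

end

/-! ### Combinatorics of nearest neighbours -/

namespace FlexRD

/-! Write a_i = n h^(1+2v) w_i² for the normalised squared weights. They vanish off [-h, h], and
with probability tending to one they are all at most c₀/(nh). The reason is that, in coordinates
rescaled by powers of h, the one-sided Gram form is bounded below by a multiple of n: its
expectation dominates a fixed positive definite form, and its entries concentrate by Chebyshev
(`IsKernelFn.exists_weight_bound`). For a radius ρ ≤ 2h with n(ρ - h) → ∞, the shells between h and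
ρ on both sides of the cutoff contain R observations each (`tendsto_not_crowded`). So every unit
with a_i ≠ 0 has exactly R neighbours, all of them in N = [-ρ, ρ]. Without ties a unit is a
neighbour of at most 2R others (`card_filter_mem_neighbors_le`), so the total weight reaching any
unit is O(1/(nh)).

On N the generated outcome is m(X_i) + e_i - d_i, with m the conditional mean of M(η̄), e the
conditionally centred noise and d the first-stage error. The variance estimate at unit i is R/(R+1)
times the square of a contrast whose coefficients sum to 0 and have squares summing to (R+1)/R.
Expanding (`abs_sum_nnVar_sub_le`) leaves three errors.

The first is a quadratic form in e minus its conditional mean. Its coefficients depend on the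
running variables only and have row sums O(1/(nh)). Given the running variables, its diagonal and
off-diagonal parts are each sums of orthogonal terms, and its second moment is of order n (nh)⁻² h =
1/(nh) (`integral_sq_quadForm_le`).

The second is the effect of the differences of m and of d. Young's inequality with a parameter τ
bounds it, cross terms with e included, by τ times a quantity bounded in mean plus 1 + 1/τ times one
of order h² + r². Cross-fitting supplies the mean of d², since the estimate used for a unit is
independent of that unit (`Design.lintegral_truncError_le`). With τ → 0 dominating both h and |r|,
everything vanishes.

The third comes from the variation of the conditional variance between neighbours, which is O(h) by
the Lipschitz condition.

`Design.measure_seHatSq_sub_seSq_ge_le` collects these bounds at a fixed n. -/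

lemma closer_trans {n : ℕ} {x : Fin n → ℝ} {i a b c : Fin n}
    (h₁ : Closer x i a b) (h₂ : Closer x i b c) : Closer x i a c := by
  unfold Closer at *
  rcases h₁ with h₁ | ⟨h₁, h₁'⟩ <;> rcases h₂ with h₂ | ⟨h₂, h₂'⟩
  · exact Or.inl (h₁.trans h₂)
  · exact Or.inl (h₂ ▸ h₁)
  · exact Or.inl (h₁ ▸ h₂)
  · exact Or.inr ⟨h₁.trans h₂, h₁'.trans h₂'⟩

lemma not_closer_self {n : ℕ} (x : Fin n → ℝ) (i a : Fin n) : ¬ Closer x i a a := by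
  simp [Closer]

lemma closer_total {n : ℕ} (x : Fin n → ℝ) (i : Fin n) {a b : Fin n} (hab : a ≠ b) :
    Closer x i a b ∨ Closer x i b a := by
  unfold Closer
  rcases lt_trichotomy |x a - x i| |x b - x i| with h | h | h
  · exact Or.inl (Or.inl h)
  · rcases lt_or_gt_of_ne hab with h' | h'
    · exact Or.inl (Or.inr ⟨h, h'⟩)
    · exact Or.inr (Or.inr ⟨h.symm, h'⟩)
  · exact Or.inr (Or.inl h)

open Classical in
/-- A unit with at least `R` rivals has exactly `R` nearest neighbours. -/
lemma card_neighbors {n R : ℕ} (x : Fin n → ℝ) (i : Fin n)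
    (hR : R ≤ (Finset.univ.filter fun k => Rival x i k).card) :
    (neighbors R x i).card = R := by
  set s := Finset.univ.filter fun k => Rival x i k with hs
  -- The rank of j by distance. `Closer x i` is a strict total order, so ranks are injective on the
  -- rivals and fill an initial segment of ℕ; the neighbours are the units of rank below R.
  set f : Fin n → ℕ := fun j => (Finset.univ.filter fun k => Rival x i k ∧ Closer x i k j).card
    with hf
  have hlt : ∀ a ∈ s, ∀ b, Closer x i a b → f a < f b := by
    intro a ha b hab
    apply Finset.card_lt_card
    rw [Finset.ssubset_iff_of_subset]
    · refine ⟨a, ?_, ?_⟩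
      · simpa using ⟨(Finset.mem_filter.1 ha).2, hab⟩
      · simp [not_closer_self]
    · intro k hk
      simp only [Finset.mem_filter, Finset.mem_univ, true_and] at hk ⊢
      exact ⟨hk.1, closer_trans hk.2 hab⟩
  have hinj : Set.InjOn f s := by
    intro a ha b hb hab
    by_contra hne
    rcases closer_total x i hne with h | h
    · exact absurd hab (hlt a ha b h).ne
    · exact absurd hab (hlt b hb a h).ne'
  have himg : s.image f = Finset.range s.card := by
    apply Finset.eq_of_subset_of_card_le
    · intro m hm
      obtain ⟨j, hj, rfl⟩ := Finset.mem_image.1 hm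
      rw [Finset.mem_range]
      apply Finset.card_lt_card
      rw [Finset.ssubset_iff_of_subset]
      · exact ⟨j, hj, by simp [not_closer_self]⟩
      · intro k hk
        simp only [Finset.mem_filter, Finset.mem_univ, true_and, hs] at hk ⊢
        exact hk.1
    · rw [Finset.card_range, Finset.card_image_of_injOn hinj]
  have hnb : neighbors R x i = s.filter fun j => f j < R := by
    ext j; simp [neighbors, hs, hf]
  have himg' : (neighbors R x i).image f = Finset.range R := by
    rw [hnb]
    ext m
    simp only [Finset.mem_image, Finset.mem_filter, Finset.mem_range]
    constructor
    · rintro ⟨j, ⟨-, hj⟩, rfl⟩; exact hj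
    · intro hm
      have : m ∈ s.image f := by rw [himg, Finset.mem_range]; omega
      obtain ⟨j, hj, rfl⟩ := Finset.mem_image.1 this
      exact ⟨j, ⟨hj, hm⟩, rfl⟩
  have hsub : (neighbors R x i : Set (Fin n)) ⊆ s := by
    rw [hnb]
    exact fun a ha => (Finset.mem_filter.1 (Finset.mem_coe.1 ha)).1
  rw [← Finset.card_image_of_injOn (hinj.mono hsub), himg', Finset.card_range]

lemma rival_of_mem_neighbors {n R : ℕ} {x : Fin n → ℝ} {i j : Fin n}
    (hj : j ∈ neighbors R x i) : Rival x i j := by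
  simp only [neighbors, Finset.mem_filter] at hj
  exact hj.2.1

open Classical in
/-- `R` rivals closer to `i` than `j` prevent `j` from being a neighbour of `i`. -/
lemma card_lt_of_mem_neighbors {n R : ℕ} {x : Fin n → ℝ} {i j : Fin n}
    (hj : j ∈ neighbors R x i) (t : Finset (Fin n))
    (ht : ∀ k ∈ t, Rival x i k ∧ Closer x i k j) : t.card < R := by
  simp only [neighbors, Finset.mem_filter] at hj
  refine lt_of_le_of_lt (Finset.card_le_card fun k hk => ?_) hj.2.2
  simpa using ht k hk

open Classical in
-- Every member of t other than a is a rival of a and closer to a than j is. As j is a neighbour of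
-- a, there are fewer than R such members.
lemma card_le_of_extremal {n R : ℕ} (x : Fin n → ℝ) (j : Fin n) (t : Finset (Fin n))
    (ht : ∀ i ∈ t, j ∈ neighbors R x i)
    (hext : t.Nonempty → ∃ a ∈ t, ∀ i ∈ t, i ≠ a → |x i - x a| < |x j - x a|) :
    t.card ≤ R := by
  rcases t.eq_empty_or_nonempty with rfl | hne
  · simp
  obtain ⟨a, ha, hmax⟩ := hext hne
  have := card_lt_of_mem_neighbors (ht a ha) (t.erase a) (fun k hk => by
    obtain ⟨hka, hk⟩ := Finset.mem_erase.1 hk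
    refine ⟨⟨hka, ?_⟩, Or.inl (hmax k hk hka)⟩
    exact (rival_of_mem_neighbors (ht k hk)).2.symm.trans (rival_of_mem_neighbors (ht a ha)).2)
  rw [Finset.card_erase_of_mem ha] at this
  omega

open Classical in
/-- Without ties, a unit is one of the `R` nearest neighbours of at most `2 * R` units. -/
lemma card_filter_mem_neighbors_le {n R : ℕ} {x : Fin n → ℝ} (hx : Function.Injective x)
    (j : Fin n) : (Finset.univ.filter fun i => j ∈ neighbors R x i).card ≤ 2 * R := by
  set t := Finset.univ.filter fun i => j ∈ neighbors R x i with ht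
  have hsplit : t ⊆ (t.filter fun i => x j < x i) ∪ (t.filter fun i => x i < x j) := by
    intro i hi
    have hij : i ≠ j := fun h => (rival_of_mem_neighbors (Finset.mem_filter.1 hi).2).1 h.symm
    rcases lt_or_gt_of_ne (hx.ne hij) with h | h
    · exact Finset.mem_union_right _ (Finset.mem_filter.2 ⟨hi, h⟩)
    · exact Finset.mem_union_left _ (Finset.mem_filter.2 ⟨hi, h⟩)
  -- The extremal unit is the one farthest from j on this side: all the others lie strictly between
  -- j and it.
  have h₁ : (t.filter fun i => x j < x i).card ≤ R := by
    apply card_le_of_extremal x j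
    · intro i hi
      exact (Finset.mem_filter.1 (Finset.mem_filter.1 hi).1).2
    · intro hne
      obtain ⟨a, ha, hmax⟩ := Finset.exists_max_image _ x hne
      refine ⟨a, ha, fun i hi hia => ?_⟩
      have h1 := lt_of_le_of_ne (hmax i hi) (hx.ne hia)
      have h2 := (Finset.mem_filter.1 hi).2
      rw [abs_of_neg (by linarith), abs_of_neg (by linarith)]
      linarith
  have h₂ : (t.filter fun i => x i < x j).card ≤ R := by
    apply card_le_of_extremal x j
    · intro i hi
      exact (Finset.mem_filter.1 (Finset.mem_filter.1 hi).1).2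
    · intro hne
      obtain ⟨a, ha, hmin⟩ := Finset.exists_min_image _ x hne
      refine ⟨a, ha, fun i hi hia => ?_⟩
      have h1 := lt_of_le_of_ne (hmin i hi) (hx.ne hia).symm
      have h2 := (Finset.mem_filter.1 hi).2
      rw [abs_of_pos (by linarith), abs_of_pos (by linarith)]
      linarith
  have := (Finset.card_le_card hsplit).trans (Finset.card_union_le _ _)
  omega

/-- `x` has at least `R` points just outside `[-h, h]`, within distance `ρ` of the origin,
on both sides. -/
def Crowded {n : ℕ} (R : ℕ) (h ρ : ℝ) (x : Fin n → ℝ) : Prop :=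
  R ≤ (Finset.univ.filter fun k => x k ∈ Set.Ioc h ρ).card ∧
  R ≤ (Finset.univ.filter fun k => x k ∈ Set.Ico (-ρ) (-h)).card

open Classical in
-- The R points beyond the window on the side of unit i are all rivals of i; none is i itself,
-- because i lies inside the window.
lemma Crowded.card_neighbors {n R : ℕ} {h ρ : ℝ} {x : Fin n → ℝ} (hx : Crowded R h ρ x)
    (hh : 0 < h) {i : Fin n} (hi : |x i| ≤ h) : (neighbors R x i).card = R := by
  obtain ⟨hi1, hi2⟩ := abs_le.1 hi
  apply FlexRD.card_neighbors
  rcases le_or_gt 0 (x i) with h0 | h0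
  · refine hx.1.trans (Finset.card_le_card fun k hk => ?_)
    obtain ⟨hk1, hk2⟩ := (Finset.mem_filter.1 hk).2
    refine Finset.mem_filter.2 ⟨Finset.mem_univ _, ?_, ?_⟩
    · rintro rfl; linarith
    · exact iff_of_true (by linarith) h0
  · refine hx.2.trans (Finset.card_le_card fun k hk => ?_)
    obtain ⟨hk1, hk2⟩ := (Finset.mem_filter.1 hk).2
    refine Finset.mem_filter.2 ⟨Finset.mem_univ _, ?_, ?_⟩
    · rintro rfl; linarith
    · exact iff_of_false (by linarith) (by linarith)

open Classical in
-- A unit beyond ρ on the same side is separated from i by the R points of the shell, and these are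
-- all closer to i.
lemma Crowded.abs_le_of_mem_neighbors {n R : ℕ} {h ρ : ℝ} {x : Fin n → ℝ}
    (hx : Crowded R h ρ x) (hh : 0 < h) {i j : Fin n} (hi : |x i| ≤ h)
    (hj : j ∈ neighbors R x i) : |x j| ≤ ρ := by
  obtain ⟨hi1, hi2⟩ := abs_le.1 hi
  by_contra hcon
  rw [not_le] at hcon
  have hr := rival_of_mem_neighbors hj
  rcases le_or_gt 0 (x i) with h0 | h0
  · have hj0 : 0 ≤ x j := hr.2.2 h0
    rw [abs_of_nonneg hj0] at hcon
    refine absurd (card_lt_of_mem_neighbors hj _ fun k hk => ?_) (not_lt.2 hx.1)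
    obtain ⟨hk1, hk2⟩ := (Finset.mem_filter.1 hk).2
    refine ⟨⟨?_, iff_of_true (by linarith) h0⟩, Or.inl ?_⟩
    · rintro rfl; linarith
    · rw [abs_of_pos (by linarith), abs_of_pos (by linarith)]; linarith
  · have hj0 : x j < 0 := by
      by_contra hc; exact absurd (hr.2.1 (not_lt.1 hc)) (not_le.2 h0)
    rw [abs_of_neg hj0] at hcon
    refine absurd (card_lt_of_mem_neighbors hj _ fun k hk => ?_) (not_lt.2 hx.2)
    obtain ⟨hk1, hk2⟩ := (Finset.mem_filter.1 hk).2
    refine ⟨⟨?_, iff_of_false (by linarith) (by linarith)⟩, Or.inl ?_⟩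
    · rintro rfl; linarith
    · rw [abs_of_neg (by linarith), abs_of_neg (by linarith)]; linarith

end FlexRD

/-! ### Local polynomial weights and positivity of the kernel moment form -/

namespace FlexRD

lemma dotProduct_gram_mulVec {n p : ℕ} (k : ℝ → ℝ) (x : Fin n → ℝ) (u : Fin (p + 1) → ℝ) :
    u ⬝ᵥ (gram k p x).mulVec u = ∑ i, k (x i) * (polyVec p (x i) ⬝ᵥ u) ^ 2 := by
  unfold gram
  rw [Matrix.sum_mulVec, dotProduct_sum]
  refine Finset.sum_congr rfl fun i _ => ?_
  rw [Matrix.smul_mulVec, dotProduct_smul, Matrix.vecMulVec_mulVec, smul_eq_mul]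
  rw [dotProduct_smul, op_smul_eq_mul, dotProduct_comm u, sq]

/-- Coordinates rescaled by powers of the bandwidth. -/
def rescale {p : ℕ} (h : ℝ) (u : Fin (p + 1) → ℝ) : Fin (p + 1) → ℝ := fun a => h ^ (a : ℕ) * u a

/-- In the variable x / h all relevant points lie in [-1, 1], so bounds on the form can be uniform
in the bandwidth; undoing the rescaling costs coordinate v a factor h^v. -/
lemma polyVec_dotProduct {p : ℕ} {h : ℝ} (hh : h ≠ 0) (x : ℝ) (u : Fin (p + 1) → ℝ) :
    polyVec p x ⬝ᵥ u = polyVec p (x / h) ⬝ᵥ rescale h u := by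
  simp only [dotProduct, polyVec, rescale]
  refine Finset.sum_congr rfl fun a _ => ?_
  rw [div_pow]; field_simp

lemma abs_polyVec_dotProduct_le {p : ℕ} {t : ℝ} (ht : |t| ≤ 1) (y : Fin (p + 1) → ℝ) :
    |polyVec p t ⬝ᵥ y| ≤ (p + 1) * ‖y‖ := by
  simp only [dotProduct, polyVec]
  refine (Finset.abs_sum_le_sum_abs _ _).trans ?_
  refine (Finset.sum_le_sum (g := fun _ => ‖y‖) fun a _ => ?_).trans (by simp)
  rw [abs_mul, abs_pow]
  calc |t| ^ (a : ℕ) * |y a| ≤ 1 * ‖y‖ := by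
        gcongr
        · exact pow_le_one₀ (abs_nonneg _) ht
        · exact norm_le_pi_norm y a
    _ = ‖y‖ := one_mul _

/-- A lower bound on the rescaled Gram form bounds the one-sided local polynomial weights. -/
lemma abs_sideWeight_le {n p : ℕ} {k : ℝ → ℝ} {x : Fin n → ℝ} {h M m : ℝ} (hh : 0 < h)
    (hm : 0 < m) (hM : 0 ≤ M) (hk : ∀ t, |k t| ≤ M) (hk0 : ∀ t, h < |t| → k t = 0)
    (hlow : ∀ y : Fin (p + 1) → ℝ,
      m * ‖y‖ ^ 2 ≤ ∑ i, k (x i) * (polyVec p (x i / h) ⬝ᵥ y) ^ 2)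
    (v : Fin (p + 1)) (i : Fin n) :
    |sideWeight k p v x i| ≤ M * (p + 1) / (m * h ^ (v : ℕ)) := by
  have hform : ∀ u : Fin (p + 1) → ℝ,
      m * ‖rescale h u‖ ^ 2 ≤ u ⬝ᵥ (gram k p x).mulVec u := by
    intro u
    rw [dotProduct_gram_mulVec]
    refine (hlow _).trans (le_of_eq ?_)
    simp_rw [← polyVec_dotProduct hh.ne']
  have hres : ∀ u : Fin (p + 1) → ℝ, rescale h u = 0 → u = 0 := by
    intro u hu
    ext a
    have := congrFun hu a
    simp only [rescale, Pi.zero_apply, mul_eq_zero] at this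
    exact this.resolve_left (pow_ne_zero _ hh.ne')
  have hunit : IsUnit (gram k p x) := by
    rw [← Matrix.mulVec_injective_iff_isUnit]
    rw [← Matrix.coe_mulVecLin, ← LinearMap.ker_eq_bot, LinearMap.ker_eq_bot']
    intro u hu
    apply hres
    have h1 := hform u
    rw [Matrix.mulVecLin_apply] at hu
    rw [hu, dotProduct_zero] at h1
    have h2 : ‖rescale h u‖ ^ 2 ≤ 0 := by
      by_contra hc
      have := mul_pos hm (not_le.1 hc)
      linarith
    exact norm_eq_zero.1 (pow_eq_zero_iff (two_ne_zero) |>.1 (le_antisymm h2 (sq_nonneg _)))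
  set b := (gram k p x)⁻¹.mulVec (k (x i) • polyVec p (x i)) with hb
  have hGb : (gram k p x).mulVec b = k (x i) • polyVec p (x i) := by
    rw [hb, Matrix.mulVec_mulVec, Matrix.mul_nonsing_inv _ ((Matrix.isUnit_iff_isUnit_det _).1 hunit),
      Matrix.one_mulVec]
  -- Pairing the normal equation with its solution b gives m‖b_h‖² ≤ M(p+1)‖b_h‖ for the rescaled
  -- vector b_h, and one factor of the norm cancels.
  have h1 := hform b
  rw [hGb, dotProduct_smul, dotProduct_comm, polyVec_dotProduct hh.ne', smul_eq_mul] at h1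
  have h2 : k (x i) * (polyVec p (x i / h) ⬝ᵥ rescale h b) ≤ M * ((p + 1) * ‖rescale h b‖) := by
    by_cases hx : h < |x i|
    · rw [hk0 _ hx, zero_mul]; positivity
    · refine (le_abs_self _).trans ?_
      rw [abs_mul]
      gcongr
      · exact hk _
      · apply abs_polyVec_dotProduct_le
        rw [abs_div, abs_of_pos hh, div_le_one hh]
        exact not_lt.1 hx
  have h3 : m * ‖rescale h b‖ ≤ M * (p + 1) := by
    rcases (norm_nonneg (rescale h b)).eq_or_lt with h0 | h0
    · rw [← h0, mul_zero]; positivity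
    · have : m * ‖rescale h b‖ * ‖rescale h b‖ ≤ M * (p + 1) * ‖rescale h b‖ := by
        calc _ = m * ‖rescale h b‖ ^ 2 := by ring
          _ ≤ _ := h1.trans h2
          _ = _ := by ring
      exact le_of_mul_le_mul_right this h0
  have h4 : h ^ (v : ℕ) * |b v| ≤ ‖rescale h b‖ := by
    have := norm_le_pi_norm (rescale h b) v
    rwa [rescale, Real.norm_eq_abs, abs_mul, abs_of_pos (pow_pos hh _)] at this
  have hs : sideWeight k p v x i = b v := rfl
  rw [hs, le_div_iff₀ (by positivity)]
  calc |b v| * (m * h ^ (v : ℕ)) = m * (h ^ (v : ℕ) * |b v|) := by ring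
    _ ≤ m * ‖rescale h b‖ := by gcongr
    _ ≤ _ := h3

lemma sideWeight_eq_zero {n p : ℕ} {k : ℝ → ℝ} {x : Fin n → ℝ} {i : Fin n} (h : k (x i) = 0)
    (v : Fin (p + 1)) : sideWeight k p v x i = 0 := by
  simp [sideWeight, h]

lemma IsKernelFn.scaled_eq_zero {K : ℝ → ℝ} (hK : IsKernelFn K) {h t : ℝ} (hh : 0 < h)
    (ht : h < |t|) : scaled K h t = 0 := by
  rw [scaled, hK.zero_outside, zero_div]
  intro hc
  have : |t / h| ≤ 1 := abs_le.2 hc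
  rw [abs_div, abs_of_pos hh, div_le_one hh] at this
  linarith

lemma IsKernelFn.weight_eq_zero {K : ℝ → ℝ} (hK : IsKernelFn K) {n p : ℕ} {h : ℝ} (hh : 0 < h)
    {x : Fin n → ℝ} {i : Fin n} (hi : h < |x i|) (v : Fin (p + 1)) : weight K h p v x i = 0 := by
  have h0 := hK.scaled_eq_zero hh hi
  rw [weight, sideWeight_eq_zero, sideWeight_eq_zero, sub_zero]
  · simp [scaledNeg, h0]
  · simp [scaledPos, h0]

/-- Reduces control of the form, uniformly in y, to the finitely many scalar moments of degree at
most 2p. -/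
lemma mul_polyVec_dotProduct_sq {p : ℕ} (k t : ℝ) (y : Fin (p + 1) → ℝ) :
    k * (polyVec p t ⬝ᵥ y) ^ 2
      = ∑ a : Fin (p + 1), ∑ c : Fin (p + 1), (k * t ^ ((a : ℕ) + (c : ℕ))) * (y a * y c) := by
  rw [sq, dotProduct, Finset.sum_mul_sum, Finset.mul_sum]
  refine Finset.sum_congr rfl fun a _ => ?_
  rw [Finset.mul_sum]
  refine Finset.sum_congr rfl fun c _ => ?_
  simp only [polyVec]; ring

/-- The quadratic form of the moments of a one-sided kernel is positive definite. -/
lemma exists_pos_le_integral_polyVec {k : ℝ → ℝ} (p : ℕ) (hk : Measurable k) (hk0 : ∀ t, 0 ≤ k t)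
    {b : ℝ} (hb : ∀ t, k t ≤ b) (hout : ∀ t, t ∉ Set.Icc (-1 : ℝ) 1 → k t = 0)
    (hpos : 0 < ∫ t, k t) :
    (∀ y : Fin (p + 1) → ℝ, Integrable fun t => k t * (polyVec p t ⬝ᵥ y) ^ 2) ∧
    ∃ l : ℝ, 0 < l ∧ ∀ y : Fin (p + 1) → ℝ,
      l * ‖y‖ ^ 2 ≤ ∫ t, k t * (polyVec p t ⬝ᵥ y) ^ 2 := by
  have hkint : ∀ a : ℕ, Integrable fun t => k t * t ^ a := by
    intro a
    have h1 : Integrable ((Set.Icc (-1 : ℝ) 1).indicator fun _ : ℝ => b) :=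
      (integrable_indicator_iff measurableSet_Icc).2 (by simp)
    refine h1.mono' (by fun_prop) (ae_of_all _ fun t => ?_)
    by_cases ht : t ∈ Set.Icc (-1 : ℝ) 1
    · rw [Set.indicator_of_mem ht, Real.norm_eq_abs, abs_mul, abs_of_nonneg (hk0 t), abs_pow]
      calc k t * |t| ^ a ≤ b * 1 := by
            gcongr
            · exact (hk0 t).trans (hb t)
            · exact hb t
            · exact pow_le_one₀ (abs_nonneg _) (abs_le.2 ht)
        _ = b := mul_one b
    · rw [hout t ht, Set.indicator_of_notMem ht]; simp
  have hexp := fun y t => mul_polyVec_dotProduct_sq (p := p) (k t) t y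
  have hint : ∀ y : Fin (p + 1) → ℝ, Integrable fun t => k t * (polyVec p t ⬝ᵥ y) ^ 2 := by
    intro y
    simp_rw [hexp]
    exact integrable_finsetSum _ fun a _ => integrable_finsetSum _ fun c _ =>
      (hkint _).mul_const _
  refine ⟨hint, ?_⟩
  set Q : (Fin (p + 1) → ℝ) → ℝ := fun y => ∫ t, k t * (polyVec p t ⬝ᵥ y) ^ 2 with hQ
  have hQexp : ∀ y, Q y = ∑ a : Fin (p + 1), ∑ c : Fin (p + 1),
      (∫ t, k t * t ^ ((a : ℕ) + (c : ℕ))) * (y a * y c) := by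
    intro y
    simp only [hQ, hexp]
    rw [integral_finsetSum _ fun a _ => integrable_finsetSum _ fun c _ =>
      (hkint _).mul_const _]
    refine Finset.sum_congr rfl fun a _ => ?_
    rw [integral_finsetSum _ fun c _ => (hkint _).mul_const _]
    refine Finset.sum_congr rfl fun c _ => ?_
    rw [integral_mul_const]
  have hQcont : Continuous Q := by
    have : Q = fun y => ∑ a : Fin (p + 1), ∑ c : Fin (p + 1),
      (∫ t, k t * t ^ ((a : ℕ) + (c : ℕ))) * (y a * y c) := funext hQexp
    rw [this]; fun_prop
  have hQnn : ∀ y t, 0 ≤ k t * (polyVec p t ⬝ᵥ y) ^ 2 := fun y t =>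
    mul_nonneg (hk0 t) (sq_nonneg _)
  -- If the form vanished at y ≠ 0, then k would vanish almost everywhere off the finite root set of
  -- a nonzero polynomial, against its positive integral.
  have hQpos : ∀ y, y ≠ 0 → 0 < Q y := by
    intro y hy
    refine lt_of_le_of_ne (integral_nonneg (hQnn y)) fun h0 => ?_
    have hae := (integral_eq_zero_iff_of_nonneg (hQnn y) (hint y)).1 h0.symm
    set P : Polynomial ℝ := ∑ a : Fin (p + 1), Polynomial.monomial (a : ℕ) (y a) with hP
    have hPev : ∀ t, P.eval t = polyVec p t ⬝ᵥ y := by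
      intro t
      simp only [hP, Polynomial.eval_finsetSum, Polynomial.eval_monomial, dotProduct, polyVec]
      exact Finset.sum_congr rfl fun a _ => mul_comm _ _
    have hPne : P ≠ 0 := by
      intro hP0
      apply hy
      ext a
      have := congrArg (fun q => Polynomial.coeff q (a : ℕ)) hP0
      simp only [hP, Polynomial.finsetSum_coeff, Polynomial.coeff_monomial, Polynomial.coeff_zero,
        Fin.val_inj] at this
      simpa using this
    have hfin : volume {t : ℝ | P.eval t = 0} = 0 := by
      have := (Polynomial.finite_setOfPred_isRoot hPne).measure_zero volume
      exact this
    have hkz : k =ᵐ[volume] 0 := by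
      have hne : ∀ᵐ t : ℝ, P.eval t ≠ 0 := by
        rw [ae_iff]; simpa using hfin
      filter_upwards [hae, hne] with t ht1 ht2
      rw [hPev] at ht2
      exact (mul_eq_zero.1 ht1).resolve_right (pow_ne_zero _ ht2)
    rw [integral_congr_ae hkz] at hpos
    simp at hpos
  -- The constant is the minimum of the form over the compact unit sphere; homogeneity of degree two
  -- extends the bound to all y.
  obtain ⟨y0, hy0, hmin⟩ := (isCompact_sphere (0 : Fin (p + 1) → ℝ) 1).exists_isMinOn
    (NormedSpace.sphere_nonempty.2 zero_le_one) hQcont.continuousOn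
  refine ⟨Q y0, hQpos y0 ?_, fun y => ?_⟩
  · rintro rfl; simp at hy0
  · rcases eq_or_ne y 0 with rfl | hy
    · simp
    · have hn : 0 < ‖y‖ := norm_pos_iff.2 hy
      have h1 : Q y0 ≤ Q (‖y‖⁻¹ • y) := by
        apply hmin
        simp [norm_smul, hn.ne']
      have h2 : Q (‖y‖⁻¹ • y) = (‖y‖⁻¹) ^ 2 * Q y := by
        simp only [hQ, ← integral_const_mul]
        congr 1; ext t
        rw [dotProduct_smul, smul_eq_mul]; ring
      rw [h2] at h1
      calc Q y0 * ‖y‖ ^ 2 ≤ (‖y‖⁻¹) ^ 2 * Q y * ‖y‖ ^ 2 := by gcongr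
        _ = Q y := by field_simp

end FlexRD

/-! ### Concentration for i.i.d. running variables near the cutoff -/

namespace FlexRD

/-- On `[-r, r]` the measure `μ` has a density between `c` and `C`. -/
structure DensityBounds (μ : Measure ℝ) (r c C : ℝ) : Prop where
  pos : 0 < r
  lower_pos : 0 < c
  upper_nonneg : 0 ≤ C
  lower : ENNReal.ofReal c • volume.restrict (Set.Icc (-r) r) ≤ μ.restrict (Set.Icc (-r) r)
  upper : μ.restrict (Set.Icc (-r) r) ≤ ENNReal.ofReal C • volume.restrict (Set.Icc (-r) r)

lemma RegularRunning.exists_densityBounds {μ : Measure ℝ} (h : RegularRunning μ) :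
    ∃ r c C : ℝ, DensityBounds μ r c C := by
  obtain ⟨f, hf, hf0, rfl, U, hU, h0U, hfU, c, hc, hcU⟩ := h
  have hcont : ContinuousAt f 0 := hfU.continuousAt (hU.mem_nhds h0U)
  have hev : ∀ᶠ x in 𝓝 (0 : ℝ), x ∈ U ∧ f x < f 0 + 1 :=
    Filter.Eventually.and (hU.mem_nhds h0U) (hcont.eventually_lt_const (lt_add_one _))
  obtain ⟨ε, hε, hball⟩ := Metric.eventually_nhds_iff.1 hev
  have hin : ∀ x ∈ Set.Icc (-(ε / 2)) (ε / 2), x ∈ U ∧ f x < f 0 + 1 := by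
    intro x hx
    apply hball
    rw [dist_zero_right, Real.norm_eq_abs]
    have := abs_le.2 hx
    linarith
  refine ⟨ε / 2, c, f 0 + 1, by positivity, hc, add_nonneg (hf0 0) zero_le_one, ?_, ?_⟩
  · rw [Measure.le_iff]
    intro s hs
    rw [Measure.smul_apply, Measure.restrict_apply hs, Measure.restrict_apply hs,
      withDensity_apply _ (hs.inter measurableSet_Icc), smul_eq_mul, ← setLIntegral_const]
    exact setLIntegral_mono' (hs.inter measurableSet_Icc) fun x hx =>
      ENNReal.ofReal_le_ofReal (hcU x (hin x hx.2).1)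
  · rw [Measure.le_iff]
    intro s hs
    rw [Measure.smul_apply, Measure.restrict_apply hs, Measure.restrict_apply hs,
      withDensity_apply _ (hs.inter measurableSet_Icc), smul_eq_mul, ← setLIntegral_const]
    exact setLIntegral_mono' (hs.inter measurableSet_Icc) fun x hx =>
      ENNReal.ofReal_le_ofReal (hin x hx.2).2.le

lemma RegularRunning.noAtoms {μ : Measure ℝ} (h : RegularRunning μ) : NullSingletonClass μ := by
  obtain ⟨f, hf, hf0, rfl, -⟩ := h
  exact ⟨fun x => withDensity_absolutelyContinuous _ _ (measure_singleton x)⟩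

namespace DensityBounds

variable {μ : Measure ℝ} {r c C : ℝ}

lemma measure_le (h : DensityBounds μ r c C) {s : Set ℝ} (hs : s ⊆ Set.Icc (-r) r) :
    μ s ≤ ENNReal.ofReal C * volume s := by
  have h1 := h.upper s
  rwa [Measure.smul_apply, Measure.restrict_eq_self _ hs, Measure.restrict_eq_self _ hs,
    smul_eq_mul] at h1

lemma le_measure (h : DensityBounds μ r c C) {s : Set ℝ} (hs : s ⊆ Set.Icc (-r) r) :
    ENNReal.ofReal c * volume s ≤ μ s := by
  have h1 := h.lower s
  rwa [Measure.smul_apply, Measure.restrict_eq_self _ hs, Measure.restrict_eq_self _ hs,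
    smul_eq_mul] at h1

/-- Open sets here have positive Lebesgue measure, hence positive μ-measure. The moment and
smoothness conditions, which concern the support, thus apply at every point near the cutoff. -/
lemma Ioo_subset_support (h : DensityBounds μ r c C) : Set.Ioo (-r) r ⊆ μ.support := by
  intro x hx
  rw [Measure.mem_support_iff_forall]
  intro V hV
  obtain ⟨V', hV'V, hV', hxV'⟩ := mem_nhds_iff.1 (Filter.inter_mem hV (Ioo_mem_nhds hx.1 hx.2))
  have h1 : 0 < volume V' := hV'.measure_pos _ ⟨x, hxV'⟩
  have h2 := h.le_measure (s := V') fun y hy => Set.Ioo_subset_Icc_self (hV'V hy).2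
  refine lt_of_lt_of_le ?_ (h2.trans (measure_mono fun y hy => (hV'V hy).1))
  exact ENNReal.mul_pos (ENNReal.ofReal_pos.2 h.lower_pos).ne' h1.ne'

lemma measure_Icc_le (h : DensityBounds μ r c C) {t : ℝ} (htr : t ≤ r) :
    μ (Set.Icc (-t) t) ≤ ENNReal.ofReal (2 * C * t) := by
  refine (h.measure_le (Set.Icc_subset_Icc (neg_le_neg htr) htr)).trans ?_
  rw [Real.volume_Icc, ← ENNReal.ofReal_mul h.upper_nonneg]
  exact ENNReal.ofReal_le_ofReal (by linarith)

lemma le_integral [IsFiniteMeasure μ] (h : DensityBounds μ r c C) {g : ℝ → ℝ} (hg0 : ∀ x, 0 ≤ g x)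
    (hg : ∀ x, r < |x| → g x = 0) (hint : Integrable g μ) :
    c * ∫ x, g x ≤ ∫ x, g x ∂μ := by
  have hs : ∀ ν : Measure ℝ, ∫ x in Set.Icc (-r) r, g x ∂ν = ∫ x, g x ∂ν := by
    intro ν
    apply setIntegral_eq_integral_of_forall_compl_eq_zero
    intro x hx
    apply hg
    by_contra hc
    exact hx (abs_le.1 (not_lt.1 hc))
  rw [← hs μ, ← hs volume]
  have := integral_mono_measure h.lower (ae_of_all _ hg0) hint.restrict
  rwa [integral_smul_measure, ENNReal.toReal_ofReal h.lower_pos.le, smul_eq_mul] at this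

end DensityBounds

/-- Chebyshev's inequality for a sum over an i.i.d. sample. -/
lemma pi_chebyshev (μ : Measure ℝ) [IsProbabilityMeasure μ] (n : ℕ) {φ : ℝ → ℝ}
    (hφ : Measurable φ) {b t : ℝ} (hb : ∀ x, |φ x| ≤ b) (ht : 0 < t) :
    Measure.pi (fun _ : Fin n => μ) {x | t ≤ |∑ i, φ (x i) - n * ∫ y, φ y ∂μ|}
      ≤ ENNReal.ofReal (n * (∫ y, φ y ^ 2 ∂μ) / t ^ 2) := by
  have hmem : MemLp φ 2 μ := MemLp.of_bound hφ.aestronglyMeasurable b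
    (ae_of_all _ fun x => by simpa using hb x)
  have hmem' : ∀ i : Fin n, MemLp (fun x : Fin n → ℝ => φ (x i)) 2
      (Measure.pi (fun _ : Fin n => μ)) := fun i =>
    hmem.comp_measurePreserving (measurePreserving_eval (fun _ : Fin n => μ) i)
  have hsum : MemLp (∑ i, fun x : Fin n → ℝ => φ (x i)) 2 (Measure.pi (fun _ : Fin n => μ)) :=
    memLp_finsetSum' _ fun i _ => hmem' i
  have hvar := variance_sum_pi (μ := fun _ : Fin n => μ) (X := fun _ => φ) fun _ => hmem
  have hE : ∫ x, (∑ i, fun x : Fin n → ℝ => φ (x i)) x ∂(Measure.pi (fun _ : Fin n => μ))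
      = n * ∫ y, φ y ∂μ := by
    simp only [Finset.sum_apply]
    rw [integral_finsetSum _ fun i _ => (hmem' i).integrable one_le_two]
    have : ∀ i : Fin n, ∫ x : Fin n → ℝ, φ (x i) ∂(Measure.pi (fun _ : Fin n => μ))
        = ∫ y, φ y ∂μ := fun i => by
      have := measurePreserving_eval (fun _ : Fin n => μ) i
      conv_rhs => rw [← this.map_eq]
      rw [integral_map this.aemeasurable hφ.aestronglyMeasurable]
    simp [this]
  have h1 := meas_ge_le_variance_div_sq hsum ht
  rw [hE, hvar] at h1
  refine le_trans (le_of_eq ?_) (h1.trans (ENNReal.ofReal_le_ofReal ?_))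
  · simp
  · simp only [Finset.sum_const, Finset.card_univ, Fintype.card_fin, nsmul_eq_mul]
    gcongr
    exact variance_le_expectation_sq hφ.aestronglyMeasurable

/-- The `a`-th moment function of the rescaled kernel. -/
noncomputable def kernelMoment (k : ℝ → ℝ) (h : ℝ) (a : ℕ) (x : ℝ) : ℝ := scaled k h x * (x / h) ^ a

/-- The one-sided kernels to which the local polynomial estimates apply. -/
structure IsSideKernel (k : ℝ → ℝ) (b : ℝ) : Prop where
  measurable : Measurable k
  nonneg : ∀ t, 0 ≤ k t
  bounded : ∀ t, k t ≤ b
  zero_outside : ∀ t, t ∉ Set.Icc (-1 : ℝ) 1 → k t = 0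
  integral_pos : 0 < ∫ t, k t

namespace IsSideKernel

variable {k : ℝ → ℝ} {b h : ℝ}

lemma scaled_eq_zero (hk : IsSideKernel k b) (hh : 0 < h) {t : ℝ} (ht : h < |t|) :
    scaled k h t = 0 := by
  rw [scaled, hk.zero_outside, zero_div]
  intro hc
  have : |t / h| ≤ 1 := abs_le.2 hc
  rw [abs_div, abs_of_pos hh, div_le_one hh] at this
  linarith

lemma bound_nonneg (hk : IsSideKernel k b) : 0 ≤ b := (hk.nonneg 0).trans (hk.bounded 0)

lemma scaled_nonneg (hk : IsSideKernel k b) (hh : 0 < h) (t : ℝ) : 0 ≤ scaled k h t :=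
  div_nonneg (hk.nonneg _) hh.le

lemma abs_scaled_le (hk : IsSideKernel k b) (hh : 0 < h) (t : ℝ) : |scaled k h t| ≤ b / h := by
  rw [abs_of_nonneg (hk.scaled_nonneg hh t), scaled]
  exact div_le_div_of_nonneg_right (hk.bounded _) hh.le

/-- Keeping the indicator of the window is what makes second moments of order 1/h and not 1/h². -/
lemma abs_kernelMoment_le (hk : IsSideKernel k b) (hh : 0 < h) (a : ℕ) (t : ℝ) :
    |kernelMoment k h a t| ≤ (Set.Icc (-h) h).indicator (fun _ => b / h) t := by
  have hb := hk.bound_nonneg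
  by_cases ht : h < |t|
  · rw [kernelMoment, hk.scaled_eq_zero hh ht, zero_mul, abs_zero]
    exact Set.indicator_nonneg (fun _ _ => by positivity) _
  · rw [Set.indicator_of_mem (show t ∈ Set.Icc (-h) h from abs_le.1 (not_lt.1 ht)), kernelMoment, abs_mul]
    calc _ ≤ b / h * 1 := by
          gcongr
          · exact hk.abs_scaled_le hh t
          · rw [abs_pow]
            apply pow_le_one₀ (abs_nonneg _)
            rw [abs_div, abs_of_pos hh, div_le_one hh]
            exact not_lt.1 ht
      _ = _ := mul_one _

lemma measurable_scaled (hk : IsSideKernel k b) : Measurable (scaled k h) :=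
  (hk.measurable.comp (measurable_id.div_const h)).div_const h

lemma measurable_kernelMoment (hk : IsSideKernel k b) (a : ℕ) : Measurable (kernelMoment k h a) :=
  hk.measurable_scaled.mul ((measurable_id.div_const h).pow_const a)

/-- The square is at most (b/h)² on a window of mass at most 2Ch. -/
lemma integral_kernelMoment_sq_le {μ : Measure ℝ} [IsFiniteMeasure μ] {r c C : ℝ}
    (hk : IsSideKernel k b) (hμ : DensityBounds μ r c C) (hh : 0 < h) (hr : h ≤ r) (a : ℕ) :
    ∫ t, kernelMoment k h a t ^ 2 ∂μ ≤ 2 * C * b ^ 2 / h := by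
  have h1 : ∀ t, kernelMoment k h a t ^ 2
      ≤ (Set.Icc (-h) h).indicator (fun _ => (b / h) ^ 2) t := by
    intro t
    have := hk.abs_kernelMoment_le hh a t
    rw [← sq_abs]
    by_cases ht : t ∈ Set.Icc (-h) h
    · rw [Set.indicator_of_mem ht] at this ⊢
      exact pow_le_pow_left₀ (abs_nonneg _) this 2
    · rw [Set.indicator_of_notMem ht] at this ⊢
      simp [le_antisymm this (abs_nonneg _)]
  refine (integral_mono_of_nonneg (ae_of_all _ fun t => sq_nonneg _)
    ((integrable_indicator_iff measurableSet_Icc).2 (by simp)) (ae_of_all _ h1)).trans ?_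
  rw [integral_indicator measurableSet_Icc, setIntegral_const, smul_eq_mul]
  have h2 := ENNReal.toReal_mono ENNReal.ofReal_ne_top (hμ.measure_Icc_le hr)
  have h3 := hμ.upper_nonneg
  rw [ENNReal.toReal_ofReal (by positivity)] at h2
  calc μ.real (Set.Icc (-h) h) * (b / h) ^ 2 ≤ 2 * C * h * (b / h) ^ 2 := by
        gcongr; exact h2
    _ = _ := by field_simp

/-- If the sample moments of the kernel are close to their expectations, the rescaled Gram form
is bounded below. -/
lemma gram_lower {μ : Measure ℝ} [IsProbabilityMeasure μ] {r c C : ℝ} (hk : IsSideKernel k b)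
    (hμ : DensityBounds μ r c C) (hh : 0 < h) (hr : h ≤ r) {p : ℕ} {l : ℝ}
    (hl : ∀ y : Fin (p + 1) → ℝ, l * ‖y‖ ^ 2 ≤ ∫ t, k t * (polyVec p t ⬝ᵥ y) ^ 2)
    {n : ℕ} {t : ℝ} {x : Fin n → ℝ}
    (hx : ∀ a ∈ Finset.range (2 * p + 1),
      |∑ i, kernelMoment k h a (x i) - n * ∫ y, kernelMoment k h a y ∂μ| ≤ n * t)
    (y : Fin (p + 1) → ℝ) :
    n * (c * l - (p + 1) ^ 2 * t) * ‖y‖ ^ 2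
      ≤ ∑ i, scaled k h (x i) * (polyVec p (x i / h) ⬝ᵥ y) ^ 2 := by
  have hexp : ∀ z : ℝ, scaled k h z * (polyVec p (z / h) ⬝ᵥ y) ^ 2
      = ∑ a : Fin (p + 1), ∑ e : Fin (p + 1),
        kernelMoment k h ((a : ℕ) + (e : ℕ)) z * (y a * y e) :=
    fun z => mul_polyVec_dotProduct_sq _ _ _
  have hmint : ∀ a, Integrable (kernelMoment k h a) μ := fun a =>
    ((integrable_indicator_iff measurableSet_Icc).2 (by simp)).mono'
      (hk.measurable_kernelMoment a).aestronglyMeasurable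
      (ae_of_all _ (hk.abs_kernelMoment_le hh a))
  have hint : Integrable (fun z => scaled k h z * (polyVec p (z / h) ⬝ᵥ y) ^ 2) μ := by
    simp_rw [hexp]
    exact integrable_finsetSum _ fun a _ => integrable_finsetSum _ fun e _ =>
      (hmint _).mul_const _
  -- The density is at least c on the window, and the substitution z = h s turns the Lebesgue
  -- integral into the unscaled form.
  have h1 : c * (l * ‖y‖ ^ 2) ≤ ∫ z, scaled k h z * (polyVec p (z / h) ⬝ᵥ y) ^ 2 ∂μ := by
    refine le_trans ?_ (hμ.le_integral (fun z => mul_nonneg (hk.scaled_nonneg hh z) (sq_nonneg _))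
      (fun z hz => by rw [hk.scaled_eq_zero hh (hr.trans_lt hz), zero_mul]) hint)
    refine mul_le_mul_of_nonneg_left ((hl y).trans (le_of_eq ?_)) hμ.lower_pos.le
    have := Measure.integral_comp_div (fun s => k s * (polyVec p s ⬝ᵥ y) ^ 2) h
    rw [abs_of_pos hh, smul_eq_mul] at this
    rw [← mul_right_inj' hh.ne', ← this, ← integral_const_mul]
    congr 1; ext z
    rw [scaled]; field_simp
  have h2 : ∫ z, scaled k h z * (polyVec p (z / h) ⬝ᵥ y) ^ 2 ∂μ
      = ∑ a : Fin (p + 1), ∑ e : Fin (p + 1),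
        (∫ z, kernelMoment k h ((a : ℕ) + (e : ℕ)) z ∂μ) * (y a * y e) := by
    simp_rw [hexp]
    rw [integral_finsetSum _ fun a _ => integrable_finsetSum _ fun c _ =>
      (hmint _).mul_const _]
    refine Finset.sum_congr rfl fun a _ => ?_
    rw [integral_finsetSum _ fun c _ => (hmint _).mul_const _]
    refine Finset.sum_congr rfl fun c _ => ?_
    rw [integral_mul_const]
  have h3 : ∑ i, scaled k h (x i) * (polyVec p (x i / h) ⬝ᵥ y) ^ 2
      = ∑ a : Fin (p + 1), ∑ e : Fin (p + 1),
        (∑ i, kernelMoment k h ((a : ℕ) + (e : ℕ)) (x i)) * (y a * y e) := by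
    simp_rw [hexp, Finset.sum_mul]
    rw [Finset.sum_comm]
    refine Finset.sum_congr rfl fun a _ => ?_
    rw [Finset.sum_comm]
  -- The (p+1)² entries are each off by at most n t, and |y_a y_e| ≤ ‖y‖² in the sup norm.
  have h4 : |∑ i, scaled k h (x i) * (polyVec p (x i / h) ⬝ᵥ y) ^ 2
      - n * ∫ z, scaled k h z * (polyVec p (z / h) ⬝ᵥ y) ^ 2 ∂μ|
      ≤ n * ((p + 1) ^ 2 * t) * ‖y‖ ^ 2 := by
    have hdiff : ∀ F G : ℕ → ℝ, (∑ a : Fin (p + 1), ∑ e : Fin (p + 1),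
        F ((a : ℕ) + e) * (y a * y e)) - n * ∑ a : Fin (p + 1), ∑ e : Fin (p + 1),
        G ((a : ℕ) + e) * (y a * y e) = ∑ a : Fin (p + 1), ∑ e : Fin (p + 1),
        (F ((a : ℕ) + e) - n * G ((a : ℕ) + e)) * (y a * y e) := by
      intro F G
      simp only [Finset.mul_sum, ← Finset.sum_sub_distrib]
      exact Finset.sum_congr rfl fun a _ => Finset.sum_congr rfl fun e _ => by ring
    rw [h2, h3, hdiff (fun a => ∑ i, kernelMoment k h a (x i))
      (fun a => ∫ z, kernelMoment k h a z ∂μ)]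
    calc _ ≤ ∑ a : Fin (p + 1), ∑ e : Fin (p + 1), n * t * ‖y‖ ^ 2 := by
          refine (Finset.abs_sum_le_sum_abs _ _).trans (Finset.sum_le_sum fun a _ => ?_)
          refine (Finset.abs_sum_le_sum_abs _ _).trans (Finset.sum_le_sum fun e _ => ?_)
          rw [abs_mul, abs_mul]
          have h5 := hx ((a : ℕ) + e) (Finset.mem_range.2 (by omega))
          have h6 : |y a| * |y e| ≤ ‖y‖ ^ 2 := by
            rw [sq]
            exact mul_le_mul (norm_le_pi_norm y a) (norm_le_pi_norm y e) (abs_nonneg _)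
              (norm_nonneg _)
          exact mul_le_mul h5 h6 (by positivity) ((abs_nonneg _).trans h5)
      _ = _ := by simp; ring
  have h5 := (abs_le.1 h4).1
  have h6 := mul_le_mul_of_nonneg_left h1 (Nat.cast_nonneg (α := ℝ) n)
  nlinarith

/-- Union bound over the 2p + 1 moments; each has sample variance of order n/h, which Chebyshev
compares with (n t)². -/
lemma measure_gram_bad_le {μ : Measure ℝ} [IsProbabilityMeasure μ] {r c C : ℝ}
    (hk : IsSideKernel k b) (hμ : DensityBounds μ r c C) (hh : 0 < h) (hr : h ≤ r) (p : ℕ)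
    {n : ℕ} (hn : 0 < n) {t : ℝ} (ht : 0 < t) :
    Measure.pi (fun _ : Fin n => μ) {x | ¬ ∀ a ∈ Finset.range (2 * p + 1),
      |∑ i, kernelMoment k h a (x i) - n * ∫ y, kernelMoment k h a y ∂μ| ≤ n * t}
      ≤ (2 * p + 1 : ℕ) * ENNReal.ofReal (2 * C * b ^ 2 / t ^ 2 / (n * h)) := by
  have hn' : (0 : ℝ) < n := Nat.cast_pos.2 hn
  have hsub : {x : Fin n → ℝ | ¬ ∀ a ∈ Finset.range (2 * p + 1),
      |∑ i, kernelMoment k h a (x i) - n * ∫ y, kernelMoment k h a y ∂μ| ≤ n * t}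
      ⊆ ⋃ a ∈ Finset.range (2 * p + 1),
        {x | n * t ≤ |∑ i, kernelMoment k h a (x i) - n * ∫ y, kernelMoment k h a y ∂μ|} := by
    intro x hx
    simp only [Set.mem_ofPred_eq, not_forall, not_le] at hx
    obtain ⟨a, ha, hx⟩ := hx
    exact Set.mem_biUnion ha hx.le
  refine (measure_mono hsub).trans ((measure_biUnion_finset_le _ _).trans ?_)
  refine (Finset.sum_le_card_nsmul _ _ (ENNReal.ofReal (2 * C * b ^ 2 / t ^ 2 / (n * h)))
    fun a _ => ?_).trans (by simp)
  have hb : ∀ x, |kernelMoment k h a x| ≤ b / h := fun x =>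
    (hk.abs_kernelMoment_le hh a x).trans (Set.indicator_le_self' (fun _ _ =>
      div_nonneg hk.bound_nonneg hh.le) x)
  refine (pi_chebyshev μ n (hk.measurable_kernelMoment a) hb (by positivity)).trans
    (ENNReal.ofReal_le_ofReal ?_)
  calc _ ≤ n * (2 * C * b ^ 2 / h) / (n * t) ^ 2 := by
        gcongr; exact hk.integral_kernelMoment_sq_le hμ hh hr a
    _ = _ := by field_simp

end IsSideKernel

open Classical in
/-- The number of sample points in a set of large expected count is rarely below `R`. -/
lemma measure_card_lt_le (μ : Measure ℝ) [IsProbabilityMeasure μ] (n R : ℕ) {s : Set ℝ}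
    (hs : MeasurableSet s) (h2 : 2 * (R : ℝ) < n * μ.real s) :
    Measure.pi (fun _ : Fin n => μ) {x | ¬ R ≤ (Finset.univ.filter fun i => x i ∈ s).card}
      ≤ ENNReal.ofReal (4 / (n * μ.real s)) := by
  have hpos : 0 < n * μ.real s := lt_of_le_of_lt (by positivity) h2
  have hE : ∫ y, s.indicator (fun _ => (1 : ℝ)) y ∂μ = μ.real s := by
    rw [integral_indicator hs]; simp
  have hsq : ∀ y, s.indicator (fun _ => (1 : ℝ)) y ^ 2 = s.indicator (fun _ => (1 : ℝ)) y := by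
    intro y; by_cases hy : y ∈ s <;> simp [hy]
  -- Since R is below half the expected count, a count below R deviates from its mean by at least
  -- that half; hence the 4 in the bound.
  have hsub : {x : Fin n → ℝ | ¬ R ≤ (Finset.univ.filter fun i => x i ∈ s).card}
      ⊆ {x | n * μ.real s / 2 ≤ |∑ i, s.indicator (fun _ => (1 : ℝ)) (x i)
        - n * ∫ y, s.indicator (fun _ => (1 : ℝ)) y ∂μ|} := by
    intro x hx
    simp only [Set.mem_ofPred_eq, not_le] at hx ⊢
    have hsum : ∑ i, s.indicator (fun _ => (1 : ℝ)) (x i)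
        = ((Finset.univ.filter fun i => x i ∈ s).card : ℝ) := by
      simp [Set.indicator_apply]
    rw [hsum, hE, abs_sub_comm]
    refine le_trans ?_ (le_abs_self _)
    have : ((Finset.univ.filter fun i => x i ∈ s).card : ℝ) < R := by exact_mod_cast hx
    linarith
  refine (measure_mono hsub).trans ((pi_chebyshev μ n (measurable_const.indicator hs) (b := 1)
    (fun y => ?_) (by positivity)).trans (ENNReal.ofReal_le_ofReal (le_of_eq ?_)))
  · by_cases hy : y ∈ s <;> simp [hy]
  · simp_rw [hsq, hE]
    field_simp; norm_num

end FlexRD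

/-! ### Resampling one unit, and orthogonality of conditionally centred sums -/

namespace FlexRD

section Resample

variable {α : Type*} [MeasurableSpace α]

lemma measurable_update_pair {n : ℕ} (j : Fin n) :
    Measurable fun q : (Fin n → α) × α => Function.update q.1 j q.2 := by
  rw [measurable_pi_iff]
  intro i
  by_cases h : i = j
  · subst h; simpa using measurable_snd
  · simp only [Function.update_of_ne h]
    exact (measurable_pi_apply i).comp measurable_fst

/-- Replacing one coordinate by an independent copy preserves a product measure. -/
lemma measurePreserving_update_pair (ν : Measure α) [IsProbabilityMeasure ν] {n : ℕ} (j : Fin n) :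
    MeasurePreserving (fun q : (Fin n → α) × α => Function.update q.1 j q.2)
      ((Measure.pi fun _ => ν).prod ν) (Measure.pi fun _ => ν) := by
  refine ⟨measurable_update_pair j, ?_⟩
  symm
  apply Measure.pi_eq
  intro s hs
  rw [Measure.map_apply (measurable_update_pair j) (MeasurableSet.univ_pi hs)]
  have hpre : (fun q : (Fin n → α) × α => Function.update q.1 j q.2) ⁻¹' Set.univ.pi s
      = (Set.univ.pi fun i => if i = j then Set.univ else s i) ×ˢ s j := by
    ext q
    simp only [Set.mem_preimage, Set.mem_pi, Set.mem_univ, true_imp_iff, Set.mem_prod]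
    constructor
    · intro h
      refine ⟨fun i => ?_, by simpa using h j⟩
      by_cases hij : i = j
      · simp [hij]
      · simpa [hij] using h i
    · rintro ⟨h1, h2⟩ i
      by_cases hij : i = j
      · subst hij; simpa using h2
      · simpa [hij] using h1 i
  rw [hpre, Measure.prod_prod, Measure.pi_pi,
    ← Finset.mul_prod_erase Finset.univ (fun i => ν (s i)) (Finset.mem_univ j),
    ← Finset.mul_prod_erase Finset.univ _ (Finset.mem_univ j)]
  simp only [if_true, measure_univ, one_mul]
  rw [mul_comm]
  congr 1
  refine Finset.prod_congr rfl fun i hi => ?_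
  rw [if_neg (Finset.ne_of_mem_erase hi)]

/-- Takes the place of conditioning on all units except j: the inner integral runs over a fresh copy
of unit j with the others frozen. -/
lemma lintegral_pi_resample (ν : Measure α) [IsProbabilityMeasure ν] {n : ℕ} (j : Fin n)
    {F : (Fin n → α) → ℝ≥0∞} (hF : Measurable F) :
    ∫⁻ w, F w ∂(Measure.pi fun _ => ν)
      = ∫⁻ w, ∫⁻ o, F (Function.update w j o) ∂ν ∂(Measure.pi fun _ => ν) := by
  rw [← (measurePreserving_update_pair ν j).lintegral_comp hF]
  exact lintegral_prod _ (hF.comp (measurable_update_pair j)).aemeasurable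

lemma integrable_pi_eval {ν : Measure α} [IsProbabilityMeasure ν] {n : ℕ} (j : Fin n)
    {F : α → ℝ} (hF : Integrable F ν) :
    Integrable (fun w => F (w j)) (Measure.pi fun _ : Fin n => ν) :=
  (measurePreserving_eval (fun _ : Fin n => ν) j).integrable_comp_of_integrable hF

lemma integral_pi_eval {ν : Measure α} [IsProbabilityMeasure ν] {n : ℕ} (j : Fin n)
    {F : α → ℝ} (hF : AEStronglyMeasurable F ν) :
    ∫ w, F (w j) ∂(Measure.pi fun _ : Fin n => ν) = ∫ o, F o ∂ν := by
  have := measurePreserving_eval (fun _ : Fin n => ν) j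
  conv_rhs => rw [← this.map_eq]
  rw [integral_map this.aemeasurable (by rwa [this.map_eq])]

end Resample

section Orthogonality

variable {E : Type*} [MeasurableSpace E] {μ : Measure ℝ} [IsProbabilityMeasure μ]
  {κ : Kernel ℝ E} [IsMarkovKernel κ] {n : ℕ}

/-- A function of unit `j` that is conditionally centred given the running variable is orthogonal
to everything that depends on unit `j` through its running variable only. -/
lemma integral_centred_mul_eq_zero {ψ : ℝ × E → ℝ} (hψ : ∀ x, ∫ y, ψ (x, y) ∂(κ x) = 0)
    (j : Fin n) {H : (Fin n → ℝ × E) → ℝ}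
    (hH : ∀ w x y y', H (Function.update w j (x, y)) = H (Function.update w j (x, y'))) :
    ∫ w, ψ (w j) * H w ∂(Measure.pi fun _ => μ ⊗ₘ κ) = 0 := by
  -- Integrability need not be assumed: where it fails, here or on a slice, the Bochner integral is
  -- 0 by convention.
  by_cases hint : Integrable (fun w => ψ (w j) * H w) (Measure.pi fun _ => μ ⊗ₘ κ)
  swap
  · exact integral_undef hint
  have hmp := measurePreserving_update_pair (μ ⊗ₘ κ) j
  have hint' := hmp.integrable_comp_of_integrable hint
  rw [← hmp.map_eq, integral_map hmp.aemeasurable (by rw [hmp.map_eq]; exact hint.1)]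
  refine (integral_prod _ hint').trans ?_
  refine integral_eq_zero_of_ae (ae_of_all _ fun w => ?_)
  by_cases hw : Integrable (fun o => ψ (Function.update w j o j) * H (Function.update w j o))
      (μ ⊗ₘ κ)
  swap
  · exact integral_undef hw
  simp only [Pi.zero_apply]
  refine (Measure.integral_compProd hw).trans ?_
  refine integral_eq_zero_of_ae (ae_of_all _ fun x => ?_)
  simp only [Function.update_self, Pi.zero_apply]
  -- H does not see the second component of unit j, so that component can be frozen and H leaves the
  -- inner integral.
  simp_rw [fun y => hH w x y (w j).2]
  rw [integral_mul_const, hψ, zero_mul]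

/-- The second moment of a sum of conditionally centred terms, each of which involves the other
units only through their running variables or through units with a smaller index. -/
lemma integral_sq_sum_eq {ψ : ℝ × E → ℝ} (hψ : ∀ x, ∫ y, ψ (x, y) ∂(κ x) = 0)
    {H : Fin n → (Fin n → ℝ × E) → ℝ}
    (hH : ∀ j k, j ≤ k → ∀ w x y y',
      H j (Function.update w k (x, y)) = H j (Function.update w k (x, y')))
    (hL2 : ∀ j, MemLp (fun w => ψ (w j) * H j w) 2 (Measure.pi fun _ => μ ⊗ₘ κ)) :
    ∫ w, (∑ j, ψ (w j) * H j w) ^ 2 ∂(Measure.pi fun _ => μ ⊗ₘ κ)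
      = ∑ j, ∫ w, (ψ (w j) * H j w) ^ 2 ∂(Measure.pi fun _ => μ ⊗ₘ κ) := by
  -- The unit with the larger index is the one integrated out: every other factor involves it
  -- through its running variable only.
  have hcross : ∀ j k, j < k → ∫ w, (ψ (w j) * H j w) * (ψ (w k) * H k w)
      ∂(Measure.pi fun _ => μ ⊗ₘ κ) = 0 := by
    intro j k hjk
    have := integral_centred_mul_eq_zero (μ := μ) (κ := κ) hψ k
      (H := fun w => ψ (w j) * H j w * H k w) (fun w x y y' => by
        rw [Function.update_of_ne hjk.ne, Function.update_of_ne hjk.ne, hH j k hjk.le w x y y',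
          hH k k le_rfl w x y y'])
    rw [← this]
    congr 1; ext w; ring
  have hint : ∀ j k, Integrable (fun w => (ψ (w j) * H j w) * (ψ (w k) * H k w))
      (Measure.pi fun _ => μ ⊗ₘ κ) := fun j k => (hL2 j).integrable_mul (hL2 k)
  simp_rw [sq, Finset.sum_mul_sum]
  rw [integral_finsetSum _ fun j _ => integrable_finsetSum _ fun k _ => hint j k]
  refine Finset.sum_congr rfl fun j _ => ?_
  rw [integral_finsetSum _ fun k _ => hint j k, Finset.sum_eq_single j]
  · intro k _ hkj
    rcases lt_or_gt_of_ne hkj with h | h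
    · rw [← hcross k j h]; congr 1; ext w; ring
    · exact hcross j k h
  · simp

/-- Symmetry folds the upper triangle onto the lower one. The off-diagonal part then has the form of
a sum of martingale differences: each e_j multiplies a combination of earlier terms. -/
lemma sum_symm_split {n : ℕ} (B : Fin n → Fin n → ℝ) (hB : ∀ j l, B j l = B l j)
    (e : Fin n → ℝ) :
    ∑ j, ∑ l, B j l * (e j * e l)
      = ∑ j, B j j * e j ^ 2 + ∑ j, e j * (2 * ∑ l ∈ Finset.univ.filter (· < j), B j l * e l) := by
  have h1 : ∀ j, ∑ l, B j l * (e j * e l) = B j j * e j ^ 2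
      + ∑ l ∈ Finset.univ.filter (· < j), B j l * (e j * e l)
      + ∑ l ∈ Finset.univ.filter (j < ·), B j l * (e j * e l) := by
    intro j
    rw [Finset.sum_filter, Finset.sum_filter, add_assoc, ← Finset.sum_add_distrib,
      ← Finset.add_sum_erase _ _ (Finset.mem_univ j)]
    conv_rhs => rw [← Finset.add_sum_erase _ _ (Finset.mem_univ j)]
    simp only [lt_irrefl, if_false, add_zero, zero_add]
    congr 1
    · ring
    · refine Finset.sum_congr rfl fun l hl => ?_
      rcases lt_or_gt_of_ne (Finset.ne_of_mem_erase hl) with h | h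
      · simp [h, h.le.not_gt]
      · simp [h, h.le.not_gt]
  have h2 : ∑ j, ∑ l ∈ Finset.univ.filter (j < ·), B j l * (e j * e l)
      = ∑ j, ∑ l ∈ Finset.univ.filter (· < j), B j l * (e j * e l) := by
    simp only [Finset.sum_filter]
    rw [Finset.sum_comm]
    refine Finset.sum_congr rfl fun j _ => Finset.sum_congr rfl fun l _ => ?_
    rw [hB, mul_comm (e l)]
  rw [Finset.sum_congr rfl fun j _ => h1 j, Finset.sum_add_distrib, Finset.sum_add_distrib, h2,
    add_assoc, ← two_mul, Finset.mul_sum]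
  congr 1
  refine Finset.sum_congr rfl fun j _ => ?_
  rw [Finset.mul_sum, Finset.mul_sum, Finset.mul_sum]
  exact Finset.sum_congr rfl fun l _ => by ring

/-- Cauchy–Schwarz with |a| split evenly between the factors, so that only ℓ¹ sums of coefficients
enter; these are what the neighbour structure controls. -/
lemma sq_sum_mul_le {ι : Type*} (s : Finset ι) (a e : ι → ℝ) :
    (∑ l ∈ s, a l * e l) ^ 2 ≤ (∑ l ∈ s, |a l|) * ∑ l ∈ s, |a l| * e l ^ 2 := by
  refine Finset.sum_sq_le_sum_mul_sum_of_sq_le_mul s (fun i _ => abs_nonneg _)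
    (fun i _ => by positivity) fun i _ => ?_
  rw [mul_pow, ← sq_abs (a i)]
  exact le_of_eq (by ring)

/-- Second moment bound for a centred quadratic form whose coefficients depend on the running
variables only. -/
lemma integral_sq_quadForm_le {e : ℝ × E → ℝ} {s : ℝ → ℝ} (he : Measurable e) (hs : Measurable s)
    (he0 : ∀ x, ∫ y, e (x, y) ∂(κ x) = 0)
    (he2 : ∀ x, ∫ y, (e (x, y) ^ 2 - s x) ∂(κ x) = 0)
    {K₁ K₂ : ℝ} (he4 : Integrable (fun o => e o ^ 4) (μ ⊗ₘ κ))
    (hK₁ : ∫ o, e o ^ 4 ∂(μ ⊗ₘ κ) ≤ K₁)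
    (hs2 : Integrable (fun o : ℝ × E => s o.1 ^ 2) (μ ⊗ₘ κ))
    (hK₂ : ∫ o, s o.1 ^ 2 ∂(μ ⊗ₘ κ) ≤ K₂)
    {B : (Fin n → ℝ) → Fin n → Fin n → ℝ} (hB : ∀ j l, Measurable fun x => B x j l)
    (hsymm : ∀ x j l, B x j l = B x l j) {β : ℝ} (hβ : ∀ x j, ∑ l, |B x j l| ≤ β) :
    Integrable (fun w => (∑ j, ∑ l, B (fun i => (w i).1) j l * (e (w j) * e (w l))
        - ∑ j, B (fun i => (w i).1) j j * s (w j).1) ^ 2) (Measure.pi fun _ => μ ⊗ₘ κ) ∧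
    ∫ w, (∑ j, ∑ l, B (fun i => (w i).1) j l * (e (w j) * e (w l))
        - ∑ j, B (fun i => (w i).1) j j * s (w j).1) ^ 2 ∂(Measure.pi fun _ => μ ⊗ₘ κ)
      ≤ n * β ^ 2 * (12 * K₁ + 4 * K₂) := by
  set ρ : Measure (Fin n → ℝ × E) := Measure.pi fun _ => μ ⊗ₘ κ with hρ
  set b : (Fin n → ℝ × E) → Fin n → Fin n → ℝ := fun w => B (fun i => (w i).1) with hb
  have hxm : Measurable fun (w : Fin n → ℝ × E) (i : Fin n) => (w i).1 := by fun_prop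
  have hbm : ∀ j l, Measurable fun w => b w j l := fun j l => (hB j l).comp hxm
  have hbupd : ∀ w k x y y', b (Function.update w k (x, y)) = b (Function.update w k (x, y')) := by
    intro w k x y y'
    have : (fun i => (Function.update w k (x, y) i).1)
        = fun i => (Function.update w k (x, y') i).1 := by
      ext i
      by_cases h : i = k
      · subst h; simp
      · simp [Function.update_of_ne h]
    simp only [hb, this]
  have hbb : ∀ w j, |b w j j| ≤ β := fun w j =>
    (Finset.single_le_sum (f := fun l => |b w j l|) (fun _ _ => abs_nonneg _)
      (Finset.mem_univ j)).trans (hβ _ j)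
  -- ψ drives the diagonal part and e, multiplied by G, the off-diagonal part. Both are
  -- conditionally centred, so the orthogonality lemma applies to each.
  set ψ : ℝ × E → ℝ := fun o => e o ^ 2 - s o.1 with hψ
  have hψm : Measurable ψ := (he.pow_const 2).sub (hs.comp measurable_fst)
  set G : Fin n → (Fin n → ℝ × E) → ℝ :=
    fun j w => 2 * ∑ l ∈ Finset.univ.filter (· < j), b w j l * e (w l) with hG
  have hGm : ∀ j, Measurable (G j) := fun j =>
    (Finset.measurable_sum _ fun l _ => (hbm j l).mul (he.comp (measurable_pi_apply l))).const_mul 2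
  have i4 : ∀ j, Integrable (fun w => e (w j) ^ 4) ρ := fun j => integrable_pi_eval j he4
  have i2 : ∀ j, Integrable (fun w => s (w j).1 ^ 2) ρ := fun j => integrable_pi_eval j hs2
  have E4 : ∀ j, ∫ w, e (w j) ^ 4 ∂ρ ≤ K₁ := fun j => by
    rw [hρ, integral_pi_eval (F := fun o => e o ^ 4) j he4.1]; exact hK₁
  have E2 : ∀ j, ∫ w, s (w j).1 ^ 2 ∂ρ ≤ K₂ := fun j => by
    rw [hρ, integral_pi_eval (F := fun o : ℝ × E => s o.1 ^ 2) j hs2.1]; exact hK₂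
  have d1 : ∀ j w, (ψ (w j) * b w j j) ^ 2 ≤ β ^ 2 * (2 * e (w j) ^ 4 + 2 * s (w j).1 ^ 2) := by
    intro j w
    rw [mul_pow, mul_comm]
    have h1 : b w j j ^ 2 ≤ β ^ 2 := by
      rw [← sq_abs]; exact pow_le_pow_left₀ (abs_nonneg _) (hbb w j) 2
    have h2 : ψ (w j) ^ 2 ≤ 2 * e (w j) ^ 4 + 2 * s (w j).1 ^ 2 := by
      simp only [hψ]; nlinarith [sq_nonneg (e (w j) ^ 2 + s (w j).1)]
    exact mul_le_mul h1 h2 (sq_nonneg _) (sq_nonneg _)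
  have d2 : ∀ j w, (e (w j) * G j w) ^ 2
      ≤ 2 * β * ∑ l, |b w j l| * (e (w j) ^ 4 + e (w l) ^ 4) := by
    intro j w
    have hβ0 : 0 ≤ β := (abs_nonneg _).trans (hbb w j)
    have h1 := sq_sum_mul_le (Finset.univ.filter (· < j)) (b w j) fun l => e (w l)
    have h2 : ∑ l ∈ Finset.univ.filter (· < j), |b w j l| ≤ β :=
      (Finset.sum_le_sum_of_subset_of_nonneg (Finset.filter_subset _ _)
        fun _ _ _ => abs_nonneg _).trans (hβ _ j)
    have h3 : ∑ l ∈ Finset.univ.filter (· < j), |b w j l| * e (w l) ^ 2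
        ≤ ∑ l, |b w j l| * e (w l) ^ 2 :=
      Finset.sum_le_sum_of_subset_of_nonneg (Finset.filter_subset _ _)
        fun _ _ _ => by positivity
    have h4 : (∑ l ∈ Finset.univ.filter (· < j), b w j l * e (w l)) ^ 2
        ≤ β * ∑ l, |b w j l| * e (w l) ^ 2 :=
      h1.trans (mul_le_mul h2 h3 (Finset.sum_nonneg fun _ _ => by positivity) hβ0)
    calc (e (w j) * G j w) ^ 2
        = 4 * e (w j) ^ 2 * (∑ l ∈ Finset.univ.filter (· < j), b w j l * e (w l)) ^ 2 := by
          simp only [hG]; ring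
      _ ≤ 4 * e (w j) ^ 2 * (β * ∑ l, |b w j l| * e (w l) ^ 2) := by gcongr
      _ = 2 * β * ∑ l, |b w j l| * (2 * e (w j) ^ 2 * e (w l) ^ 2) := by
          rw [Finset.mul_sum, Finset.mul_sum, Finset.mul_sum]
          exact Finset.sum_congr rfl fun l _ => by ring
      _ ≤ _ := by
          gcongr with l
          nlinarith [sq_nonneg (e (w j) ^ 2 - e (w l) ^ 2)]
  -- The bound is taken pointwise, since the coefficients are random. Cauchy–Schwarz yields one
  -- factor β; summing over j and using symmetry yields a second row sum.
  have d2sum : ∀ w, ∑ j, (e (w j) * G j w) ^ 2 ≤ 4 * β ^ 2 * ∑ j, e (w j) ^ 4 := by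
    intro w
    rcases isEmpty_or_nonempty (Fin n) with hn | ⟨⟨j0⟩⟩
    · simp
    have hβ0 : 0 ≤ β := (abs_nonneg _).trans (hbb w j0)
    refine (Finset.sum_le_sum fun j _ => d2 j w).trans ?_
    rw [← Finset.mul_sum]
    have h1 : ∑ j, ∑ l, |b w j l| * (e (w j) ^ 4 + e (w l) ^ 4)
        = 2 * ∑ j, (∑ l, |b w j l|) * e (w j) ^ 4 := by
      simp_rw [mul_add, Finset.sum_add_distrib]
      rw [two_mul]
      congr 1
      · simp_rw [Finset.sum_mul]
      · rw [Finset.sum_comm]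
        simp_rw [Finset.sum_mul]
        refine Finset.sum_congr rfl fun j _ => Finset.sum_congr rfl fun l _ => ?_
        rw [show b w l j = b w j l from hsymm _ _ _]
    rw [h1]
    calc _ ≤ 2 * β * (2 * ∑ j, β * e (w j) ^ 4) := by
          gcongr with j; exact hβ _ j
      _ = _ := by rw [← Finset.mul_sum]; ring
  have m1 : ∀ j, MemLp (fun w => ψ (w j) * b w j j) 2 ρ := fun j => by
    have hm : Measurable fun w => ψ (w j) * b w j j :=
      (hψm.comp (measurable_pi_apply j)).mul (hbm j j)
    rw [memLp_two_iff_integrable_sq hm.aestronglyMeasurable]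
    refine (((i4 j).const_mul 2).add ((i2 j).const_mul 2)).const_mul (β ^ 2) |>.mono'
      (hm.pow_const 2).aestronglyMeasurable (ae_of_all _ fun w => ?_)
    rw [Real.norm_eq_abs, abs_of_nonneg (sq_nonneg _)]
    exact d1 j w
  have m2 : ∀ j, MemLp (fun w => e (w j) * G j w) 2 ρ := fun j => by
    have hm : Measurable fun w => e (w j) * G j w :=
      (he.comp (measurable_pi_apply j)).mul (hGm j)
    rw [memLp_two_iff_integrable_sq hm.aestronglyMeasurable]
    refine ((integrable_finsetSum Finset.univ fun j _ => i4 j).const_mul (4 * β ^ 2)).mono'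
      (hm.pow_const 2).aestronglyMeasurable (ae_of_all _ fun w => ?_)
    rw [Real.norm_eq_abs, abs_of_nonneg (sq_nonneg _)]
    exact (Finset.single_le_sum (f := fun j => (e (w j) * G j w) ^ 2)
      (fun _ _ => sq_nonneg _) (Finset.mem_univ j)).trans (d2sum w)
  have o1 := integral_sq_sum_eq (μ := μ) (κ := κ) (ψ := ψ) he2 (H := fun j w => b w j j)
    (fun j k _ w x y y' => by rw [hbupd w k x y y']) m1
  have o2 := integral_sq_sum_eq (μ := μ) (κ := κ) (ψ := e) he0 (H := G)
    (fun j k hjk w x y y' => by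
      simp only [hG]
      rw [hbupd w k x y y']
      congr 1
      refine Finset.sum_congr rfl fun l hl => ?_
      have hlk : l ≠ k := ((Finset.mem_filter.1 hl).2.trans_le hjk).ne
      rw [Function.update_of_ne hlk, Function.update_of_ne hlk]) m2
  have hsplit : ∀ w, ∑ j, ∑ l, b w j l * (e (w j) * e (w l)) - ∑ j, b w j j * s (w j).1
      = ∑ j, ψ (w j) * b w j j + ∑ j, e (w j) * G j w := by
    intro w
    rw [sum_symm_split (b w) (hsymm _) fun j => e (w j), add_sub_right_comm,
      ← Finset.sum_sub_distrib]
    congr 1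
    exact Finset.sum_congr rfl fun j _ => by simp only [hψ]; ring
  have M1 : MemLp (fun w => ∑ j, ψ (w j) * b w j j) 2 ρ := memLp_finsetSum _ fun j _ => m1 j
  have M2 : MemLp (fun w => ∑ j, e (w j) * G j w) 2 ρ := memLp_finsetSum _ fun j _ => m2 j
  have hM := (M1.add M2).integrable_sq
  have b1 : ∫ w, (∑ j, ψ (w j) * b w j j) ^ 2 ∂ρ ≤ n * β ^ 2 * (2 * K₁ + 2 * K₂) := by
    rw [hρ, o1]
    refine (Finset.sum_le_card_nsmul _ _ (β ^ 2 * (2 * K₁ + 2 * K₂)) fun j _ => ?_).trans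
      (by simp [mul_assoc])
    refine (integral_mono (m1 j).integrable_sq
      ((((i4 j).const_mul 2).add ((i2 j).const_mul 2)).const_mul (β ^ 2)) (d1 j)).trans ?_
    rw [integral_const_mul]
    simp only [Pi.add_apply]
    rw [integral_add ((i4 j).const_mul 2) ((i2 j).const_mul 2), integral_const_mul,
      integral_const_mul]
    gcongr
    · exact E4 j
    · exact E2 j
  have b2 : ∫ w, (∑ j, e (w j) * G j w) ^ 2 ∂ρ ≤ n * β ^ 2 * (4 * K₁) := by
    rw [hρ, o2, ← integral_finsetSum _ fun j _ => (m2 j).integrable_sq]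
    refine (integral_mono (integrable_finsetSum _ fun j _ => (m2 j).integrable_sq)
      ((integrable_finsetSum Finset.univ fun j _ => i4 j).const_mul (4 * β ^ 2)) d2sum).trans ?_
    rw [integral_const_mul, integral_finsetSum _ fun j _ => i4 j]
    calc _ ≤ 4 * β ^ 2 * ∑ j : Fin n, K₁ := by
          gcongr with j; exact E4 j
      _ = _ := by simp; ring
  have hrw : (fun w => (∑ j, ∑ l, B (fun i => (w i).1) j l * (e (w j) * e (w l))
        - ∑ j, B (fun i => (w i).1) j j * s (w j).1) ^ 2)
      = fun w => (∑ j, ψ (w j) * b w j j + ∑ j, e (w j) * G j w) ^ 2 := by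
    ext w; rw [← hsplit w]
  rw [hrw]
  refine ⟨hM, ?_⟩
  -- (u + v)² ≤ 2u² + 2v² doubles both bounds: 12 = 2·2 + 2·4 and 4 = 2·2.
  calc _ ≤ ∫ w, (2 * (∑ j, ψ (w j) * b w j j) ^ 2 + 2 * (∑ j, e (w j) * G j w) ^ 2) ∂ρ := by
        refine integral_mono hM ((M1.integrable_sq.const_mul 2).add
          (M2.integrable_sq.const_mul 2)) fun w => ?_
        simp only
        nlinarith [sq_nonneg (∑ j, ψ (w j) * b w j j - ∑ j, e (w j) * G j w)]
    _ = 2 * ∫ w, (∑ j, ψ (w j) * b w j j) ^ 2 ∂ρ + 2 * ∫ w, (∑ j, e (w j) * G j w) ^ 2 ∂ρ := by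
        rw [integral_add (M1.integrable_sq.const_mul 2) (M2.integrable_sq.const_mul 2),
          integral_const_mul, integral_const_mul]
    _ ≤ 2 * (n * β ^ 2 * (2 * K₁ + 2 * K₂)) + 2 * (n * β ^ 2 * (4 * K₁)) := by gcongr
    _ = _ := by ring

end Orthogonality

end FlexRD

/-! ### The variance estimator as a quadratic form: deterministic bounds -/

namespace FlexRD

/-- The coefficient of unit `l` in the nearest-neighbour contrast at unit `i`. -/
noncomputable def nnCoef {n : ℕ} (R : ℕ) (x : Fin n → ℝ) (i l : Fin n) : ℝ :=
  (if l = i then 1 else 0) - if l ∈ neighbors R x i then 1 / (R : ℝ) else 0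

/-- The coefficients of `∑ i, a i * (∑ l, nnCoef R x i l * e l) ^ 2` as a quadratic form in `e`. -/
noncomputable def quadCoef {n : ℕ} (R : ℕ) (x : Fin n → ℝ) (a : Fin n → ℝ) (j l : Fin n) : ℝ :=
  ∑ i, a i * (nnCoef R x i j * nnCoef R x i l)

variable {n R : ℕ} {x : Fin n → ℝ}

lemma self_notMem_neighbors (i : Fin n) : i ∉ neighbors R x i :=
  fun h => (rival_of_mem_neighbors h).1 rfl

lemma sum_nnCoef_mul (i : Fin n) (y : Fin n → ℝ) :
    ∑ l, nnCoef R x i l * y l = y i - 1 / (R : ℝ) * ∑ j ∈ neighbors R x i, y j := by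
  simp [nnCoef, sub_mul, Finset.sum_sub_distrib, Finset.mul_sum]

lemma nnVar_eq (y : Fin n → ℝ) (i : Fin n) :
    nnVar R x y i = (R : ℝ) / (R + 1) * (∑ l, nnCoef R x i l * y l) ^ 2 := by
  rw [sum_nnCoef_mul, nnVar]

lemma abs_nnCoef (i l : Fin n) :
    |nnCoef R x i l| = (if l = i then 1 else 0) + if l ∈ neighbors R x i then 1 / (R : ℝ) else 0 := by
  unfold nnCoef
  by_cases h : l = i
  · subst h; simp [self_notMem_neighbors]
  · rw [if_neg h, zero_sub, zero_add, abs_neg, abs_of_nonneg]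
    split_ifs <;> positivity

lemma nnCoef_sq (i l : Fin n) :
    nnCoef R x i l ^ 2
      = (if l = i then 1 else 0) + if l ∈ neighbors R x i then (1 / (R : ℝ)) ^ 2 else 0 := by
  unfold nnCoef
  by_cases h : l = i
  · subst h; simp [self_notMem_neighbors]
  · rw [if_neg h, zero_sub, zero_add, neg_sq]
    split_ifs <;> simp

/-- The contrast annihilates constants, so the conditional mean enters only through differences
between neighbours. -/
lemma sum_nnCoef (hR : 1 ≤ R) {i : Fin n} (hi : (neighbors R x i).card = R) :
    ∑ l, nnCoef R x i l = 0 := by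
  have hR' : (R : ℝ) ≠ 0 := by positivity
  have := sum_nnCoef_mul (R := R) (x := x) i fun _ => 1
  simpa [hi, hR'] using this

lemma sum_abs_nnCoef_le {i : Fin n} (hi : (neighbors R x i).card = R) :
    ∑ l, |nnCoef R x i l| ≤ 2 := by
  simp only [abs_nnCoef, Finset.sum_add_distrib]
  simp only [Finset.sum_ite_eq', Finset.mem_univ, if_true, Finset.sum_ite_mem, Finset.univ_inter,
    Finset.sum_const, hi, nsmul_eq_mul, one_div]
  have := mul_inv_le_one (a := (R : ℝ))
  linarith

/-- The sum of squares is 1 + R · R⁻² = (R+1)/R. This is why the normalisation R/(R+1) reproduces a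
locally constant variance without bias. -/
lemma sum_nnCoef_sq (hR : 1 ≤ R) {i : Fin n} (hi : (neighbors R x i).card = R) :
    (R : ℝ) / (R + 1) * ∑ l, nnCoef R x i l ^ 2 = 1 := by
  have hR' : (R : ℝ) ≠ 0 := by positivity
  simp only [nnCoef_sq, Finset.sum_add_distrib]
  simp only [Finset.sum_ite_eq', Finset.mem_univ, if_true, Finset.sum_ite_mem, Finset.univ_inter,
    Finset.sum_const, hi, nsmul_eq_mul]
  field_simp

/-- Total contrast weight received by a unit. -/
lemma sum_mul_abs_nnCoef_le (hx : Function.Injective x) {a : Fin n → ℝ} {c : ℝ} (hc : 0 ≤ c)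
    (ha : ∀ i, a i ≤ c) (l : Fin n) :
    ∑ i, a i * |nnCoef R x i l| ≤ 3 * c := by
  classical
  -- A unit has coefficient 1 in its own contrast and 1/R in absolute value in at most 2R others: 1
  -- + 2R · (1/R) ≤ 3.
  have hmult := card_filter_mem_neighbors_le (R := R) hx l
  calc _ ≤ ∑ i, c * |nnCoef R x i l| := by
        gcongr with i; exact ha i
    _ = c * (1 + (Finset.univ.filter fun i => l ∈ neighbors R x i).card * (1 / (R : ℝ))) := by
        rw [← Finset.mul_sum]
        simp only [abs_nnCoef, Finset.sum_add_distrib]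
        congr 2
        · simp
        · rw [← Finset.sum_filter, Finset.sum_const, nsmul_eq_mul]
    _ ≤ c * (1 + (2 * R : ℕ) * (1 / (R : ℝ))) := by gcongr
    _ ≤ 3 * c := by
        have := mul_inv_le_one (a := (R : ℝ))
        push_cast
        rw [one_div]
        nlinarith

lemma quadCoef_symm (a : Fin n → ℝ) (j l : Fin n) :
    quadCoef R x a j l = quadCoef R x a l j := by
  unfold quadCoef
  exact Finset.sum_congr rfl fun i _ => by ring

/-- Summing over l first gives the ℓ¹ norm of a contrast, at most 2; the remaining sum is the weight
reaching unit j, at most 3c. -/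
lemma sum_abs_quadCoef_le (hx : Function.Injective x) {a : Fin n → ℝ} {c : ℝ} (hc : 0 ≤ c)
    (ha0 : ∀ i, 0 ≤ a i) (ha : ∀ i, a i ≤ c) (hcard : ∀ i, a i ≠ 0 → (neighbors R x i).card = R)
    (j : Fin n) : ∑ l, |quadCoef R x a j l| ≤ 6 * c := by
  calc ∑ l, |quadCoef R x a j l|
      ≤ ∑ l, ∑ i, a i * (|nnCoef R x i j| * |nnCoef R x i l|) := by
        refine Finset.sum_le_sum fun l _ => (Finset.abs_sum_le_sum_abs _ _).trans ?_
        refine Finset.sum_le_sum fun i _ => le_of_eq ?_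
        rw [abs_mul, abs_mul, abs_of_nonneg (ha0 i)]
    _ = ∑ i, a i * |nnCoef R x i j| * ∑ l, |nnCoef R x i l| := by
        rw [Finset.sum_comm]
        refine Finset.sum_congr rfl fun i _ => ?_
        rw [Finset.mul_sum]
        exact Finset.sum_congr rfl fun l _ => by ring
    _ ≤ ∑ i, a i * |nnCoef R x i j| * 2 := by
        refine Finset.sum_le_sum fun i _ => ?_
        by_cases h : a i = 0
        · simp [h]
        · exact mul_le_mul_of_nonneg_left (sum_abs_nnCoef_le (hcard i h))
            (mul_nonneg (ha0 i) (abs_nonneg _))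
    _ ≤ 6 * c := by
        rw [← Finset.sum_mul]
        have := sum_mul_abs_nnCoef_le (R := R) hx hc ha j
        linarith

lemma sum_mul_sq_eq_quadCoef (a e : Fin n → ℝ) :
    ∑ i, a i * (∑ l, nnCoef R x i l * e l) ^ 2
      = ∑ j, ∑ l, quadCoef R x a j l * (e j * e l) := by
  unfold quadCoef
  simp_rw [sq, Finset.sum_mul_sum, Finset.sum_mul, Finset.mul_sum]
  rw [Finset.sum_comm]
  refine Finset.sum_congr rfl fun j _ => ?_
  rw [Finset.sum_comm]
  exact Finset.sum_congr rfl fun l _ => Finset.sum_congr rfl fun i _ => by ring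

/-- Young's inequality. D will be the noise contrast, whose weighted square is bounded in mean, and
E a vanishing perturbation; τ is left free so that both terms can be made small. -/
lemma abs_add_sq_sub_sq_le {τ : ℝ} (hτ : 0 < τ) (D E : ℝ) :
    |(D + E) ^ 2 - D ^ 2| ≤ τ * D ^ 2 + (1 + 1 / τ) * E ^ 2 := by
  have h1 : 2 * |D * E| ≤ τ * D ^ 2 + 1 / τ * E ^ 2 := by
    have h2 : 0 ≤ 1 / τ * (τ * |D| - |E|) ^ 2 := by positivity
    have h3 : 1 / τ * (τ * |D| - |E|) ^ 2 = τ * |D| ^ 2 + 1 / τ * |E| ^ 2 - 2 * (|D| * |E|) := by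
      field_simp; ring
    rw [sq_abs, sq_abs, ← abs_mul] at h3
    linarith
  have h4 : (D + E) ^ 2 - D ^ 2 = 2 * (D * E) + E ^ 2 := by ring
  rw [h4]
  refine (abs_add_le _ _).trans ?_
  rw [abs_mul, abs_two, abs_of_nonneg (sq_nonneg E)]
  linarith

/-- Deviation of the weighted nearest-neighbour variance estimator from the weighted variances. -/
lemma abs_sum_nnVar_sub_le (hR : 1 ≤ R) (hx : Function.Injective x) {a : Fin n → ℝ} {c : ℝ}
    (hc : 0 ≤ c) (ha0 : ∀ i, 0 ≤ a i) (ha : ∀ i, a i ≤ c) (J : Finset (Fin n))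
    (hJ : ∀ i, a i ≠ 0 → (neighbors R x i).card = R ∧ i ∈ J ∧ neighbors R x i ⊆ J)
    {y m e d s : Fin n → ℝ} (hy : ∀ i ∈ J, y i = m i + e i - d i) {β τ : ℝ} (hτ : 0 < τ)
    (hm : ∀ i, a i ≠ 0 → ∀ l ∈ neighbors R x i, |m l - m i| ≤ β)
    (hs : ∀ i, a i ≠ 0 → ∀ l ∈ neighbors R x i, |s l - s i| ≤ β) (hβ : 0 ≤ β) :
    |∑ i, a i * nnVar R x y i - ∑ i, a i * s i|
      ≤ |∑ j, ∑ l, quadCoef R x a j l * (e j * e l) - ∑ j, quadCoef R x a j j * s j|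
        + (τ * (6 * c * ∑ l ∈ J, e l ^ 2)
          + (1 + 1 / τ) * (8 * β ^ 2 * (c * J.card) + 12 * c * ∑ l ∈ J, d l ^ 2))
        + β * (c * J.card) := by
  set g := nnCoef R x with hg
  have hgJ : ∀ i, a i ≠ 0 → ∀ l, l ∉ J → g i l = 0 := by
    intro i hi l hl
    obtain ⟨-, h2, h3⟩ := hJ i hi
    have h4 : l ≠ i := fun h => hl (h ▸ h2)
    have h5 : l ∉ neighbors R x i := fun h => hl (h3 h)
    simp [hg, nnCoef, h4, h5]
  have hclose : ∀ (u : Fin n → ℝ), (∀ i, a i ≠ 0 → ∀ l ∈ neighbors R x i, |u l - u i| ≤ β) →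
      ∀ i, a i ≠ 0 → ∀ l, g i l ≠ 0 → |u l - u i| ≤ β := by
    intro u hu i hi l hl
    by_cases h : l = i
    · subst h; simpa using hβ
    · refine hu i hi l ?_
      by_contra hc
      exact hl (by simp [hg, nnCoef, h, hc])
  -- Exchanging the sums turns contrast sums over units i into weights received by units l, which
  -- are at most 3c; this produces the constants 6 = 2·3 and 12 = 4·3.
  have hsumJ : ∀ u : Fin n → ℝ, (∀ l, 0 ≤ u l) →
      ∑ i, a i * ∑ l, |g i l| * u l ≤ 3 * c * ∑ l ∈ J, u l := by
    intro u hu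
    calc ∑ i, a i * ∑ l, |g i l| * u l = ∑ i, ∑ l ∈ J, a i * |g i l| * u l := by
          refine Finset.sum_congr rfl fun i _ => ?_
          by_cases hi : a i = 0
          · simp [hi]
          · rw [Finset.mul_sum]
            symm
            rw [← Finset.sum_subset (Finset.subset_univ J)]
            · exact Finset.sum_congr rfl fun l _ => by ring
            · intro l _ hl
              rw [hgJ i hi l hl]; simp
      _ = ∑ l ∈ J, (∑ i, a i * |g i l|) * u l := by
          rw [Finset.sum_comm]
          exact Finset.sum_congr rfl fun l _ => (Finset.sum_mul _ _ _).symm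
      _ ≤ ∑ l ∈ J, 3 * c * u l := by
          gcongr with l
          · exact hu l
          · exact sum_mul_abs_nnCoef_le hx hc ha l
      _ = _ := (Finset.mul_sum _ _ _).symm
  have hasum : ∑ i, a i ≤ c * J.card := by
    rw [← Finset.sum_subset (Finset.subset_univ J)]
    · exact (Finset.sum_le_card_nsmul _ _ c fun i _ => ha i).trans (by rw [nsmul_eq_mul, mul_comm])
    · intro i _ hi
      by_contra h
      exact hi (hJ i h).2.1
  -- D is the noise contrast; F collects the smoothing bias and the first-stage error.
  set D : Fin n → ℝ := fun i => ∑ l, g i l * e l with hD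
  set F : Fin n → ℝ := fun i => ∑ l, g i l * m l - ∑ l, g i l * d l with hF
  have hyDF : ∀ i, a i ≠ 0 → ∑ l, g i l * y l = D i + F i := by
    intro i hi
    simp only [hD, hF]
    rw [← Finset.sum_sub_distrib, ← Finset.sum_add_distrib]
    refine Finset.sum_congr rfl fun l _ => ?_
    by_cases hl : l ∈ J
    · rw [hy l hl]; ring
    · rw [hgJ i hi l hl]; ring
  have hDsq : ∀ i, a i ≠ 0 → D i ^ 2 ≤ 2 * ∑ l, |g i l| * e l ^ 2 := fun i hi =>
    (sq_sum_mul_le _ _ _).trans (mul_le_mul_of_nonneg_right (sum_abs_nnCoef_le (hJ i hi).1)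
      (Finset.sum_nonneg fun _ _ => by positivity))
  have hFsq : ∀ i, a i ≠ 0 → F i ^ 2 ≤ 8 * β ^ 2 + 4 * ∑ l, |g i l| * d l ^ 2 := by
    intro i hi
    have h1 : |∑ l, g i l * m l| ≤ 2 * β := by
      have : ∑ l, g i l * m l = ∑ l, g i l * (m l - m i) := by
        simp_rw [mul_sub]
        rw [Finset.sum_sub_distrib, ← Finset.sum_mul, sum_nnCoef hR (hJ i hi).1, zero_mul, sub_zero]
      rw [this]
      calc _ ≤ ∑ l, |g i l| * β := by
            refine (Finset.abs_sum_le_sum_abs _ _).trans (Finset.sum_le_sum fun l _ => ?_)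
            rw [abs_mul]
            by_cases hl : g i l = 0
            · simp [hl]
            · exact mul_le_mul_of_nonneg_left (hclose m hm i hi l hl) (abs_nonneg _)
        _ ≤ 2 * β := by
            rw [← Finset.sum_mul]
            exact mul_le_mul_of_nonneg_right (sum_abs_nnCoef_le (hJ i hi).1) hβ
    have h2 : (∑ l, g i l * d l) ^ 2 ≤ 2 * ∑ l, |g i l| * d l ^ 2 :=
      (sq_sum_mul_le _ _ _).trans (mul_le_mul_of_nonneg_right (sum_abs_nnCoef_le (hJ i hi).1)
        (Finset.sum_nonneg fun _ _ => by positivity))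
    have h3 : (∑ l, g i l * m l) ^ 2 ≤ (2 * β) ^ 2 := by
      rw [← sq_abs]; exact pow_le_pow_left₀ (abs_nonneg _) h1 2
    simp only [hF]
    nlinarith [sq_nonneg (∑ l, g i l * m l + ∑ l, g i l * d l)]
  have hrho0 : 0 ≤ (R : ℝ) / (R + 1) := by positivity
  have hrho1 : (R : ℝ) / (R + 1) ≤ 1 := by
    rw [div_le_one (by positivity)]; linarith
  have hdiag : ∑ j, quadCoef R x a j j * s j = ∑ i, a i * ∑ l, g i l ^ 2 * s l := by
    unfold quadCoef
    simp_rw [Finset.sum_mul, Finset.mul_sum]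
    rw [Finset.sum_comm]
    exact Finset.sum_congr rfl fun i _ => Finset.sum_congr rfl fun l _ => by rw [hg]; ring
  -- Three errors: the centred quadratic form in the noise, the perturbation by F, and the variation
  -- of s among neighbours. The last arises because R/(R+1) ∑ g² = 1 allows s i to be written as an
  -- average.
  have hmain : ∑ i, a i * nnVar R x y i - ∑ i, a i * s i
      = (R : ℝ) / (R + 1) * (∑ j, ∑ l, quadCoef R x a j l * (e j * e l)
          - ∑ j, quadCoef R x a j j * s j)
        + (R : ℝ) / (R + 1) * ∑ i, a i * ((D i + F i) ^ 2 - D i ^ 2)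
        + ∑ i, a i * ((R : ℝ) / (R + 1) * ∑ l, g i l ^ 2 * (s l - s i)) := by
    rw [hdiag, ← sum_mul_sq_eq_quadCoef, ← Finset.sum_sub_distrib, ← Finset.sum_sub_distrib,
      Finset.mul_sum, Finset.mul_sum, ← Finset.sum_add_distrib, ← Finset.sum_add_distrib]
    refine Finset.sum_congr rfl fun i _ => ?_
    by_cases hi : a i = 0
    · simp [hi]
    have h1 : (R : ℝ) / (R + 1) * ∑ l, g i l ^ 2 * (s l - s i)
        = (R : ℝ) / (R + 1) * ∑ l, g i l ^ 2 * s l - s i := by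
      simp_rw [mul_sub]
      rw [Finset.sum_sub_distrib, ← Finset.sum_mul, mul_sub, ← mul_assoc,
        sum_nnCoef_sq hR (hJ i hi).1, one_mul]
    rw [h1, nnVar_eq, hyDF i hi]
    ring
  rw [hmain]
  refine (abs_add_three _ _ _).trans ?_
  refine add_le_add (add_le_add ?_ ?_) ?_
  · rw [abs_mul, abs_of_nonneg hrho0]
    exact mul_le_of_le_one_left (abs_nonneg _) hrho1
  · rw [abs_mul, abs_of_nonneg hrho0]
    refine (mul_le_of_le_one_left (abs_nonneg _) hrho1).trans ?_
    calc |∑ i, a i * ((D i + F i) ^ 2 - D i ^ 2)|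
        ≤ ∑ i, a i * (τ * D i ^ 2 + (1 + 1 / τ) * F i ^ 2) := by
          refine (Finset.abs_sum_le_sum_abs _ _).trans (Finset.sum_le_sum fun i _ => ?_)
          rw [abs_mul, abs_of_nonneg (ha0 i)]
          exact mul_le_mul_of_nonneg_left (abs_add_sq_sub_sq_le hτ _ _) (ha0 i)
      _ ≤ ∑ i, a i * (τ * (2 * ∑ l, |g i l| * e l ^ 2)
            + (1 + 1 / τ) * (8 * β ^ 2 + 4 * ∑ l, |g i l| * d l ^ 2)) := by
          refine Finset.sum_le_sum fun i _ => ?_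
          by_cases hi : a i = 0
          · simp [hi]
          · have := hDsq i hi
            have := hFsq i hi
            refine mul_le_mul_of_nonneg_left ?_ (ha0 i)
            gcongr
      _ = τ * (2 * ∑ i, a i * ∑ l, |g i l| * e l ^ 2)
            + (1 + 1 / τ) * (8 * β ^ 2 * ∑ i, a i + 4 * ∑ i, a i * ∑ l, |g i l| * d l ^ 2) := by
          simp only [Finset.mul_sum (s := (Finset.univ : Finset (Fin n)))
            (f := fun i => a i * ∑ l, |g i l| * e l ^ 2),
            Finset.mul_sum (s := (Finset.univ : Finset (Fin n)))
            (f := fun i => a i * ∑ l, |g i l| * d l ^ 2), Finset.mul_sum (f := a)]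
          rw [← Finset.sum_add_distrib, Finset.mul_sum, Finset.mul_sum, ← Finset.sum_add_distrib]
          exact Finset.sum_congr rfl fun i _ => by ring
      _ ≤ τ * (2 * (3 * c * ∑ l ∈ J, e l ^ 2))
            + (1 + 1 / τ) * (8 * β ^ 2 * (c * J.card) + 4 * (3 * c * ∑ l ∈ J, d l ^ 2)) := by
          gcongr
          · exact hsumJ _ fun _ => sq_nonneg _
          · exact hsumJ _ fun _ => sq_nonneg _
      _ = _ := by ring
  · calc |∑ i, a i * ((R : ℝ) / (R + 1) * ∑ l, g i l ^ 2 * (s l - s i))| ≤ ∑ i, a i * β := by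
          refine (Finset.abs_sum_le_sum_abs _ _).trans (Finset.sum_le_sum fun i _ => ?_)
          rw [abs_mul, abs_of_nonneg (ha0 i)]
          by_cases hi : a i = 0
          · simp [hi]
          refine mul_le_mul_of_nonneg_left ?_ (ha0 i)
          rw [abs_mul, abs_of_nonneg hrho0]
          calc _ ≤ (R : ℝ) / (R + 1) * ∑ l, g i l ^ 2 * β := by
                refine mul_le_mul_of_nonneg_left ?_ hrho0
                refine (Finset.abs_sum_le_sum_abs _ _).trans (Finset.sum_le_sum fun l _ => ?_)
                rw [abs_mul, abs_of_nonneg (sq_nonneg _)]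
                by_cases hl : g i l = 0
                · simp [hl]
                · exact mul_le_mul_of_nonneg_left (hclose s hs i hi l hl) (sq_nonneg _)
            _ = β := by
                rw [← Finset.sum_mul, ← mul_assoc, sum_nnCoef_sq hR (hJ i hi).1, one_mul]
      _ ≤ β * (c * J.card) := by
          rw [← Finset.sum_mul, mul_comm]
          gcongr

end FlexRD

/-! ### Samples with small weights, no ties and crowded shells -/

namespace FlexRD

lemma IsKernelFn.measurable {K : ℝ → ℝ} (hK : IsKernelFn K) : Measurable K := by
  classical
  have h := ContinuousOn.measurable_piecewise (g := fun _ => (0 : ℝ)) hK.continuousOn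
    continuousOn_const (isClosed_tsupport K).measurableSet
  convert h using 1
  ext t
  by_cases ht : t ∈ tsupport K
  · simp [Set.piecewise, ht]
  · simp [Set.piecewise, ht, image_eq_zero_of_notMem_tsupport ht]

/-- By symmetry each half of K has mass 1/2, which is the positivity needed for the one-sided moment
forms. -/
lemma IsKernelFn.exists_isSideKernel {K : ℝ → ℝ} (hK : IsKernelFn K) :
    ∃ b, IsSideKernel (fun t => if 0 ≤ t then K t else 0) b ∧
      IsSideKernel (fun t => if t < 0 then K t else 0) b := by
  obtain ⟨b, hb⟩ := hK.bounded
  have hb0 : 0 ≤ b := (hK.nonneg 0).trans (hb 0)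
  have e1 : (fun t => if 0 ≤ t then K t else 0) = (Set.Ici (0 : ℝ)).indicator K := by
    ext t; simp [Set.indicator_apply]
  have e2 : (fun t => if t < 0 then K t else 0) = (Set.Iio (0 : ℝ)).indicator K := by
    ext t; simp [Set.indicator_apply]
  have i1 : ∫ t, (if 0 ≤ t then K t else 0) = ∫ t in Set.Ici (0 : ℝ), K t := by
    rw [e1, integral_indicator measurableSet_Ici]
  have i2 : ∫ t, (if t < 0 then K t else 0) = ∫ t in Set.Iio (0 : ℝ), K t := by
    rw [e2, integral_indicator measurableSet_Iio]
  have hsym : ∫ t in Set.Iio (0 : ℝ), K t = ∫ t in Set.Ici (0 : ℝ), K t := by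
    rw [integral_Ici_eq_integral_Ioi, ← integral_Iic_eq_integral_Iio,
      ← neg_zero, ← integral_comp_neg_Iic, neg_zero]
    simp_rw [hK.symm]
  have hadd : (∫ t in Set.Iio (0 : ℝ), K t) + (∫ t in Set.Ici (0 : ℝ), K t) = 1 := by
    have := integral_add_compl (measurableSet_Iio (a := (0 : ℝ))) hK.integrable
    rwa [Set.compl_Iio, hK.integral_eq_one] at this
  refine ⟨b, ⟨?_, ?_, ?_, ?_, ?_⟩, ⟨?_, ?_, ?_, ?_, ?_⟩⟩
  · exact Measurable.ite measurableSet_Ici hK.measurable measurable_const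
  · intro t; split_ifs; exacts [hK.nonneg t, le_rfl]
  · intro t; split_ifs; exacts [hb t, hb0]
  · intro t ht; rw [hK.zero_outside t ht, ite_self]
  · rw [i1]; linarith
  · exact Measurable.ite measurableSet_Iio hK.measurable measurable_const
  · intro t; split_ifs; exacts [hK.nonneg t, le_rfl]
  · intro t; split_ifs; exacts [hb t, hb0]
  · intro t ht; rw [hK.zero_outside t ht, ite_self]
  · rw [i2]; linarith

lemma scaledPos_eq (K : ℝ → ℝ) {h : ℝ} (hh : 0 < h) :
    scaledPos K h = scaled (fun t => if 0 ≤ t then K t else 0) h := by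
  ext x
  simp only [scaledPos, scaled]
  by_cases hx : 0 ≤ x
  · rw [if_pos hx, if_pos (div_nonneg hx hh.le)]
  · rw [if_neg hx, if_neg (not_le.2 (div_neg_of_neg_of_pos (not_le.1 hx) hh)), zero_div]

lemma scaledNeg_eq (K : ℝ → ℝ) {h : ℝ} (hh : 0 < h) :
    scaledNeg K h = scaled (fun t => if t < 0 then K t else 0) h := by
  ext x
  simp only [scaledNeg, scaled]
  by_cases hx : x < 0
  · rw [if_pos hx, if_pos (div_neg_of_neg_of_pos hx hh)]
  · rw [if_neg hx, if_neg (not_lt.2 (div_nonneg (not_lt.1 hx) hh.le)), zero_div]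

/-- One-sided weights are `O(1 / (n h ^ (1 + v)))` outside an event of probability `O(1 / (n h))`. -/
lemma IsSideKernel.exists_sideWeight_bound {k : ℝ → ℝ} {b : ℝ} (hk : IsSideKernel k b)
    {μ : Measure ℝ} [IsProbabilityMeasure μ] {r c C : ℝ} (hμ : DensityBounds μ r c C) (p : ℕ) :
    ∃ A D : ℝ, 0 ≤ A ∧ ∀ n : ℕ, 0 < n → ∀ h : ℝ, 0 < h → h ≤ r →
      Measure.pi (fun _ : Fin n => μ) {x | ¬ ∀ (v : Fin (p + 1)) (i : Fin n),
        |sideWeight (scaled k h) p v x i| ≤ A / (n * h * h ^ (v : ℕ))}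
        ≤ (2 * p + 1 : ℕ) * ENNReal.ofReal (D / (n * h)) := by
  obtain ⟨-, l, hl, hlow⟩ := exists_pos_le_integral_polyVec p hk.measurable hk.nonneg hk.bounded
    hk.zero_outside hk.integral_pos
  have hc := hμ.lower_pos
  have hb := hk.bound_nonneg
  -- Chosen so that the sampling error (p+1)² t uses up exactly half of the lower bound c l.
  set t : ℝ := c * l / (2 * (p + 1) ^ 2) with ht
  have htpos : 0 < t := by positivity
  have hm0 : c * l - (p + 1) ^ 2 * t = c * l / 2 := by rw [ht]; field_simp; ring
  refine ⟨b * (p + 1) / (c * l / 2), 2 * C * b ^ 2 / t ^ 2, by positivity, fun n hn h hh hr => ?_⟩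
  have hn' : (0 : ℝ) < n := Nat.cast_pos.2 hn
  refine (measure_mono fun x hx => ?_).trans (hk.measure_gram_bad_le hμ hh hr p hn htpos)
  intro hgood
  apply hx
  intro v i
  have hlow' := hk.gram_lower hμ hh hr hlow hgood
  rw [hm0] at hlow'
  refine (abs_sideWeight_le (M := b / h) hh (by positivity) (by positivity)
    (hk.abs_scaled_le hh) (fun t ht => hk.scaled_eq_zero hh ht) hlow' v i).trans (le_of_eq ?_)
  field_simp

/-- The weights are of order `1 / (n h ^ (1 + v))` with high probability. -/
lemma IsKernelFn.exists_weight_bound {K : ℝ → ℝ} (hK : IsKernelFn K) {μ : Measure ℝ}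
    [IsProbabilityMeasure μ] {r c C : ℝ} (hμ : DensityBounds μ r c C) (p : ℕ) {h : ℕ → ℝ}
    (hh : IsBandwidth h) :
    ∃ c₀ : ℝ, 0 ≤ c₀ ∧ Tendsto (fun n => Measure.pi (fun _ : Fin n => μ)
      {x | ¬ ∀ (v : Fin (p + 1)) (i : Fin n),
        n * h n ^ (1 + 2 * (v : ℕ)) * weight K (h n) p v x i ^ 2 ≤ c₀ / (n * h n)})
      atTop (𝓝 0) := by
  obtain ⟨b, hk1, hk2⟩ := hK.exists_isSideKernel
  obtain ⟨A₁, D₁, hA₁, hD₁⟩ := hk1.exists_sideWeight_bound hμ p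
  obtain ⟨A₂, D₂, hA₂, hD₂⟩ := hk2.exists_sideWeight_bound hμ p
  obtain ⟨hpos, hto0, htoinf⟩ := hh
  refine ⟨(A₁ + A₂) ^ 2, sq_nonneg _, ?_⟩
  have hlim : ∀ D : ℝ, Tendsto (fun n : ℕ => ((2 * p + 1 : ℕ) : ℝ≥0∞)
      * ENNReal.ofReal (D / (n * h n))) atTop (𝓝 0) := by
    intro D
    have h1 : Tendsto (fun n : ℕ => D / (n * h n)) atTop (𝓝 0) := htoinf.const_div_atTop D
    have h2 := ENNReal.tendsto_ofReal h1
    rw [ENNReal.ofReal_zero] at h2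
    simpa using ENNReal.Tendsto.const_mul h2 (Or.inr (ENNReal.natCast_ne_top (2 * p + 1)))
  have hlim2 := (hlim D₁).add (hlim D₂)
  rw [add_zero] at hlim2
  refine tendsto_of_tendsto_of_tendsto_of_le_of_le' tendsto_const_nhds hlim2
    (Eventually.of_forall fun _ => zero_le) ?_
  filter_upwards [eventually_gt_atTop 0, hto0.eventually_le_const hμ.pos] with n hn hr
  have hn' : (0 : ℝ) < n := Nat.cast_pos.2 hn
  have hhn := hpos n
  refine (measure_mono fun x hx => ?_).trans ((measure_union_le _ _).trans
    (add_le_add (hD₁ n hn (h n) hhn hr) (hD₂ n hn (h n) hhn hr)))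
  by_contra hcon
  simp only [Set.mem_union, Set.mem_ofPred_eq, not_or, not_not] at hcon
  apply hx
  intro v i
  have h1 := hcon.1 v i
  have h2 := hcon.2 v i
  rw [← scaledPos_eq K hhn] at h1
  rw [← scaledNeg_eq K hhn] at h2
  have h3 : |weight K (h n) p v x i| ≤ (A₁ + A₂) / (n * h n * h n ^ (v : ℕ)) := by
    rw [add_div]
    exact (abs_sub _ _).trans (add_le_add h1 h2)
  have h4 : weight K (h n) p v x i ^ 2 ≤ ((A₁ + A₂) / (n * h n * h n ^ (v : ℕ))) ^ 2 := by
    rw [← sq_abs]; exact pow_le_pow_left₀ (abs_nonneg _) h3 2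
  calc _ ≤ n * h n ^ (1 + 2 * (v : ℕ)) * ((A₁ + A₂) / (n * h n * h n ^ (v : ℕ))) ^ 2 := by gcongr
    _ = _ := by
      have e1 : h n ^ (1 + 2 * (v : ℕ)) = h n * (h n ^ (v : ℕ)) ^ 2 := by ring
      rw [e1]
      have : h n ^ (v : ℕ) ≠ 0 := (pow_pos hhn _).ne'
      field_simp

/-- After resampling coordinate j, a tie with coordinate i means that the fresh copy hits a single
point, which is a null set. -/
lemma ae_injective_pi (μ : Measure ℝ) [IsProbabilityMeasure μ] [NullSingletonClass μ] (n : ℕ) :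
    ∀ᵐ x ∂(Measure.pi fun _ : Fin n => μ), Function.Injective x := by
  have h1 : ∀ i j : Fin n, i ≠ j → ∀ᵐ x ∂(Measure.pi fun _ : Fin n => μ), x i ≠ x j := by
    intro i j hij
    have hmp := measurePreserving_update_pair μ j (n := n)
    rw [← hmp.map_eq, ae_map_iff hmp.aemeasurable]
    · have hs : MeasurableSet {q : (Fin n → ℝ) × ℝ | q.1 i = q.2} :=
        measurableSet_eq_fun ((measurable_pi_apply i).comp measurable_fst) measurable_snd
      have h0 : ((Measure.pi fun _ : Fin n => μ).prod μ) {q | q.1 i = q.2} = 0 := by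
        rw [Measure.measure_prod_null hs]
        refine ae_of_all _ fun w => ?_
        have : Prod.mk w ⁻¹' {q : (Fin n → ℝ) × ℝ | q.1 i = q.2} = {w i} := by
          ext o; simp [eq_comm]
        change μ (Prod.mk w ⁻¹' _) = 0
        rw [this]; simp
      rw [ae_iff]
      convert h0 using 2
      ext q; simp [Function.update_of_ne hij]
    · exact (measurableSet_eq_fun (measurable_pi_apply i) (measurable_pi_apply j)).compl
  have h2 : ∀ᵐ x ∂(Measure.pi fun _ : Fin n => μ), ∀ i j : Fin n, i ≠ j → x i ≠ x j := by
    rw [ae_all_iff]; intro i; rw [ae_all_iff]; intro j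
    by_cases hij : i = j
    · simp [hij]
    · filter_upwards [h1 i j hij] with x hx _ using hx
  filter_upwards [h2] with x hx i j hij
  by_contra hne
  exact hx i j hne hij

/-- The Lipschitz conditions concern the open half-lines, so an observation exactly at the cutoff
has to be excluded. -/
lemma ae_forall_ne_zero_pi (μ : Measure ℝ) [IsProbabilityMeasure μ] [NullSingletonClass μ]
    (n : ℕ) : ∀ᵐ x ∂(Measure.pi fun _ : Fin n => μ), ∀ i, x i ≠ 0 := by
  rw [ae_all_iff]
  intro i
  have h : ∀ᵐ t ∂μ, t ≠ 0 := by rw [ae_iff]; simp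
  exact (measurePreserving_eval (fun _ : Fin n => μ) i).quasiMeasurePreserving.ae h

open Classical in
-- Each shell has length ρ - h, hence mass at least c(ρ - h), so its expected count tends to
-- infinity and exceeds 2R.
lemma tendsto_not_crowded (R : ℕ) {μ : Measure ℝ} [IsProbabilityMeasure μ] {r c C : ℝ}
    (hμ : DensityBounds μ r c C) {h ρ : ℕ → ℝ} (hh : ∀ n, 0 < h n)
    (hρ : ∀ᶠ n in atTop, ρ n ≤ r)
    (hgap : Tendsto (fun n : ℕ => n * (ρ n - h n)) atTop atTop) :
    Tendsto (fun n => Measure.pi (fun _ : Fin n => μ) {x | ¬ Crowded R (h n) (ρ n) x})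
      atTop (𝓝 0) := by
  have hlim : Tendsto (fun n : ℕ => ENNReal.ofReal (4 / (n * (c * (ρ n - h n))))) atTop (𝓝 0) := by
    rw [← ENNReal.ofReal_zero]
    apply ENNReal.tendsto_ofReal
    apply Tendsto.const_div_atTop
    refine (hgap.const_mul_atTop hμ.lower_pos).congr fun n => by ring
  have hlim2 := hlim.add hlim
  rw [add_zero] at hlim2
  refine tendsto_of_tendsto_of_tendsto_of_le_of_le' tendsto_const_nhds hlim2
    (Eventually.of_forall fun _ => zero_le) ?_
  filter_upwards [hρ, hgap.eventually_gt_atTop 0,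
    (hgap.const_mul_atTop hμ.lower_pos).eventually_gt_atTop (2 * (R : ℝ)),
    eventually_gt_atTop 0] with n hr hpos h2R hn
  have hn' : (0 : ℝ) < n := Nat.cast_pos.2 hn
  have hlt : 0 < ρ n - h n := pos_of_mul_pos_right hpos hn'.le
  have hhn := hh n
  have hc := hμ.lower_pos
  have hvol : ∀ s : Set ℝ, s ⊆ Set.Icc (-r) r → volume s = ENNReal.ofReal (ρ n - h n) →
      c * (ρ n - h n) ≤ μ.real s := by
    intro s hs hv
    have := hμ.le_measure hs
    rw [hv, ← ENNReal.ofReal_mul hc.le] at this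
    rw [Measure.real, ← ENNReal.ofReal_le_iff_le_toReal (measure_ne_top _ _)]
    exact this
  have key : ∀ s : Set ℝ, MeasurableSet s → s ⊆ Set.Icc (-r) r →
      volume s = ENNReal.ofReal (ρ n - h n) →
      Measure.pi (fun _ : Fin n => μ) {x | ¬ R ≤ (Finset.univ.filter fun i => x i ∈ s).card}
        ≤ ENNReal.ofReal (4 / (n * (c * (ρ n - h n)))) := by
    intro s hs hsub hv
    have h1 := hvol s hsub hv
    have h2 : n * (c * (ρ n - h n)) ≤ n * μ.real s := by gcongr
    refine (measure_card_lt_le μ n R hs (lt_of_lt_of_le ?_ h2)).trans ?_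
    · linarith
    · gcongr
  refine (measure_mono fun x hx => ?_).trans ((measure_union_le _ _).trans (add_le_add
    (key (Set.Ioc (h n) (ρ n)) measurableSet_Ioc (fun y hy => ⟨?_, ?_⟩) ?_)
    (key (Set.Ico (-ρ n) (-h n)) measurableSet_Ico (fun y hy => ⟨?_, ?_⟩) ?_)))
  · by_contra hcon
    simp only [Set.mem_union, Set.mem_ofPred_eq, not_or, not_not] at hcon
    refine hx ⟨?_, ?_⟩
    · convert hcon.1
    · convert hcon.2
  · linarith [hy.1]
  · linarith [hy.2]
  · rw [Real.volume_Ioc]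
  · linarith [hy.1]
  · linarith [hy.2]
  · rw [Real.volume_Ico]; congr 1; ring

/-! ### Measurability of weights, neighbour sets and contrast coefficients -/

section Measurability

variable {n : ℕ}

lemma measurable_gram_apply {k : ℝ → ℝ} (hk : Measurable k) (p : ℕ) (a c : Fin (p + 1)) :
    Measurable fun x : Fin n → ℝ => gram k p x a c := by
  unfold gram
  simp only [Matrix.sum_apply, Matrix.smul_apply, Matrix.vecMulVec_apply, polyVec, smul_eq_mul]
  fun_prop

/-- The matrix inverse is the inverse of the determinant times the adjugate, also in the singular
case with 0⁻¹ = 0, and both are continuous in the entries. -/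
lemma measurable_sideWeight {k : ℝ → ℝ} (hk : Measurable k) (p : ℕ) (v : Fin (p + 1))
    (i : Fin n) : Measurable fun x : Fin n → ℝ => sideWeight k p v x i := by
  have hg : Measurable fun (x : Fin n → ℝ) (a c : Fin (p + 1)) => gram k p x a c :=
    measurable_pi_iff.2 fun a => measurable_pi_iff.2 fun c => measurable_gram_apply hk p a c
  have hdet : Measurable fun x : Fin n → ℝ => (gram k p x).det :=
    have h1 : Continuous fun m : Fin (p + 1) → Fin (p + 1) → ℝ => (Matrix.of m).det :=
      Continuous.matrix_det continuous_id
    h1.measurable.comp hg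
  have hadj : ∀ a c, Measurable fun x : Fin n → ℝ => (gram k p x).adjugate a c := by
    intro a c
    have h1 : Continuous fun m : Fin (p + 1) → Fin (p + 1) → ℝ => (Matrix.of m).adjugate :=
      Continuous.matrix_adjugate continuous_id
    have h2 : Continuous fun m : Fin (p + 1) → Fin (p + 1) → ℝ => (Matrix.of m).adjugate a c :=
      h1.matrix_elem a c
    exact h2.measurable.comp hg
  unfold sideWeight
  simp only [Matrix.mulVec, dotProduct, Matrix.inv_def, Matrix.smul_apply, Pi.smul_apply,
    smul_eq_mul, polyVec, Ring.inverse_eq_inv]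
  refine Finset.measurable_sum _ fun a _ => ?_
  exact (hdet.inv.mul (hadj v a)).mul
    ((hk.comp (measurable_pi_apply i)).mul ((measurable_pi_apply i).pow_const _))

lemma IsKernelFn.measurable_weight {K : ℝ → ℝ} (hK : IsKernelFn K) (h : ℝ) (p : ℕ)
    (v : Fin (p + 1)) (i : Fin n) : Measurable fun x : Fin n → ℝ => weight K h p v x i := by
  have hs : Measurable (scaled K h) :=
    (hK.measurable.comp (measurable_id.div_const h)).div_const h
  exact (measurable_sideWeight (Measurable.ite measurableSet_Ici hs measurable_const) p v i).sub
    (measurable_sideWeight (Measurable.ite measurableSet_Iio hs measurable_const) p v i)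

lemma measurableSet_rival (i k : Fin n) : MeasurableSet {x : Fin n → ℝ | Rival x i k} := by
  have h1 : ∀ j : Fin n, MeasurableSet {x : Fin n → ℝ | 0 ≤ x j} := fun j =>
    measurableSet_le measurable_const (measurable_pi_apply j)
  by_cases hk : k = i
  · simp [Rival, hk]
  · have : {x : Fin n → ℝ | Rival x i k}
        = ({x | 0 ≤ x k} ∩ {x | 0 ≤ x i}) ∪ ({x | 0 ≤ x k}ᶜ ∩ {x | 0 ≤ x i}ᶜ) := by
      ext x
      simp only [Rival, Set.mem_ofPred_eq, Set.mem_union, Set.mem_inter_iff, Set.mem_compl_iff]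
      tauto
    rw [this]
    exact ((h1 k).inter (h1 i)).union ((h1 k).compl.inter (h1 i).compl)

lemma measurableSet_closer (i k j : Fin n) : MeasurableSet {x : Fin n → ℝ | Closer x i k j} := by
  have h1 : ∀ j : Fin n, Measurable fun x : Fin n → ℝ => |x j - x i| := fun j => by fun_prop
  unfold Closer
  by_cases hk : k < j
  · simp only [hk, and_true]
    exact (measurableSet_lt (h1 k) (h1 j)).union (measurableSet_eq_fun (h1 k) (h1 j))
  · simp only [hk, and_false, or_false]
    exact measurableSet_lt (h1 k) (h1 j)

open Classical in
lemma measurable_card_filter {ι Ω : Type*} [Fintype ι] [MeasurableSpace Ω] {s : ι → Ω → Prop}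
    (hs : ∀ i, MeasurableSet {x | s i x}) :
    Measurable fun x => (Finset.univ.filter fun i => s i x).card := by
  simp only [Finset.card_filter]
  exact Finset.measurable_sum _ fun i _ => Measurable.ite (hs i) measurable_const measurable_const

lemma measurableSet_mem_neighbors (R : ℕ) (i j : Fin n) :
    MeasurableSet {x : Fin n → ℝ | j ∈ neighbors R x i} := by
  classical
  have h1 := measurable_card_filter (s := fun (k : Fin n) (x : Fin n → ℝ) =>
    Rival x i k ∧ Closer x i k j)
    fun k => (measurableSet_rival i k).inter (measurableSet_closer i k j)
  have : {x : Fin n → ℝ | j ∈ neighbors R x i} = {x | Rival x i j} ∩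
      {x | (Finset.univ.filter fun k => Rival x i k ∧ Closer x i k j).card < R} := by
    ext x; simp [neighbors]
  rw [this]
  refine (measurableSet_rival i j).inter ?_
  convert h1 (measurableSet_Iio (a := R))
  ext x
  simp only [Set.mem_ofPred_eq, Set.mem_preimage, Set.mem_Iio]
  exact ⟨fun h => lt_of_eq_of_lt (by congr) h, fun h => lt_of_eq_of_lt (by congr) h⟩

lemma measurableSet_crowded (R : ℕ) (h ρ : ℝ) :
    MeasurableSet {x : Fin n → ℝ | Crowded R h ρ x} := by
  classical
  have h1 : ∀ s : Set ℝ, MeasurableSet s → MeasurableSet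
      {x : Fin n → ℝ | R ≤ (Finset.univ.filter fun k => x k ∈ s).card} := by
    intro s hs
    have := measurable_card_filter (s := fun (k : Fin n) (x : Fin n → ℝ) => x k ∈ s)
      fun k => measurable_pi_apply k hs
    convert this (measurableSet_Ici (a := R))
    ext x
    simp only [Set.mem_ofPred_eq, Set.mem_preimage, Set.mem_Ici]
  have h2 := (h1 _ (measurableSet_Ioc (a := h) (b := ρ))).inter
    (h1 _ (measurableSet_Ico (a := -ρ) (b := -h)))
  unfold Crowded
  convert h2 using 1
  ext x
  simp only [Set.mem_inter_iff, Set.mem_ofPred_eq]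
  constructor <;> rintro ⟨ha, hb⟩ <;> exact ⟨by convert ha, by convert hb⟩

lemma measurable_nnCoef (R : ℕ) (i l : Fin n) :
    Measurable fun x : Fin n → ℝ => nnCoef R x i l :=
  measurable_const.sub
    (Measurable.ite (measurableSet_mem_neighbors R i l) measurable_const measurable_const)

lemma measurable_quadCoef (R : ℕ) {a : (Fin n → ℝ) → Fin n → ℝ}
    (ha : ∀ i, Measurable fun x => a x i) (j l : Fin n) :
    Measurable fun x : Fin n → ℝ => quadCoef R x (a x) j l :=
  Finset.measurable_sum _ fun i _ =>
    (ha i).mul ((measurable_nnCoef R i j).mul (measurable_nnCoef R i l))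

end Measurability

/-- Samples of the running variable without ties, with weights of the usual order and with enough
observations next to the window. -/
def goodSample (K : ℝ → ℝ) (n R p : ℕ) (v : Fin (p + 1)) (h ρ c : ℝ) : Set (Fin n → ℝ) :=
  {x | (∀ i j, i ≠ j → x i ≠ x j) ∧ (∀ i, x i ≠ 0) ∧
    (∀ i, n * h ^ (1 + 2 * (v : ℕ)) * weight K h p v x i ^ 2 ≤ c) ∧ Crowded R h ρ x}

lemma IsKernelFn.measurableSet_goodSample {K : ℝ → ℝ} (hK : IsKernelFn K) (n R p : ℕ)
    (v : Fin (p + 1)) (h ρ c : ℝ) : MeasurableSet (goodSample K n R p v h ρ c) := by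
  have h1 : MeasurableSet {x : Fin n → ℝ | ∀ i j, i ≠ j → x i ≠ x j} := by
    simp only [Set.ofPred_forall]
    exact MeasurableSet.iInter fun i => MeasurableSet.iInter fun j => MeasurableSet.iInter fun _ =>
      (measurableSet_eq_fun (measurable_pi_apply i) (measurable_pi_apply j)).compl
  have h2 : MeasurableSet {x : Fin n → ℝ | ∀ i, x i ≠ 0} := by
    simp only [Set.ofPred_forall]
    exact MeasurableSet.iInter fun i =>
      (measurableSet_eq_fun (measurable_pi_apply i) measurable_const).compl
  have h3 : MeasurableSet {x : Fin n → ℝ |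
      ∀ i, n * h ^ (1 + 2 * (v : ℕ)) * weight K h p v x i ^ 2 ≤ c} := by
    simp only [Set.ofPred_forall]
    exact MeasurableSet.iInter fun i => measurableSet_le
      (((hK.measurable_weight h p v i).pow_const 2).const_mul _) measurable_const
  exact h1.inter (h2.inter (h3.inter (measurableSet_crowded R h ρ)))

/-- Good samples have probability tending to one. -/
lemma IsKernelFn.exists_tendsto_goodSample {K : ℝ → ℝ} (hK : IsKernelFn K) {μ : Measure ℝ}
    [IsProbabilityMeasure μ] [NullSingletonClass μ] {r c C : ℝ} (hμ : DensityBounds μ r c C)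
    (p R : ℕ) {h ρ : ℕ → ℝ} (hh : IsBandwidth h) (hρ : ∀ᶠ n in atTop, ρ n ≤ r)
    (hgap : Tendsto (fun n : ℕ => n * (ρ n - h n)) atTop atTop) :
    ∃ c₀ : ℝ, 0 ≤ c₀ ∧ ∀ v : Fin (p + 1), Tendsto (fun n => Measure.pi (fun _ : Fin n => μ)
      (goodSample K n R p v (h n) (ρ n) (c₀ / (n * h n)))ᶜ) atTop (𝓝 0) := by
  obtain ⟨c₀, hc₀, hw⟩ := hK.exists_weight_bound hμ p hh
  refine ⟨c₀, hc₀, fun v => ?_⟩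
  have hlim := hw.add (tendsto_not_crowded R hμ hh.1 hρ hgap)
  rw [add_zero] at hlim
  refine tendsto_of_tendsto_of_tendsto_of_le_of_le tendsto_const_nhds hlim
    (fun _ => zero_le) fun n => ?_
  refine le_trans (measure_mono_ae ?_) (measure_union_le _ _)
  filter_upwards [ae_injective_pi μ n, ae_forall_ne_zero_pi μ n] with x hx1 hx2 hx
  by_contra hcon
  have hcon' : ¬ (_ ∨ _) := hcon
  rw [not_or] at hcon'
  obtain ⟨h1, h2⟩ := hcon'
  exact hx ⟨fun i j hij => hx1.ne hij, hx2, fun i => (not_not.1 h1) v i, not_not.1 h2⟩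

end FlexRD

/-! ### Markov bounds and the cross-fitted first-stage error -/

namespace FlexRD

universe u

lemma measure_ge_le_of_integral_le {Ω : Type*} [MeasurableSpace Ω] {P : Measure Ω}
    [IsFiniteMeasure P] {f : Ω → ℝ} (hf : Integrable f P) (hf0 : ∀ ω, 0 ≤ f ω) {k ε : ℝ}
    (hk : ∫ ω, f ω ∂P ≤ k) (hε : 0 < ε) : P {ω | ε ≤ f ω} ≤ ENNReal.ofReal (k / ε) := by
  have h := mul_meas_ge_le_integral_of_nonneg (ae_of_all _ hf0) hf ε
  rw [← ENNReal.ofReal_toReal (measure_ne_top P {ω | ε ≤ f ω})]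
  apply ENNReal.ofReal_le_ofReal
  rw [le_div_iff₀ hε, mul_comm]
  exact h.trans hk

/-- Markov's inequality for a weighted sum of nonnegative variables. -/
lemma measure_ge_mul_sum_le {Ω : Type*} [MeasurableSpace Ω] {P : Measure Ω} {n : ℕ}
    {Y : Fin n → Ω → ℝ} (hY : ∀ j, Measurable (Y j)) (hY0 : ∀ j ω, 0 ≤ Y j ω) {k a ε : ℝ}
    (hk : ∀ j, ∫⁻ ω, ENNReal.ofReal (Y j ω) ∂P ≤ ENNReal.ofReal k) (ha : 0 ≤ a) (hε : 0 < ε) :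
    P {ω | ε ≤ a * ∑ j, Y j ω} ≤ ENNReal.ofReal (a * (n * k) / ε) := by
  have hm : Measurable fun ω => ENNReal.ofReal (a * ∑ j, Y j ω) :=
    ((Finset.measurable_sum _ fun j _ => hY j).const_mul a).ennreal_ofReal
  have hsub : {ω | ε ≤ a * ∑ j, Y j ω} ⊆
      {ω | ENNReal.ofReal ε ≤ ENNReal.ofReal (a * ∑ j, Y j ω)} :=
    fun ω hω => ENNReal.ofReal_le_ofReal hω
  refine (measure_mono hsub).trans ((meas_ge_le_lintegral_div hm.aemeasurable
    (ENNReal.ofReal_pos.2 hε).ne' ENNReal.ofReal_ne_top).trans ?_)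
  rw [ENNReal.ofReal_div_of_pos hε]
  refine ENNReal.div_le_div_right ?_ _
  simp_rw [ENNReal.ofReal_mul ha, ENNReal.ofReal_sum_of_nonneg fun j _ => hY0 j _]
  rw [lintegral_const_mul _ (Finset.measurable_sum _ fun j _ => (hY j).ennreal_ofReal),
    lintegral_finsetSum _ fun j _ => (hY j).ennreal_ofReal]
  refine mul_le_mul_right ((Finset.sum_le_card_nsmul _ _ _ fun j _ => hk j).trans ?_) _
  rw [ENNReal.ofReal_mul (Nat.cast_nonneg n), ENNReal.ofReal_natCast]
  simp

section Moments

variable {E : Type*} [MeasurableSpace E] {μ : Measure ℝ} [IsProbabilityMeasure μ]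
  {κ : Kernel ℝ E} [IsMarkovKernel κ]

/-- The mean of a nonnegative function that vanishes off `N` and has conditional means at most
`k` on `N`. -/
lemma lintegral_compProd_le {N : Set ℝ} (hN : MeasurableSet N) {f : ℝ × E → ℝ} (hf : Measurable f)
    {k m₀ : ℝ} (hk : 0 ≤ k) (hfN : ∀ x ∉ N, ∀ y, f (x, y) = 0)
    (hfk : ∀ x ∈ N, ∫⁻ y, ENNReal.ofReal (f (x, y)) ∂(κ x) ≤ ENNReal.ofReal k)
    (hμN : μ N ≤ ENNReal.ofReal m₀) :
    ∫⁻ o, ENNReal.ofReal (f o) ∂(μ ⊗ₘ κ) ≤ ENNReal.ofReal (k * m₀) := by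
  rw [Measure.lintegral_compProd hf.ennreal_ofReal]
  calc _ ≤ ∫⁻ x, N.indicator (fun _ => ENNReal.ofReal k) x ∂μ := by
        refine lintegral_mono fun x => ?_
        by_cases hx : x ∈ N
        · rw [Set.indicator_of_mem hx]; exact hfk x hx
        · rw [Set.indicator_of_notMem hx]; simp [hfN x hx]
    _ = ENNReal.ofReal k * μ N := by rw [lintegral_indicator hN, setLIntegral_const]
    _ ≤ _ := by rw [ENNReal.ofReal_mul hk]; gcongr

lemma integral_compProd_le {N : Set ℝ} (hN : MeasurableSet N) {f : ℝ × E → ℝ} (hf : Measurable f)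
    (hf0 : ∀ o, 0 ≤ f o) {k m₀ : ℝ} (hk : 0 ≤ k) (hm₀ : 0 ≤ m₀)
    (hfN : ∀ x ∉ N, ∀ y, f (x, y) = 0)
    (hfk : ∀ x ∈ N, ∫⁻ y, ENNReal.ofReal (f (x, y)) ∂(κ x) ≤ ENNReal.ofReal k)
    (hμN : μ N ≤ ENNReal.ofReal m₀) :
    Integrable f (μ ⊗ₘ κ) ∧ ∫ o, f o ∂(μ ⊗ₘ κ) ≤ k * m₀ := by
  have h := lintegral_compProd_le hN hf hk hfN hfk hμN
  refine ⟨⟨hf.aestronglyMeasurable, ?_⟩, ?_⟩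
  · rw [hasFiniteIntegral_iff_ofReal (ae_of_all _ hf0)]
    exact h.trans_lt ENNReal.ofReal_lt_top
  · rw [integral_eq_lintegral_of_nonneg_ae (ae_of_all _ hf0) hf.aestronglyMeasurable]
    exact ENNReal.toReal_le_of_le_ofReal (mul_nonneg hk hm₀) h

end Moments

namespace Design

variable {μ : Measure ℝ} {S : ℕ} (A : Design.{u} μ S) (n : ℕ)

/-- The sample of size `n` as a random vector. -/
def sample (ω : A.Ω n) : Fin n → Obs (A.dim n) := fun i => A.W n i ω

lemma measurable_sample : Measurable (A.sample n) :=
  measurable_pi_iff.2 (A.measurable_W n)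

lemma map_sample : (A.P n).map (A.sample n) = Measure.pi fun _ => μ ⊗ₘ A.κ n := by
  have h := (iIndepFun_iff_map_fun_eq_pi_map fun i => (A.measurable_W n i).aemeasurable).1
    (A.indep_W n)
  simp_rw [A.map_W n] at h
  exact h

lemma map_fold_sample [IsProbabilityMeasure μ] : (A.P n).map (fun ω => (A.fold n ω, A.sample n ω))
    = ((A.P n).map (A.fold n)).prod (Measure.pi fun _ => μ ⊗ₘ A.κ n) := by
  have h := (indepFun_iff_map_prod_eq_prod_map_map (A.measurable_fold n).aemeasurable
    (A.measurable_sample n).aemeasurable).1 (A.indep_fold n)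
  rw [h, A.map_sample n]

lemma map_X [IsProbabilityMeasure μ] : (A.P n).map (A.X n) = Measure.pi fun _ : Fin n => μ := by
  have h1 : MeasurePreserving (fun o : Obs (A.dim n) => o.1) (μ ⊗ₘ A.κ n) μ :=
    ⟨measurable_fst, Measure.fst_compProd μ (A.κ n)⟩
  have h2 := measurePreserving_pi (fun _ : Fin n => μ ⊗ₘ A.κ n) (fun _ => μ) fun _ => h1
  have h3 : A.X n = (fun (w : Fin n → Obs (A.dim n)) i => (w i).1) ∘ A.sample n := rfl
  rw [h3, ← Measure.map_map h2.measurable (A.measurable_sample n), A.map_sample n, h2.map_eq]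

lemma measurable_X : Measurable (A.X n) :=
  measurable_pi_iff.2 fun i => measurable_fst.comp (A.measurable_W n i)

/-- The estimation error for unit `j` at `z`, for a given split `φ` and sample `w`. -/
def splitError (ηbar : Cov (A.dim n) → ℝ) (j : Fin n) (φ : Fin n → Fin S)
    (w : Fin n → Obs (A.dim n)) (z : Cov (A.dim n)) : ℝ :=
  A.est n (Finset.univ.filter fun i => φ i = φ j)ᶜ (fun i => w i) z - ηbar z

/-- The squared estimation error at unit `j`, set to zero unless the running variable is in `N` and
the conditional mean squared error at its value is at most `k`. -/
noncomputable def truncError (ηbar : Cov (A.dim n) → ℝ) (N : Set ℝ) (k : ℝ) (j : Fin n)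
    (q : (Fin n → Fin S) × (Fin n → Obs (A.dim n))) : ℝ :=
  open Classical in
  if (q.2 j).1 ∈ N ∧ ∫⁻ y, ENNReal.ofReal (A.splitError n ηbar j q.1 q.2 y.2 ^ 2)
      ∂(A.κ n (q.2 j).1) ≤ ENNReal.ofReal k
  then A.splitError n ηbar j q.1 q.2 (q.2 j).2.2 ^ 2 else 0

variable {n}

lemma measurable_splitError {ηbar : Cov (A.dim n) → ℝ} (hη : Measurable ηbar) (j : Fin n)
    (φ : Fin n → Fin S) :
    Measurable fun q : (Fin n → Obs (A.dim n)) × Cov (A.dim n) =>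
      A.splitError n ηbar j φ q.1 q.2 := by
  unfold splitError
  refine Measurable.sub ?_ (hη.comp measurable_snd)
  have h := A.measurable_est n (Finset.univ.filter fun i => φ i = φ j)ᶜ
  have h2 : Measurable fun q : (Fin n → Obs (A.dim n)) × Cov (A.dim n) =>
      ((fun i : ((Finset.univ.filter fun i => φ i = φ j)ᶜ : Finset (Fin n)) => q.1 i), q.2) := by
    fun_prop
  exact h.comp h2

lemma measurable_truncError {ηbar : Cov (A.dim n) → ℝ} (hη : Measurable ηbar) {N : Set ℝ}
    (hN : MeasurableSet N) (k : ℝ) (j : Fin n) : Measurable (A.truncError n ηbar N k j) := by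
  -- There are finitely many splits, so φ may be fixed; the index set on which the estimate is
  -- computed is then no longer random.
  refine measurable_from_prod_countable_right fun φ => ?_
  have hs := A.measurable_splitError hη j φ
  have hx : Measurable fun w : Fin n → Obs (A.dim n) => (w j).1 :=
    measurable_fst.comp (measurable_pi_apply j)
  have h1 : Measurable fun w : Fin n → Obs (A.dim n) =>
      ∫⁻ y, ENNReal.ofReal (A.splitError n ηbar j φ w y.2 ^ 2) ∂(A.κ n (w j).1) := by
    have h2 : Measurable (Function.uncurry fun (w : Fin n → Obs (A.dim n))
        (y : ℝ × Cov (A.dim n)) => ENNReal.ofReal (A.splitError n ηbar j φ w y.2 ^ 2)) := by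
      have h3 : Measurable fun q : (Fin n → Obs (A.dim n)) × (ℝ × Cov (A.dim n)) =>
          (q.1, q.2.2) := by fun_prop
      exact ((hs.comp h3).pow_const 2).ennreal_ofReal
    exact Measurable.lintegral_kernel_prod_right (κ := (A.κ n).comap _ hx) h2
  refine Measurable.ite ((hx hN).inter (measurableSet_le h1 measurable_const)) ?_ measurable_const
  have h4 : Measurable fun w : Fin n → Obs (A.dim n) => (w, (w j).2.2) := by fun_prop
  exact (hs.comp h4).pow_const 2

/-- Cross-fitting: the estimate used for unit `j` is independent of unit `j`. -/
lemma lintegral_truncError_le [IsProbabilityMeasure μ] {ηbar : Cov (A.dim n) → ℝ} (hη : Measurable ηbar) {N : Set ℝ}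
    (hN : MeasurableSet N) {k m₀ : ℝ} (hk : 0 ≤ k) (hμN : μ N ≤ ENNReal.ofReal m₀) (j : Fin n) :
    ∫⁻ ω, ENNReal.ofReal (A.truncError n ηbar N k j (A.fold n ω, A.sample n ω)) ∂(A.P n)
      ≤ ENNReal.ofReal (k * m₀) := by
  have hm := (A.measurable_truncError hη hN k j).ennreal_ofReal
  have hfs : Measurable fun ω => (A.fold n ω, A.sample n ω) :=
    (A.measurable_fold n).prodMk (A.measurable_sample n)
  have : IsProbabilityMeasure ((A.P n).map (A.fold n)) :=
    Measure.isProbabilityMeasure_map (A.measurable_fold n).aemeasurable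
  rw [← lintegral_map hm hfs, A.map_fold_sample n, lintegral_prod _ hm.aemeasurable]
  -- The split is independent of the sample, so it can be frozen; unit j is then integrated out with
  -- the rest of the sample fixed.
  have hφ : ∀ φ : Fin n → Fin S, ∫⁻ w, ENNReal.ofReal (A.truncError n ηbar N k j (φ, w))
      ∂(Measure.pi fun _ => μ ⊗ₘ A.κ n) ≤ ENNReal.ofReal (k * m₀) := by
    intro φ
    have hmφ : Measurable fun w => ENNReal.ofReal (A.truncError n ηbar N k j (φ, w)) :=
      hm.comp measurable_prodMk_left
    rw [lintegral_pi_resample _ j hmφ]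
    have hw : ∀ w, ∫⁻ o, ENNReal.ofReal (A.truncError n ηbar N k j (φ, Function.update w j o))
        ∂(μ ⊗ₘ A.κ n) ≤ ENNReal.ofReal (k * m₀) := by
      intro w
      -- The estimate is computed outside the fold of j, so replacing unit j leaves it unchanged.
      have hupd : ∀ o, A.splitError n ηbar j φ (Function.update w j o)
          = A.splitError n ηbar j φ w := by
        intro o
        ext z
        have : (fun i : ((Finset.univ.filter fun i => φ i = φ j)ᶜ : Finset (Fin n)) =>
            Function.update w j o (i : Fin n)) =
            fun i : ((Finset.univ.filter fun i => φ i = φ j)ᶜ : Finset (Fin n)) => w i := by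
          ext1 i
          apply Function.update_of_ne
          rintro h
          have := i.2
          rw [h] at this
          simp at this
        simp only [splitError, this]
      refine lintegral_compProd_le hN ?_ hk ?_ ?_ hμN
      · have h5 : Measurable fun o => (φ, Function.update w j o) :=
          measurable_const.prodMk (measurable_update w)
        exact (A.measurable_truncError hη hN k j).comp h5
      · intro x hx y
        simp [truncError, hx]
      · intro x hx
        simp only [truncError, Function.update_self, hupd, hx, true_and]
        split_ifs with hG
        · exact hG
        · simp
    calc _ ≤ ∫⁻ _, ENNReal.ofReal (k * m₀) ∂(Measure.pi fun _ : Fin n => μ ⊗ₘ A.κ n) :=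
          lintegral_mono hw
      _ = _ := by simp
  calc _ ≤ ∫⁻ _, ENNReal.ofReal (k * m₀) ∂((A.P n).map (A.fold n)) := lintegral_mono hφ
    _ = _ := by simp

lemma truncError_nonneg (ηbar : Cov (A.dim n) → ℝ) (N : Set ℝ) (k : ℝ) (j : Fin n)
    (q : (Fin n → Fin S) × (Fin n → Obs (A.dim n))) : 0 ≤ A.truncError n ηbar N k j q := by
  unfold truncError
  split_ifs
  · positivity
  · exact le_rfl

/-- The truncation gives moment bounds without any assumption on the realised estimate. When the
estimate lies in the class with small conditional errors the truncation is inactive, so its cost is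
only the probability of leaving that class. -/
lemma truncError_eq {ηbar : Cov (A.dim n) → ℝ} {N : Set ℝ} {k : ℝ} {j : Fin n} {ω : A.Ω n}
    (hx : A.X n ω j ∈ N)
    (hint : Integrable (fun yz : ℝ × Cov (A.dim n) =>
      (A.etaHat n ω (A.fold n ω j) yz.2 - ηbar yz.2) ^ 2) (A.κ n (A.X n ω j)))
    (hle : ∫ yz, (A.etaHat n ω (A.fold n ω j) yz.2 - ηbar yz.2) ^ 2 ∂(A.κ n (A.X n ω j)) ≤ k) :
    A.truncError n ηbar N k j (A.fold n ω, A.sample n ω) = A.adjError n ηbar ω j ^ 2 := by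
  unfold truncError
  rw [if_pos]
  · rfl
  · refine ⟨hx, ?_⟩
    have := ofReal_integral_eq_lintegral_ofReal hint (ae_of_all _ fun _ => sq_nonneg _)
    exact this.symm.le.trans (ENNReal.ofReal_le_ofReal hle)

end Design

end FlexRD

/-! ### Noise moments and the bound at a fixed sample size -/

namespace FlexRD

universe u

namespace Design

variable {μ : Measure ℝ} {S : ℕ} (A : Design.{u} μ S) {n : ℕ}

/-- The conditionally centred outcome of a unit with running variable in `N`, zero otherwise. -/
noncomputable def noise (ηbar : Cov (A.dim n) → ℝ) (N : Set ℝ) (o : Obs (A.dim n)) : ℝ :=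
  open Classical in if o.1 ∈ N then adj ηbar o.2 - A.condMean n ηbar o.1 else 0

/-- The conditional variance of `Design.noise`. -/
noncomputable def noiseVar (ηbar : Cov (A.dim n) → ℝ) (N : Set ℝ) (x : ℝ) : ℝ :=
  N.indicator (A.condVar n ηbar) x

/-- The outcomes have a fourth conditional moment, at most `B` after centring, on `N`. -/
structure FourthMoment (ηbar : Cov (A.dim n) → ℝ) (N : Set ℝ) (B : ℝ) : Prop where
  measurable : Measurable ηbar
  measurableSet : MeasurableSet N
  nonneg : 0 ≤ B
  memLp : ∀ x ∈ N, MemLp (adj ηbar) 4 (A.κ n x)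
  fourth : ∀ x ∈ N, ∫ yz, (adj ηbar yz - A.condMean n ηbar x) ^ 4 ∂(A.κ n x) ≤ B

namespace FourthMoment

variable {A} {ηbar : Cov (A.dim n) → ℝ} {N : Set ℝ} {B : ℝ}

lemma measurable_adj (h : A.FourthMoment ηbar N B) : Measurable (adj ηbar) :=
  measurable_fst.sub (h.measurable.comp measurable_snd)

lemma measurable_condMean (h : A.FourthMoment ηbar N B) : Measurable (A.condMean n ηbar) :=
  (StronglyMeasurable.integral_kernel h.measurable_adj.stronglyMeasurable).measurable

lemma measurable_centred (h : A.FourthMoment ηbar N B) :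
    Measurable fun o : Obs (A.dim n) => adj ηbar o.2 - A.condMean n ηbar o.1 :=
  (h.measurable_adj.comp measurable_snd).sub (h.measurable_condMean.comp measurable_fst)

lemma condVar_eq (h : A.FourthMoment ηbar N B) (x : ℝ) :
    A.condVar n ηbar x = ∫ yz, (adj ηbar yz - A.condMean n ηbar x) ^ 2 ∂(A.κ n x) :=
  variance_eq_integral h.measurable_adj.aemeasurable

lemma measurable_condVar (h : A.FourthMoment ηbar N B) : Measurable (A.condVar n ηbar) := by
  have h1 : A.condVar n ηbar = fun x =>
      ∫ yz, (adj ηbar yz - A.condMean n ηbar x) ^ 2 ∂(A.κ n x) := funext h.condVar_eq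
  rw [h1]
  exact (StronglyMeasurable.integral_kernel_prod_right
    (f := fun x yz => (adj ηbar yz - A.condMean n ηbar x) ^ 2)
    (h.measurable_centred.pow_const 2).stronglyMeasurable).measurable

lemma measurable_noise (h : A.FourthMoment ηbar N B) : Measurable (A.noise ηbar N) :=
  Measurable.ite (measurable_fst h.measurableSet) h.measurable_centred measurable_const

lemma measurable_noiseVar (h : A.FourthMoment ηbar N B) : Measurable (A.noiseVar ηbar N) :=
  h.measurable_condVar.indicator h.measurableSet

lemma memLp_centred (h : A.FourthMoment ηbar N B) {x : ℝ} (hx : x ∈ N) :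
    MemLp (fun yz => adj ηbar yz - A.condMean n ηbar x) 4 (A.κ n x) :=
  (h.memLp x hx).sub (memLp_const _)

lemma integrable_centred_sq (h : A.FourthMoment ηbar N B) {x : ℝ} (hx : x ∈ N) :
    Integrable (fun yz => (adj ηbar yz - A.condMean n ηbar x) ^ 2) (A.κ n x) :=
  ((h.memLp_centred hx).mono_exponent (by norm_num)).integrable_sq

lemma integrable_centred_fourth (h : A.FourthMoment ηbar N B) {x : ℝ} (hx : x ∈ N) :
    Integrable (fun yz => (adj ηbar yz - A.condMean n ηbar x) ^ 4) (A.κ n x) := by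
  have := (h.memLp_centred hx).integrable_norm_pow (p := 4) (by norm_num)
  refine this.congr (ae_of_all _ fun yz => ?_)
  simp only [Real.norm_eq_abs]
  exact Even.pow_abs (by decide) _

/-- Follows from s² ≤ 1 + s⁴. -/
lemma condVar_le (h : A.FourthMoment ηbar N B) {x : ℝ} (hx : x ∈ N) :
    A.condVar n ηbar x ≤ 1 + B := by
  rw [h.condVar_eq]
  calc _ ≤ ∫ yz, (1 + (adj ηbar yz - A.condMean n ηbar x) ^ 4) ∂(A.κ n x) := by
        refine integral_mono (h.integrable_centred_sq hx)
          ((integrable_const 1).add (h.integrable_centred_fourth hx)) fun yz => ?_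
        simp only
        nlinarith [sq_nonneg ((adj ηbar yz - A.condMean n ηbar x) ^ 2 - 1)]
    _ ≤ 1 + B := by
        rw [integral_add (integrable_const 1) (h.integrable_centred_fourth hx)]
        simpa using h.fourth x hx

lemma condVar_nonneg (ηbar : Cov (A.dim n) → ℝ) (x : ℝ) : 0 ≤ A.condVar n ηbar x :=
  variance_nonneg _ _

lemma noise_of_notMem {x : ℝ} (hx : x ∉ N) (y : ℝ × Cov (A.dim n)) :
    A.noise ηbar N (x, y) = 0 := by simp [noise, hx]

lemma noise_of_mem {x : ℝ} (hx : x ∈ N) (y : ℝ × Cov (A.dim n)) :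
    A.noise ηbar N (x, y) = adj ηbar y - A.condMean n ηbar x := by simp [noise, hx]

lemma integral_noise (h : A.FourthMoment ηbar N B) (x : ℝ) :
    ∫ y, A.noise ηbar N (x, y) ∂(A.κ n x) = 0 := by
  by_cases hx : x ∈ N
  · simp only [noise_of_mem hx]
    rw [integral_sub ((h.memLp x hx).integrable (by norm_num)) (integrable_const _)]
    simp [condMean]
  · simp [noise_of_notMem hx]

lemma integral_noise_sq_sub (h : A.FourthMoment ηbar N B) (x : ℝ) :
    ∫ y, (A.noise ηbar N (x, y) ^ 2 - A.noiseVar ηbar N x) ∂(A.κ n x) = 0 := by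
  by_cases hx : x ∈ N
  · simp only [noise_of_mem hx, noiseVar, Set.indicator_of_mem hx]
    rw [integral_sub (h.integrable_centred_sq hx) (integrable_const _), h.condVar_eq]
    simp
  · simp [noise_of_notMem hx, noiseVar, hx]

lemma lintegral_noise_sq_le (h : A.FourthMoment ηbar N B) {x : ℝ} (hx : x ∈ N) :
    ∫⁻ y, ENNReal.ofReal (A.noise ηbar N (x, y) ^ 2) ∂(A.κ n x) ≤ ENNReal.ofReal (1 + B) := by
  simp only [noise_of_mem hx]
  rw [← ofReal_integral_eq_lintegral_ofReal (h.integrable_centred_sq hx)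
    (ae_of_all _ fun _ => sq_nonneg _), ← h.condVar_eq]
  exact ENNReal.ofReal_le_ofReal (h.condVar_le hx)

lemma lintegral_noise_fourth_le (h : A.FourthMoment ηbar N B) {x : ℝ} (hx : x ∈ N) :
    ∫⁻ y, ENNReal.ofReal (A.noise ηbar N (x, y) ^ 4) ∂(A.κ n x) ≤ ENNReal.ofReal B := by
  simp only [noise_of_mem hx]
  rw [← ofReal_integral_eq_lintegral_ofReal (h.integrable_centred_fourth hx)
    (ae_of_all _ fun _ => Even.pow_nonneg (by decide) _)]
  exact ENNReal.ofReal_le_ofReal (h.fourth x hx)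

/-- Tail bound for the centred quadratic form in the noise. -/
lemma measure_quadForm_ge_le [IsProbabilityMeasure μ] (h : A.FourthMoment ηbar N B) {m₀ : ℝ}
    (hm₀ : 0 ≤ m₀)
    (hμN : μ N ≤ ENNReal.ofReal m₀) {Q : (Fin n → ℝ) → Fin n → Fin n → ℝ}
    (hQ : ∀ j l, Measurable fun x => Q x j l) (hsymm : ∀ x j l, Q x j l = Q x l j) {β : ℝ}
    (hβ : ∀ x j, ∑ l, |Q x j l| ≤ β) {ε : ℝ} (hε : 0 < ε) :
    A.P n {ω | ε ≤ |∑ j, ∑ l, Q (A.X n ω) j l *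
          (A.noise ηbar N (A.W n j ω) * A.noise ηbar N (A.W n l ω))
        - ∑ j, Q (A.X n ω) j j * A.noiseVar ηbar N (A.X n ω j)|}
      ≤ ENNReal.ofReal
        (n * β ^ 2 * (12 * (B * m₀) + 4 * ((1 + B) ^ 2 * m₀)) / ε ^ 2) := by
  have hB := h.nonneg
  obtain ⟨i4, b4⟩ := integral_compProd_le (μ := μ) (κ := A.κ n) h.measurableSet
    (h.measurable_noise.pow_const 4) (fun _ => Even.pow_nonneg (by decide) _) hB hm₀
    (fun x hx y => by simp [noise_of_notMem hx]) (fun x hx => h.lintegral_noise_fourth_le hx) hμN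
  obtain ⟨i2, b2⟩ := integral_compProd_le (μ := μ) (κ := A.κ n) h.measurableSet
    (f := fun o => A.noiseVar ηbar N o.1 ^ 2) (k := (1 + B) ^ 2)
    ((h.measurable_noiseVar.comp measurable_fst).pow_const 2) (fun _ => sq_nonneg _) (by positivity)
    hm₀ (fun x hx y => by simp [noiseVar, hx]) (fun x hx => by
      simp only [noiseVar, Set.indicator_of_mem hx, lintegral_const, measure_univ, mul_one]
      exact ENNReal.ofReal_le_ofReal
        (pow_le_pow_left₀ (condVar_nonneg _ _) (h.condVar_le hx) 2)) hμN
  obtain ⟨hint, hle⟩ := integral_sq_quadForm_le (μ := μ) (κ := A.κ n) h.measurable_noise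
    h.measurable_noiseVar h.integral_noise h.integral_noise_sq_sub i4 b4 i2 b2 hQ hsymm hβ
  have hx : Measurable fun (w : Fin n → Obs (A.dim n)) (i : Fin n) => (w i).1 := by fun_prop
  have hn : ∀ j, Measurable fun w : Fin n → Obs (A.dim n) => A.noise ηbar N (w j) := fun j =>
    h.measurable_noise.comp (measurable_pi_apply j)
  have hm : Measurable fun w : Fin n → Obs (A.dim n) => (∑ j, ∑ l, Q (fun i => (w i).1) j l *
        (A.noise ηbar N (w j) * A.noise ηbar N (w l))
        - ∑ j, Q (fun i => (w i).1) j j * A.noiseVar ηbar N (w j).1) ^ 2 := by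
    refine Measurable.pow_const (Measurable.sub ?_ ?_) 2
    · exact Finset.measurable_sum _ fun j _ => Finset.measurable_sum _ fun l _ =>
        ((hQ j l).comp hx).mul ((hn j).mul (hn l))
    · exact Finset.measurable_sum _ fun j _ => ((hQ j j).comp hx).mul
        (h.measurable_noiseVar.comp (measurable_fst.comp (measurable_pi_apply j)))
  have h1 := measure_ge_le_of_integral_le hint (fun _ => sq_nonneg _) hle (sq_pos_of_pos hε)
  refine le_trans ?_ h1
  rw [← A.map_sample n, Measure.map_apply (A.measurable_sample n)
    (measurableSet_le measurable_const hm)]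
  refine measure_mono fun ω hω => ?_
  have h2 := pow_le_pow_left₀ hε.le hω 2
  rw [sq_abs] at h2
  exact h2

end FourthMoment

/-- Deviation of the rescaled standard error at a fixed sample size. -/
lemma measure_seHatSq_sub_seSq_ge_le [IsProbabilityMeasure μ] {K : ℝ → ℝ} (hK : IsKernelFn K)
    {h : ℕ → ℝ} (hh : 0 < h n) {p R : ℕ} (hR : 1 ≤ R) (v : Fin (p + 1)) {ρ c : ℝ} (hρ : h n ≤ ρ)
    (hc : 0 ≤ c) {T : Set (Cov (A.dim n) → ℝ)} {ηbar : Cov (A.dim n) → ℝ} {B : ℝ}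
    (hB : A.FourthMoment ηbar (Set.Icc (-ρ) ρ) B) (hsupp : Set.Icc (-ρ) ρ ⊆ μ.support)
    {m₀ k : ℝ} (hm₀ : 0 ≤ m₀) (hμN : μ (Set.Icc (-ρ) ρ) ≤ ENNReal.ofReal m₀) (hk : 0 ≤ k)
    (hT : ∀ η ∈ T, ∀ x ∈ Set.Icc (-ρ) ρ,
      Integrable (fun yz : ℝ × Cov (A.dim n) => (η yz.2 - ηbar yz.2) ^ 2) (A.κ n x) ∧
      ∫ yz, (η yz.2 - ηbar yz.2) ^ 2 ∂(A.κ n x) ≤ k) {L : ℝ≥0}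
    (hlip : ∀ D ∈ ({Set.Ioi 0, Set.Iio 0} : Set (Set ℝ)),
      LipschitzOnWith L (A.condMean n ηbar) (μ.support ∩ D) ∧
      LipschitzOnWith L (A.condVar n ηbar) (μ.support ∩ D)) {τ ε : ℝ} (hτ : 0 < τ) (hε : 0 < ε) :
    A.P n {ω | ε ≤ |(n : ℝ) * h n ^ (1 + 2 * (v : ℕ)) *
        (A.seHatSq K h p R v n ω - A.seSq K h p v n ηbar ω)|}
      ≤ Measure.pi (fun _ : Fin n => μ) (goodSample K n R p v (h n) ρ c)ᶜ
        + (∑ s : Fin S, A.P n {ω | A.etaHat n ω s ∉ T})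
        + (ENNReal.ofReal (n * (6 * c) ^ 2 * (12 * (B * m₀) + 4 * ((1 + B) ^ 2 * m₀)) / (ε / 4) ^ 2)
        + (ENNReal.ofReal (τ * (6 * c) * (n * ((1 + B) * m₀)) / (ε / 4))
        + (ENNReal.ofReal ((1 + 1 / τ) * (12 * c) * (n * (k * m₀)) / (ε / 4))
        + ENNReal.ofReal (((1 + 1 / τ) * (8 * (L * ρ) ^ 2 * c) + L * ρ * c) * (n * (1 * m₀))
            / (ε / 4))))) := by
  classical
  set N : Set ℝ := Set.Icc (-ρ) ρ with hN
  have hρ0 : 0 ≤ ρ := hh.le.trans hρ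
  have hβ0 : 0 ≤ L * ρ := mul_nonneg L.2 hρ0
  set G := goodSample K n R p v (h n) ρ c with hG
  have hGm : MeasurableSet G := hK.measurableSet_goodSample n R p v (h n) ρ c
  have hBn := hB.nonneg
  -- Weights are set to zero off the good samples. The row-sum bound then holds for every x, and the
  -- coefficients remain measurable functions of the running variables alone.
  set a : (Fin n → ℝ) → Fin n → ℝ := fun x i =>
    if x ∈ G then n * h n ^ (1 + 2 * (v : ℕ)) * weight K (h n) p v x i ^ 2 else 0 with ha
  have ham : ∀ i, Measurable fun x => a x i := fun i =>
    Measurable.ite hGm (((hK.measurable_weight (h n) p v i).pow_const 2).const_mul _)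
      measurable_const
  have ha0 : ∀ x i, 0 ≤ a x i := by
    intro x i
    simp only [ha]
    split_ifs
    · have := hh.le; positivity
    · exact le_rfl
  have hac : ∀ x i, a x i ≤ c := by
    intro x i
    simp only [ha]
    split_ifs with hx
    · exact hx.2.2.1 i
    · exact hc
  have hinj : ∀ x ∈ G, Function.Injective x := by
    intro x hx i j hij
    by_contra hne
    exact hx.1 i j hne hij
  have hsupport : ∀ x ∈ G, ∀ i, a x i ≠ 0 → |x i| ≤ h n := by
    intro x hx i hi
    by_contra hcon
    apply hi
    simp [ha, hK.weight_eq_zero hh (not_le.1 hcon)]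
  have hcard : ∀ x ∈ G, ∀ i, a x i ≠ 0 → (neighbors R x i).card = R := fun x hx i hi =>
    hx.2.2.2.card_neighbors hh (hsupport x hx i hi)
  set Q : (Fin n → ℝ) → Fin n → Fin n → ℝ := fun x => quadCoef R x (a x) with hQ
  have hQβ : ∀ x j, ∑ l, |Q x j l| ≤ 6 * c := by
    intro x j
    by_cases hx : x ∈ G
    · exact sum_abs_quadCoef_le (hinj x hx) hc (ha0 x) (hac x) (hcard x hx) j
    · have : ∀ l, Q x j l = 0 := fun l => by simp [hQ, quadCoef, ha, hx]
      simp only [this, abs_zero, Finset.sum_const_zero]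
      positivity
  have hquad := hB.measure_quadForm_ge_le hm₀ hμN (Q := Q)
    (fun j l => measurable_quadCoef R ham j l) (fun x j l => quadCoef_symm _ _ _) hQβ
    (show 0 < ε / 4 by positivity)
  have hWm : ∀ j, Measurable fun ω => A.noise ηbar N (A.W n j ω) := fun j =>
    hB.measurable_noise.comp (A.measurable_W n j)
  have hε4 : 0 < ε / 4 := by positivity
  have hb2 := measure_ge_mul_sum_le (P := A.P n)
    (Y := fun j ω => A.noise ηbar N (A.W n j ω) ^ 2) (k := (1 + B) * m₀) (a := τ * (6 * c))
    (fun j => (hWm j).pow_const 2) (fun _ _ => sq_nonneg _) (fun j => by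
      rw [← lintegral_map (f := fun o => ENNReal.ofReal (A.noise ηbar N o ^ 2))
        (hB.measurable_noise.pow_const 2).ennreal_ofReal (A.measurable_W n j), A.map_W n j]
      exact lintegral_compProd_le hB.measurableSet (hB.measurable_noise.pow_const 2) (by positivity)
        (fun x hx y => by simp [FourthMoment.noise_of_notMem hx])
        (fun x hx => hB.lintegral_noise_sq_le hx) hμN) (by positivity) hε4
  have hfs : Measurable fun ω => (A.fold n ω, A.sample n ω) :=
    (A.measurable_fold n).prodMk (A.measurable_sample n)
  have hb3 := measure_ge_mul_sum_le (P := A.P n)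
    (Y := fun j ω => A.truncError n ηbar N k j (A.fold n ω, A.sample n ω)) (k := k * m₀)
    (a := (1 + 1 / τ) * (12 * c))
    (fun j => (A.measurable_truncError hB.measurable hB.measurableSet k j).comp hfs)
    (fun _ _ => A.truncError_nonneg _ _ _ _ _)
    (fun j => A.lintegral_truncError_le hB.measurable hB.measurableSet hk hμN j)
    (by positivity) hε4
  have hind : Measurable (N.indicator fun _ : ℝ => (1 : ℝ)) :=
    measurable_const.indicator hB.measurableSet
  have hb0 := measure_ge_mul_sum_le (P := A.P n)
    (Y := fun j ω => N.indicator (fun _ => (1 : ℝ)) (A.X n ω j)) (k := 1 * m₀)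
    (a := (1 + 1 / τ) * (8 * (L * ρ) ^ 2 * c) + L * ρ * c)
    (fun j => hind.comp (measurable_fst.comp (A.measurable_W n j)))
    (fun _ _ => Set.indicator_nonneg (fun _ _ => zero_le_one) _) (fun j => by
      have hm : Measurable fun o : Obs (A.dim n) => N.indicator (fun _ => (1 : ℝ)) o.1 :=
        hind.comp measurable_fst
      have := lintegral_map (μ := A.P n) hm.ennreal_ofReal (A.measurable_W n j)
      refine this.symm.le.trans ?_
      rw [A.map_W n j]
      exact lintegral_compProd_le hB.measurableSet hm zero_le_one
        (fun x hx y => by simp [hx]) (fun x hx => by simp [hx]) hμN) (by positivity) hε4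
  have hGP : A.P n (A.X n ⁻¹' Gᶜ) = Measure.pi (fun _ : Fin n => μ) Gᶜ := by
    rw [← A.map_X n, Measure.map_apply (A.measurable_X n) hGm.compl]
  -- Off the bad samples and the bad first stages, four error terms remain, and each is allotted
  -- ε/4.
  refine le_trans (measure_mono ?_) ((measure_union_le _ _).trans (add_le_add
    ((measure_union_le _ _).trans (add_le_add hGP.le (measure_iUnion_fintype_le _ _)))
    ((measure_union_le _ _).trans (add_le_add hquad ((measure_union_le _ _).trans
      (add_le_add hb2 ((measure_union_le _ _).trans (add_le_add hb3 hb0))))))))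
  intro ω hω
  by_contra hcon
  simp only [Set.mem_union, not_or, Set.mem_preimage, Set.mem_iUnion, not_exists, Set.mem_compl_iff,
    not_not, Set.mem_ofPred_eq, not_le] at hcon
  obtain ⟨⟨hxG, hTs⟩, hc1, hc2, hc3, hc4⟩ := hcon
  set x := A.X n ω with hx
  set J : Finset (Fin n) := Finset.univ.filter fun i => x i ∈ N with hJ
  have hmemJ : ∀ i, i ∈ J ↔ x i ∈ N := fun i => by simp [hJ]
  have haG : ∀ i, a x i = n * h n ^ (1 + 2 * (v : ℕ)) * weight K (h n) p v x i ^ 2 := fun i => by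
    simp only [ha]; rw [if_pos hxG]
  have hJa : ∀ i, a x i ≠ 0 → (neighbors R x i).card = R ∧ i ∈ J ∧ neighbors R x i ⊆ J := by
    intro i hi
    have hxi := hsupport x hxG i hi
    refine ⟨hcard x hxG i hi, (hmemJ i).2 (abs_le.1 (hxi.trans hρ)), fun l hl => (hmemJ l).2 ?_⟩
    exact abs_le.1 (hxG.2.2.2.abs_le_of_mem_neighbors hh hxi hl)
  have hlipβ : ∀ g : ℝ → ℝ, (∀ D ∈ ({Set.Ioi 0, Set.Iio 0} : Set (Set ℝ)),
      LipschitzOnWith L g (μ.support ∩ D)) → ∀ i, a x i ≠ 0 → ∀ l ∈ neighbors R x i,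
      |g (x l) - g (x i)| ≤ L * ρ := by
    intro g hg i hi l hl
    obtain ⟨-, hiJ, hnb⟩ := hJa i hi
    have hxi : x i ∈ N := (hmemJ i).1 hiJ
    have hxl : x l ∈ N := (hmemJ l).1 (hnb hl)
    have hside := (rival_of_mem_neighbors hl).2
    have hi0 := hxG.2.1 i
    have hl0 := hxG.2.1 l
    -- Neighbours are on the same side of the cutoff and within [-ρ, ρ], so they are at most ρ apart
    -- and the one-sided Lipschitz condition applies.
    have key : ∃ D ∈ ({Set.Ioi 0, Set.Iio 0} : Set (Set ℝ)), x i ∈ D ∧ x l ∈ D ∧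
        |x l - x i| ≤ ρ := by
      rcases lt_or_gt_of_ne hi0 with h0 | h0
      · have hl1 : x l < 0 := by
          by_contra hcc; exact absurd (hside.1 (not_lt.1 hcc)) (not_le.2 h0)
        exact ⟨Set.Iio 0, by simp, h0, hl1, abs_le.2 ⟨by linarith [hxl.1], by linarith [hxi.1]⟩⟩
      · have hl1 : 0 < x l := lt_of_le_of_ne (hside.2 h0.le) hl0.symm
        exact ⟨Set.Ioi 0, by simp, h0, hl1, abs_le.2 ⟨by linarith [hxi.2], by linarith [hxl.2]⟩⟩
    obtain ⟨D, hD, hiD, hlD, hdist⟩ := key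
    have := (hg D hD).dist_le_mul (x l) ⟨hsupp hxl, hlD⟩ (x i) ⟨hsupp hxi, hiD⟩
    rw [Real.dist_eq, Real.dist_eq] at this
    exact this.trans (mul_le_mul_of_nonneg_left hdist L.2)
  -- The decomposition y = m + e - d is needed on J only, where the truncated noise agrees with the
  -- centred outcome.
  have hdet := abs_sum_nnVar_sub_le hR (hinj x hxG) hc (ha0 x) (hac x) J hJa
    (y := A.genOutcome n ω) (m := fun i => A.condMean n ηbar (x i))
    (e := fun i => A.noise ηbar N (A.W n i ω)) (d := A.adjError n ηbar ω)
    (s := fun i => A.noiseVar ηbar N (x i)) (fun i hi => by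
      have hxi : (A.W n i ω).1 ∈ N := (hmemJ i).1 hi
      have : A.noise ηbar N (A.W n i ω) = adj ηbar (A.W n i ω).2 - A.condMean n ηbar (x i) :=
        FourthMoment.noise_of_mem hxi _
      rw [this]
      simp only [genOutcome, adjError, adj]
      ring) hτ
    (hlipβ _ fun D hD => (hlip D hD).1)
    (fun i hi l hl => by
      obtain ⟨-, hiJ, hnb⟩ := hJa i hi
      have := hlipβ _ (fun D hD => (hlip D hD).2) i hi l hl
      simp only [noiseVar]
      rwa [Set.indicator_of_mem ((hmemJ l).1 (hnb hl)), Set.indicator_of_mem ((hmemJ i).1 hiJ)])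
    hβ0
  have hlhs : (n : ℝ) * h n ^ (1 + 2 * (v : ℕ)) *
        (A.seHatSq K h p R v n ω - A.seSq K h p v n ηbar ω)
      = ∑ i, a x i * nnVar R x (A.genOutcome n ω) i
        - ∑ i, a x i * A.noiseVar ηbar N (x i) := by
    rw [seHatSq, seSq, mul_sub, Finset.mul_sum, Finset.mul_sum]
    congr 1
    · exact Finset.sum_congr rfl fun i _ => by rw [haG]; ring
    · refine Finset.sum_congr rfl fun i _ => ?_
      by_cases hi : a x i = 0
      · rw [hi, zero_mul, ← mul_assoc, ← haG, hi, zero_mul]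
      · rw [noiseVar, Set.indicator_of_mem ((hmemJ i).1 (hJa i hi).2.1), haG]; ring
  rw [← hlhs] at hdet
  have hJcard : ∑ j, N.indicator (fun _ => (1 : ℝ)) (x j) = J.card := by
    rw [hJ, Finset.card_filter, Nat.cast_sum]
    exact Finset.sum_congr rfl fun j _ => by by_cases hj : x j ∈ N <;> simp [hj]
  have hd : ∑ l ∈ J, A.adjError n ηbar ω l ^ 2
      ≤ ∑ j, A.truncError n ηbar N k j (A.fold n ω, A.sample n ω) := by
    refine le_trans (le_of_eq ?_) (Finset.sum_le_sum_of_subset_of_nonneg (Finset.subset_univ J)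
      fun j _ _ => A.truncError_nonneg _ _ _ _ _)
    refine Finset.sum_congr rfl fun j hj => ?_
    obtain ⟨h1, h2⟩ := hT _ (hTs (A.fold n ω j)) (x j) ((hmemJ j).1 hj)
    exact (A.truncError_eq ((hmemJ j).1 hj) h1 h2).symm
  have he : ∑ l ∈ J, A.noise ηbar N (A.W n l ω) ^ 2 ≤ ∑ j, A.noise ηbar N (A.W n j ω) ^ 2 :=
    Finset.sum_le_sum_of_subset_of_nonneg (Finset.subset_univ J) fun j _ _ => sq_nonneg _
  rw [hJcard] at hc4
  have hω' : ε ≤ _ := le_trans hω hdet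
  have e1 : τ * (6 * c * ∑ l ∈ J, A.noise ηbar N (A.W n l ω) ^ 2) < ε / 4 := by
    refine lt_of_le_of_lt ?_ hc2
    rw [mul_assoc τ]
    gcongr
  have e2 : (1 + 1 / τ) * (12 * c * ∑ l ∈ J, A.adjError n ηbar ω l ^ 2) < ε / 4 := by
    refine lt_of_le_of_lt ?_ hc3
    rw [mul_assoc (1 + 1 / τ)]
    gcongr
  have e3 : (1 + 1 / τ) * (8 * (L * ρ) ^ 2 * (c * J.card)) + L * ρ * (c * J.card) < ε / 4 := by
    refine lt_of_le_of_lt (le_of_eq ?_) hc4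
    ring
  have e4 : |∑ j, ∑ l, quadCoef R x (a x) j l * (A.noise ηbar N (A.W n j ω) *
      A.noise ηbar N (A.W n l ω)) - ∑ j, quadCoef R x (a x) j j * A.noiseVar ηbar N (x j)|
      < ε / 4 := hc1
  rw [mul_add] at hω'
  linarith

end Design

end FlexRD

/-! ### Choice of rates and conclusion -/

namespace FlexRD

lemma Icc_subset_thickening_window {μ : Measure ℝ} {h ρ δ : ℝ} (hh : 0 ≤ h) (hρδ : ρ - h < δ)
    (hδ : 0 < δ) (hsupp : Set.Icc (-h) h ⊆ μ.support) :
    Set.Icc (-ρ) ρ ⊆ Metric.thickening δ (window μ h) := by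
  intro x hx
  rw [Metric.mem_thickening_iff]
  have hmem : ∀ z ∈ Set.Icc (-h) h, z ∈ window μ h := fun z hz => ⟨hsupp hz, hz⟩
  rcases lt_or_ge h x with h1 | h1
  · refine ⟨h, hmem h ⟨by linarith, le_rfl⟩, ?_⟩
    rw [Real.dist_eq, abs_of_pos (by linarith)]
    linarith [hx.2]
  · rcases lt_or_ge x (-h) with h2 | h2
    · refine ⟨-h, hmem (-h) ⟨le_rfl, by linarith⟩, ?_⟩
      rw [Real.dist_eq, abs_of_neg (by linarith)]
      linarith [hx.1]
    · exact ⟨x, hmem x ⟨h2, h1⟩, by simpa using hδ⟩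

/-- A parameter τ → 0 that dominates s makes the Young factor 1 + 1/τ harmless. -/
lemma one_add_inv_mul_sq_le {s τ : ℝ} (hτ : 0 < τ) (hs : |s| ≤ τ) :
    (1 + 1 / τ) * s ^ 2 ≤ τ ^ 2 + τ := by
  have h1 : s ^ 2 ≤ τ ^ 2 := by
    rw [← sq_abs]; exact pow_le_pow_left₀ (abs_nonneg _) hs 2
  calc (1 + 1 / τ) * s ^ 2 ≤ (1 + 1 / τ) * τ ^ 2 := by gcongr
    _ = τ ^ 2 + τ := by field_simp

end FlexRD

theorem mainTheorem6 {μ : Measure ℝ} [IsProbabilityMeasure μ] {S : ℕ}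
    (A : FlexRD.Design μ S) (K : ℝ → ℝ) (h : ℕ → ℝ) (p R : ℕ) (hR : 1 ≤ R)
    (T : ∀ n, Set (FlexRD.Cov (A.dim n) → ℝ)) (ηbar : ∀ n, FlexRD.Cov (A.dim n) → ℝ)
    (C : ℝ) (hC : 0 < C) (L : ℝ≥0) (q : ℝ) (hq : 2 < q) (B : ℝ) (U : ℕ → Set ℝ)
    (h_first : A.FirstStage T ηbar fun n => FlexRD.window μ (h n))
    (h_deriv : A.SmallDerivatives T ηbar fun n => FlexRD.window μ (h n) \ {0})
    (h_run : FlexRD.RegularRunning μ)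
    (h_kernel : FlexRD.IsKernelFn K)
    (h_band : FlexRD.IsBandwidth h)
    (h_mom : A.RegularMoments ηbar C L q)
    (h_cross : A.CrossFoldNegligible K h p R ηbar)
    (h_window : FlexRD.IsEnlargedWindow μ h U)
    (h_first' : A.FirstStage T ηbar fun n => μ.support ∩ U n)
    (h_fourth : ∀ n, ∀ η ∈ T n, ∀ x ∈ μ.support ∩ U n,
      MemLp (FlexRD.adj η) 4 (A.κ n x) ∧
      ∫ yz, (FlexRD.adj η yz - A.condMean n η x) ^ 4 ∂(A.κ n x) ≤ B)
    (h_lip : ∀ n, ∀ D ∈ ({Set.Ioi 0, Set.Iio 0} : Set (Set ℝ)),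
      LipschitzOnWith L (A.condMean n (ηbar n)) (μ.support ∩ D) ∧
      LipschitzOnWith L (A.condVar n (ηbar n)) (μ.support ∩ D)) :
    ∀ v : Fin (p + 1), A.LittleOP fun n ω =>
      (n : ℝ) * h n ^ (1 + 2 * (v : ℕ)) *
        (A.seHatSq K h p R v n ω - A.seSq K h p v n (ηbar n) ω) := by
  intro v ε hε
  have := h_run.noAtoms
  obtain ⟨r, c, Cf, hμ⟩ := h_run.exists_densityBounds
  obtain ⟨-, δ, hδ, hδU⟩ := h_window
  obtain ⟨rr, hrr, Cc, hcontr⟩ := h_first'.contraction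
  have hCf := hμ.upper_nonneg
  obtain ⟨hpos, hto0, htoinf⟩ := h_band
  -- The sign of B is not assumed; the same applies to `Cc`, hence its absolute value below.
  set B' : ℝ := max B 0 with hB'
  have hB0 : 0 ≤ B' := le_max_right _ _
  -- Going beyond the window by less than δ keeps N inside the enlarged window; going beyond by at
  -- most h/2 keeps its mass O(h). Still n(ρ - h) → ∞, so the shells fill up.
  set ρ : ℕ → ℝ := fun n => h n + min (δ n) (h n) / 2 with hρ
  -- Dominates both the first-stage rate and the bandwidth; the summand h also keeps it positive.
  set τ : ℕ → ℝ := fun n => |rr n| + h n with hτ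
  have hτpos : ∀ n, 0 < τ n := fun n => add_pos_of_nonneg_of_pos (abs_nonneg _) (hpos n)
  have hτ0 : Tendsto τ atTop (𝓝 0) := by
    have := hrr.abs.add hto0
    simpa using this
  have hδpos : ∀ᶠ n in atTop, 0 < δ n := by
    filter_upwards [hδ.eventually_gt_atTop 0] with n hn
    exact pos_of_mul_pos_right hn (Nat.cast_nonneg n)
  have hρle : ∀ n, ρ n ≤ 2 * h n := fun n => by
    have := min_le_right (δ n) (h n)
    have := hpos n
    simp only [hρ]; linarith
  have hsmall : ∀ᶠ n in atTop, 2 * h n < r := by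
    have h2 : Tendsto (fun n => 2 * h n) atTop (𝓝 0) := by simpa using hto0.const_mul 2
    exact h2.eventually_lt_const hμ.pos
  have hgap : Tendsto (fun n : ℕ => n * (ρ n - h n)) atTop atTop := by
    rw [tendsto_atTop]
    intro b
    filter_upwards [hδ.eventually_ge_atTop (2 * b), htoinf.eventually_ge_atTop (2 * b)]
      with n h1 h2
    have h3 : (n : ℝ) * (ρ n - h n) = n * min (δ n) (h n) / 2 := by simp only [hρ]; ring
    have h4 : 2 * b ≤ n * min (δ n) (h n) := by
      rcases min_choice (δ n) (h n) with h5 | h5 <;> rw [h5] <;> assumption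
    linarith
  obtain ⟨c₀, hc₀, hgood⟩ := h_kernel.exists_tendsto_goodSample hμ p R ⟨hpos, hto0, htoinf⟩
    (hsmall.mono fun n hn => (hρle n).trans hn.le) hgap
  -- These constants come from c = c₀/(nh) and mass 4 Cf h: c times n times the mass is free of n
  -- and h, while the quadratic form has one more factor c and keeps 1/(nh). The final 16 and 4 come
  -- from ε/4.
  set D₁ : ℝ := 36 * c₀ ^ 2 * (12 * B' + 4 * (1 + B') ^ 2) * (4 * Cf) * 16 / ε ^ 2 with hD₁
  set D₂ : ℝ := 6 * c₀ * (1 + B') * (4 * Cf) * 4 / ε with hD₂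
  set D₃ : ℝ := 12 * c₀ * |Cc| * (4 * Cf) * 4 / ε with hD₃
  set D₄ : ℝ := c₀ * (4 * Cf) * 4 / ε with hD₄
  have hlim : Tendsto (fun n : ℕ => Measure.pi (fun _ : Fin n => μ)
        (FlexRD.goodSample K n R p v (h n) (ρ n) (c₀ / (n * h n)))ᶜ
      + (∑ s : Fin S, A.P n {ω | A.etaHat n ω s ∉ T n})
      + (ENNReal.ofReal (D₁ / (n * h n)) + (ENNReal.ofReal (D₂ * τ n)
      + (ENNReal.ofReal (D₃ * (τ n ^ 2 + τ n))
      + ENNReal.ofReal (D₄ * (32 * (L : ℝ) ^ 2 * (τ n ^ 2 + τ n) + 2 * L * τ n))))))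
      atTop (𝓝 0) := by
    have l0 : Tendsto (fun n => ∑ s : Fin S, A.P n {ω | A.etaHat n ω s ∉ T n}) atTop (𝓝 0) := by
      have := tendsto_finsetSum Finset.univ fun s (_ : s ∈ Finset.univ) => h_first'.whp s
      simpa using this
    have l1 : Tendsto (fun n : ℕ => D₁ / (n * h n)) atTop (𝓝 0) := htoinf.const_div_atTop D₁
    have l2 : Tendsto (fun n => D₂ * τ n) atTop (𝓝 0) := by simpa using hτ0.const_mul D₂
    have l3' : Tendsto (fun n => τ n ^ 2 + τ n) atTop (𝓝 0) := by simpa using (hτ0.pow 2).add hτ0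
    have l3 : Tendsto (fun n => D₃ * (τ n ^ 2 + τ n)) atTop (𝓝 0) := by
      simpa using l3'.const_mul D₃
    have l4 : Tendsto (fun n => D₄ * (32 * (L : ℝ) ^ 2 * (τ n ^ 2 + τ n) + 2 * L * τ n)) atTop
        (𝓝 0) := by
      simpa using ((l3'.const_mul (32 * (L : ℝ) ^ 2)).add (hτ0.const_mul (2 * (L : ℝ)))).const_mul D₄
    have := ((hgood v).add l0).add ((ENNReal.tendsto_ofReal l1).add
      ((ENNReal.tendsto_ofReal l2).add ((ENNReal.tendsto_ofReal l3).add
      (ENNReal.tendsto_ofReal l4))))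
    simpa using this
  refine tendsto_of_tendsto_of_tendsto_of_le_of_le' tendsto_const_nhds hlim
    (Eventually.of_forall fun _ => zero_le) ?_
  filter_upwards [hcontr, hδpos, hsmall, eventually_gt_atTop 0] with n hcn hδn hrn hn
  have hn' : (0 : ℝ) < n := Nat.cast_pos.2 hn
  have hhn := hpos n
  have hτn := hτpos n
  have hminpos : 0 < min (δ n) (h n) := lt_min hδn hhn
  have hhρ : h n ≤ ρ n := by simp only [hρ]; linarith
  have hρ0 : 0 ≤ ρ n := hhn.le.trans hhρ
  have hNsupp : Set.Icc (-(ρ n)) (ρ n) ⊆ μ.support := fun x hx =>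
    hμ.Ioo_subset_support ⟨by linarith [hx.1, hρle n], by linarith [hx.2, hρle n]⟩
  have hNU : Set.Icc (-(ρ n)) (ρ n) ⊆ μ.support ∩ U n := fun x hx =>
    ⟨hNsupp hx, hδU n ⟨hNsupp hx, FlexRD.Icc_subset_thickening_window hhn.le
      (by have := min_le_left (δ n) (h n); simp only [hρ]; linarith) hδn
      ((Set.Icc_subset_Icc (neg_le_neg hhρ) hhρ).trans hNsupp) hx⟩⟩
  have hfm : A.FourthMoment (ηbar n) (Set.Icc (-(ρ n)) (ρ n)) B' :=
    { measurable := (h_first'.subset n (h_first'.mem n)).1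
      measurableSet := measurableSet_Icc
      nonneg := hB0
      memLp := fun x hx => (h_fourth n _ (h_first'.mem n) x (hNU hx)).1
      fourth := fun x hx =>
        (h_fourth n _ (h_first'.mem n) x (hNU hx)).2.trans (le_max_left _ _) }
  have hμN : μ (Set.Icc (-(ρ n)) (ρ n)) ≤ ENNReal.ofReal (4 * Cf * h n) := by
    refine (hμ.measure_Icc_le ((hρle n).trans hrn.le)).trans (ENNReal.ofReal_le_ofReal ?_)
    have := mul_le_mul_of_nonneg_left (hρle n) hCf
    linarith
  have hbound := A.measure_seHatSq_sub_seSq_ge_le h_kernel hhn hR v hhρ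
    (c := c₀ / (n * h n)) (by positivity) (T := T n) hfm hNsupp
    (m₀ := 4 * Cf * h n) (k := |Cc| * rr n ^ 2) (by positivity) hμN (by positivity)
    (fun η hη x hx => ⟨(hcn η hη x (hNU hx)).1, (hcn η hη x (hNU hx)).2.trans
      (mul_le_mul_of_nonneg_right (le_abs_self Cc) (sq_nonneg _))⟩) (h_lip n) hτn hε
  refine hbound.trans ?_
  refine add_le_add le_rfl (add_le_add ?_ (add_le_add ?_ (add_le_add ?_ ?_)))
  · refine ENNReal.ofReal_le_ofReal (le_of_eq ?_)
    rw [hD₁]; field_simp; ring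
  · refine ENNReal.ofReal_le_ofReal (le_of_eq ?_)
    rw [hD₂]; field_simp
  · refine ENNReal.ofReal_le_ofReal ?_
    have h1 := FlexRD.one_add_inv_mul_sq_le hτn
      (show |rr n| ≤ τ n by simp only [hτ]; linarith)
    have h2 : 0 ≤ D₃ := by positivity
    refine le_trans (le_of_eq ?_) (mul_le_mul_of_nonneg_left h1 h2)
    rw [hD₃]; field_simp
  · refine ENNReal.ofReal_le_ofReal ?_
    have hhτ : h n ≤ τ n := by simp only [hτ]; linarith [abs_nonneg (rr n)]
    have h1 := FlexRD.one_add_inv_mul_sq_le hτn (show |h n| ≤ τ n by rwa [abs_of_pos hhn])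
    have h2 : 0 ≤ D₄ := by positivity
    have hL : (0 : ℝ) ≤ L := L.2
    have h3 : (1 + 1 / τ n) * (8 * (L * ρ n) ^ 2) + L * ρ n
        ≤ 32 * (L : ℝ) ^ 2 * (τ n ^ 2 + τ n) + 2 * L * τ n := by
      have h4 : ρ n ^ 2 ≤ (2 * h n) ^ 2 := pow_le_pow_left₀ hρ0 (hρle n) 2
      have h5 : ρ n ≤ 2 * τ n := (hρle n).trans (by linarith)
      calc (1 + 1 / τ n) * (8 * (L * ρ n) ^ 2) + L * ρ n
          = 8 * (L : ℝ) ^ 2 * ((1 + 1 / τ n) * ρ n ^ 2) + L * ρ n := by ring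
        _ ≤ 8 * (L : ℝ) ^ 2 * ((1 + 1 / τ n) * (2 * h n) ^ 2) + L * (2 * τ n) := by gcongr
        _ = 32 * (L : ℝ) ^ 2 * ((1 + 1 / τ n) * h n ^ 2) + 2 * L * τ n := by ring
        _ ≤ _ := by gcongr
    refine le_trans (le_of_eq ?_) (mul_le_mul_of_nonneg_left h3 h2)
    rw [hD₄]; field_simp
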